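/- **Setting.** Identify $\mathbb{C}^4$ with $\mathbb{H}^2$ by $(z_0,z_1,z_2,z_3)\mapsto(z_0+z_1j,\,z_2+z_3j)$, and let $\pi:S^7\to\mathbb{CP}^3$ be the Hopf fibration. Let $J_\circ$ be the almost complex structure of $\mathbb{CP}^3$ induced by multiplication by $i$, and $g_\circ$ the Fubini–Study metric for which $\pi$ is a Riemannian submersion (holomorphic sectional curvature $4$). Let $\mathcal D_1=d\pi(\mathrm{span}\{jp,kp\})$, let $\mathcal D_2$ be the image under $d\pi$ of the orthogonal complement of $\mathrm{span}\{ip,jp,kp\}$ in $T_pS^7$, and let $P$ be $-1$ on $\mathcal D_1$ and $+1$ on $\mathcal D_2$. The nearly Kähler structure of $\mathbb{CP}^3$ is $J=PJ_\circ$, $g(X,Y)=\tfrac32 g_\circ(X,Y)+\tfrac12 g_\circ(X,PY)$. Put $G=\nabla J$, i.e. $G(X,Y)=(\nabla_XJ)Y$, with $\nabla$ the Levi-Civita connection of $g$. Let $f:M\to\mathbb{CP}^3$ be a smooth immersion of a smooth $2$-manifold which is totally real in the nearly Kähler $\mathbb{CP}^3$: $g(X,JY)=0$ for all tangent vectors $X,Y$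 of $M$. The surface is called *totally real for $J_\circ$* if $g_\circ(X,J_\circ Y)=0$ for all tangent $X,Y$, and *almost complex for Kähler $\mathbb{CP}^3$* if $J_\circ(TM)\subseteq TM$. **Types.** Let $O\subseteq M$ be open. For a smooth $g$-orthonormal frame $U,V$ of $M$ on $O$ and functions $b_i,c_i$ consider $$J_\circ U=b_1V+b_2JU+b_4G(U,V)+b_5JG(U,V),\qquad J_\circ V=-b_1U+c_3JV+c_4G(U,V)+c_5JG(U,V).\quad(*)$$ * $M$ is of *Type 0 on $O$ with function $\lambda$* if there are such a frame and smooth functions $\lambda$, $\theta$ and $\alpha$ on $O$, $\alpha$ with values in $\left]-\tfrac\pi2,\tfrac\pi2\right[$, such that $(*)$ holds on $O$ with $$b_1=\tfrac{\lambda}{1+\lambda^2}(1-\sin\alpha),\quad b_2=\tfrac{\lambda^2+\sin\alpha}{1+\lambda^2},\quad b_4=\tfrac{\cos\alpha\sin\theta}{\sqrt{1+\lambda^2}},\quad b_5=\tfrac{\cos\alpha\cos\theta}{\sqrt{1+\lambda^2}},$$ $$c_3=\tfrac{1+\lambda^2\sin\alpha}{1+\lambda^2},\quad c_4=\tfrac{\lambda\cos\alpha\cos\theta}{\sqrt{1+\lambda^2}},\quad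 c_5=-\tfrac{\lambda\cos\alpha\sin\theta}{\sqrt{1+\lambda^2}}.$$ * $M$ is of *Type 2 on $O$ with function $\alpha$* if there are such a frame and a smooth function $\alpha$ on $O$ such that $(*)$ holds on $O$ with $b_1=\cos\alpha$, $b_2=\sin\alpha$, $c_3=-\sin\alpha$, $b_4=b_5=c_4=c_5=0$. **Proposition.** 1. $M$ is totally real for $J_\circ$ if and only if there is an open dense subset $D\subseteq M$ every point of which has an open neighbourhood $O$ on which $M$ is of Type 0 with $\lambda=0$ identically, or of Type 2 with $\cos\alpha=0$ identically. 2. $M$ is almost complex for Kähler $\mathbb{CP}^3$ if and only if there is an open dense subset $D\subseteq M$ every point of which has an open neighbourhood $O$ on which $M$ is of Type 2 with $\sin\alpha=0$ identically. -/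

import Mathlib

open scoped Manifold ContDiff ComplexConjugate

noncomputable section

namespace NKCP3

/-! ### Complex projective space as a smooth manifold -/

/-- `ℂ⁴` with its standard Hermitian inner product. -/
abbrev C4 : Type := EuclideanSpace ℂ (Fin 4)

/-- The model space of `ℂP³`; it is regarded as a real vector space of dimension six. -/
abbrev C3 : Type := Fin 3 → ℂ

/-- Complex projective three-space: the complex lines in `ℂ⁴`. -/
abbrev CP3 : Type := Projectivization ℂ C4

/-- The quotient map `ℂ⁴ ∖ {0} → ℂP³` (with an irrelevant value at `0`); its restriction to the
unit sphere is the Hopf fibration `S⁷ → ℂP³`. -/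
def hopf (v : C4) : CP3 :=
  open Classical in
  if h : v ≠ 0 then Projectivization.mk ℂ v h
  else Projectivization.mk ℂ (EuclideanSpace.single 0 1) (by simp)

theorem hopf_rep (x : CP3) : hopf x.rep = x := by
  rw [hopf, dif_pos x.rep_nonzero]
  exact Projectivization.mk_rep x

theorem hopf_eq_iff {v w : C4} (hv : v ≠ 0) (hw : w ≠ 0) :
    hopf v = hopf w ↔ ∃ a : ℂ, a • w = v := by
  rw [hopf, hopf, dif_pos hv, dif_pos hw]
  exact Projectivization.mk_eq_mk_iff' ℂ v w hv hw

theorem hopf_smul {a : ℂ} (ha : a ≠ 0) {v : C4} (hv : v ≠ 0) : hopf (a • v) = hopf v :=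
  (hopf_eq_iff (smul_ne_zero ha hv) hv).2 ⟨a, rfl⟩

/-- `ℂP³` carries the quotient topology. -/
instance : TopologicalSpace CP3 :=
  TopologicalSpace.coinduced (fun v : {v : C4 // v ≠ 0} => hopf v) inferInstance

theorem isQuotientMap_hopf :
    Topology.IsQuotientMap (fun v : {v : C4 // v ≠ 0} => hopf v) :=
  ⟨⟨rfl⟩, fun x => ⟨⟨x.rep, x.rep_nonzero⟩, hopf_rep x⟩⟩

theorem exists_smul_rep {v : C4} (hv : v ≠ 0) : ∃ a : ℂ, a ≠ 0 ∧ (hopf v).rep = a • v := by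
  obtain ⟨a, ha⟩ := (hopf_eq_iff (hopf v).rep_nonzero hv).1 (hopf_rep _)
  refine ⟨a, ?_, ha.symm⟩
  rintro rfl
  exact (hopf v).rep_nonzero (by rw [← ha, zero_smul])

/-- A unitary basis of `ℂ⁴`; each of them gives an affine chart of `ℂP³`. -/
abbrev UBasis : Type := OrthonormalBasis (Fin 4) ℂ C4

/-- The affine coordinates `zᵢ = ⟨bᵢ, v⟩ / ⟨b₀, v⟩` of the line through `v`. -/
def affineCoord (b : UBasis) (v : C4) : C3 :=
  fun i => inner ℂ (b i.succ) v / inner ℂ (b 0) v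

/-- The vector `b₀ + ∑ zᵢ bᵢ` with affine coordinates `z`. -/
def affineVec (b : UBasis) (z : C3) : C4 := b 0 + ∑ i, z i • b i.succ

theorem affineCoord_smul (b : UBasis) {a : ℂ} (ha : a ≠ 0) (v : C4) :
    affineCoord b (a • v) = affineCoord b v := by
  funext i
  simp only [affineCoord, inner_smul_right]
  exact mul_div_mul_left _ _ ha

theorem inner_zero_affineVec (b : UBasis) (z : C3) : inner ℂ (b 0) (affineVec b z) = 1 := by
  have h : ∀ i : Fin 3, inner ℂ (b 0) (b i.succ) = 0 := fun i =>
    b.orthonormal.2 (Fin.succ_ne_zero i).symm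
  simp [affineVec, h]

theorem inner_succ_affineVec (b : UBasis) (z : C3) (i : Fin 3) :
    inner ℂ (b i.succ) (affineVec b z) = z i := by
  have h0 : inner ℂ (b i.succ) (b 0) = 0 := b.orthonormal.2 (Fin.succ_ne_zero i)
  have h : ∀ k : Fin 3, inner ℂ (b i.succ) (b k.succ) = if i = k then 1 else 0 := fun k => by
    rw [orthonormal_iff_ite.1 b.orthonormal]
    simp
  simp [affineVec, h, h0]

theorem affineVec_ne_zero (b : UBasis) (z : C3) : affineVec b z ≠ 0 := by
  intro h
  have := inner_zero_affineVec b z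
  simp [h] at this

theorem affineCoord_affineVec (b : UBasis) (z : C3) : affineCoord b (affineVec b z) = z := by
  funext i
  simp [affineCoord, inner_zero_affineVec, inner_succ_affineVec]

theorem smul_affineVec_affineCoord (b : UBasis) {v : C4} (hv : inner ℂ (b 0) v ≠ 0) :
    inner ℂ (b 0) v • affineVec b (affineCoord b v) = v := by
  conv_rhs => rw [← b.sum_repr' v]
  rw [Fin.sum_univ_succ, affineVec, smul_add, Finset.smul_sum]
  congr 1
  refine Finset.sum_congr rfl fun i _ => ?_
  rw [smul_smul, affineCoord, mul_div_cancel₀ _ hv]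

theorem contDiff_affineVec (b : UBasis) : ContDiff ℝ ∞ (affineVec b) := by
  unfold affineVec
  fun_prop

theorem contDiffOn_affineCoord (b : UBasis) :
    ContDiffOn ℝ ∞ (affineCoord b) {v | inner ℂ (b 0) v ≠ 0} := by
  rw [contDiffOn_pi]
  intro i
  have h : ∀ w : C4, ContDiff ℝ ∞ (fun v : C4 => (inner ℂ w v : ℂ)) := fun w =>
    ((innerSL ℂ w).restrictScalars ℝ).contDiff
  simp only [affineCoord, div_eq_mul_inv]
  exact (h _).contDiffOn.mul ((h _).contDiffOn.inv fun v hv => hv)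

theorem isOpen_inner_ne_zero (b : UBasis) : IsOpen {v : C4 | inner ℂ (b 0) v ≠ 0} :=
  isOpen_ne_fun (by fun_prop) (by fun_prop)

/-- The affine chart of `ℂP³` given by a unitary basis `b`: it is defined on the lines not
orthogonal to `b₀`, and its centre is the line through `b₀`. -/
def affineChart (b : UBasis) : OpenPartialHomeomorph CP3 C3 where
  toFun x := affineCoord b x.rep
  invFun z := hopf (affineVec b z)
  source := {x | inner ℂ (b 0) x.rep ≠ 0}
  target := Set.univ
  map_source' _ _ := Set.mem_univ _
  map_target' z _ := by
    obtain ⟨a, ha, h⟩ := exists_smul_rep (affineVec_ne_zero b z)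
    simp [h, inner_zero_affineVec, ha]
  left_inv' x hx := by
    rw [← hopf_smul hx (affineVec_ne_zero b _), smul_affineVec_affineCoord b hx, hopf_rep]
  right_inv' z _ := by
    obtain ⟨a, ha, h⟩ := exists_smul_rep (affineVec_ne_zero b z)
    rw [h, affineCoord_smul b ha, affineCoord_affineVec]
  open_source := by
    rw [← isQuotientMap_hopf.isOpen_preimage]
    have : (fun v : {v : C4 // v ≠ 0} => hopf v) ⁻¹' {x | inner ℂ (b 0) x.rep ≠ 0}
        = Subtype.val ⁻¹' {v : C4 | inner ℂ (b 0) v ≠ 0} := by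
      ext ⟨v, hv⟩
      obtain ⟨a, ha, h⟩ := exists_smul_rep hv
      simp [h, ha]
    rw [this]
    exact (isOpen_inner_ne_zero b).preimage continuous_subtype_val
  open_target := isOpen_univ
  continuousOn_toFun := by
    have hopen : IsOpen {x : CP3 | inner ℂ (b 0) x.rep ≠ 0} := by
      rw [← isQuotientMap_hopf.isOpen_preimage]
      have : (fun v : {v : C4 // v ≠ 0} => hopf v) ⁻¹' {x | inner ℂ (b 0) x.rep ≠ 0}
          = Subtype.val ⁻¹' {v : C4 | inner ℂ (b 0) v ≠ 0} := by
        ext ⟨v, hv⟩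
        obtain ⟨a, ha, h⟩ := exists_smul_rep hv
        simp [h, ha]
      rw [this]
      exact (isOpen_inner_ne_zero b).preimage continuous_subtype_val
    rw [isQuotientMap_hopf.continuousOn_isOpen_iff hopen]
    have h1 : ContinuousOn (fun v : {v : C4 // v ≠ 0} => affineCoord b v)
        {v | inner ℂ (b 0) (v : C4) ≠ 0} :=
      (contDiffOn_affineCoord b).continuousOn.comp continuous_subtype_val.continuousOn
        fun v hv => hv
    have h2 : (fun x : CP3 => affineCoord b x.rep) ∘ (fun v : {v : C4 // v ≠ 0} => hopf v)
        = fun v : {v : C4 // v ≠ 0} => affineCoord b v := by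
      funext ⟨v, hv⟩
      obtain ⟨a, ha, h⟩ := exists_smul_rep hv
      simp [h, affineCoord_smul b ha]
    rw [h2]
    refine h1.mono ?_
    rintro ⟨v, hv⟩ hx
    obtain ⟨a, ha, h⟩ := exists_smul_rep hv
    simpa [h, ha] using hx
  continuousOn_invFun :=
    (isQuotientMap_hopf.continuous.comp
      ((contDiff_affineVec b).continuous.subtype_mk (affineVec_ne_zero b))).continuousOn

theorem exists_adapted_basis (x : CP3) : ∃ b : UBasis, hopf (b 0) = x := by
  have hx := x.rep_nonzero
  have hn : ‖x.rep‖ ≠ 0 := norm_ne_zero_iff.2 hx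
  let u : C4 := ((‖x.rep‖ : ℂ)⁻¹) • x.rep
  have hu : ‖u‖ = 1 := by
    simp [u, norm_smul, hn]
  obtain ⟨b, hb⟩ := Orthonormal.exists_orthonormalBasis_extension_of_card_eq (𝕜 := ℂ)
    (E := C4) (ι := Fin 4) (by simp) (v := fun _ => u) (s := {0})
    ⟨fun _ => hu, fun i j hij => (hij (Subsingleton.elim i j)).elim⟩
  refine ⟨b, ?_⟩
  rw [hb 0 rfl]
  change hopf (((‖x.rep‖ : ℂ)⁻¹) • x.rep) = x
  rw [hopf_smul (inv_ne_zero (by exact_mod_cast hn)) hx, hopf_rep]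

/-- A chosen unitary basis `b` of `ℂ⁴` whose first vector spans the line `x`. -/
def adaptedBasis (x : CP3) : UBasis := (exists_adapted_basis x).choose

theorem hopf_adaptedBasis (x : CP3) : hopf (adaptedBasis x 0) = x :=
  (exists_adapted_basis x).choose_spec

theorem UBasis.ne_zero (b : UBasis) (i : Fin 4) : b i ≠ 0 := b.orthonormal.ne_zero i

/-- The smooth structure of `ℂP³`: all affine charts of unitary bases, where the preferred chart
at `x` is centred at `x`. -/
instance : ChartedSpace C3 CP3 where
  atlas := Set.range affineChart
  chartAt x := affineChart (adaptedBasis x)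
  mem_chart_source x := by
    change inner ℂ (adaptedBasis x 0) x.rep ≠ 0
    obtain ⟨a, ha, h⟩ := exists_smul_rep (UBasis.ne_zero (adaptedBasis x) 0)
    rw [hopf_adaptedBasis] at h
    simp [h, ha]
  chart_mem_atlas x := Set.mem_range_self _

/-- `ℂP³` as a real smooth manifold. -/
instance : IsManifold 𝓘(ℝ, C3) ∞ CP3 := by
  refine isManifold_of_contDiffOn _ _ _ ?_
  rintro _ _ ⟨b, rfl⟩ ⟨b', rfl⟩
  have h : ∀ z : C3, affineCoord b' (hopf (affineVec b z)).rep
      = affineCoord b' (affineVec b z) := fun z => by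
    obtain ⟨a, ha, h⟩ := exists_smul_rep (affineVec_ne_zero b z)
    rw [h, affineCoord_smul b' ha]
  have key : ContDiffOn ℝ ∞ (fun z => affineCoord b' (hopf (affineVec b z)).rep)
      {z | inner ℂ (b' 0) (affineVec b z) ≠ 0} := by
    simp only [h]
    exact (contDiffOn_affineCoord b').comp (contDiff_affineVec b).contDiffOn fun z hz => hz
  refine key.mono ?_
  rintro z ⟨hz, -⟩
  have hz' : inner ℂ (b' 0) (hopf (affineVec b z)).rep ≠ 0 := by
    simpa [affineChart] using hz
  obtain ⟨a, ha, h⟩ := exists_smul_rep (affineVec_ne_zero b z)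
  rw [h, inner_smul_right] at hz'
  exact right_ne_zero_of_mul hz'

/-! ### The tensors of `ℂP³`

Put `q = adaptedBasis x 0`, a point of the unit sphere `S⁷` over `x`. The chart `chartAt C3 x` is
centred at `x` and identifies the tangent space of `ℂP³` at `x` with `C3`. In these terms the
differential of the Hopf fibration at `q` is `hopfPush x`, and `horLift x` is its inverse on the
horizontal space, the Hermitian orthogonal complement of `q` (see `mfderiv_hopf` below). -/

/-- The tangent space of `ℂP³` at `x`. -/
abbrev TCP3 (x : CP3) : Type := TangentSpace 𝓘(ℝ, C3) x

/-- The horizontal lift to the point `adaptedBasis x 0` of `S⁷` of tangent vectors at `x`. -/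
def horLift (x : CP3) : TCP3 x →ₗ[ℝ] C4 where
  toFun X := ∑ i, (X : C3) i • adaptedBasis x i.succ
  map_add' X Y := by
    rw [← Finset.sum_add_distrib]
    exact Finset.sum_congr rfl fun i _ => add_smul _ _ _
  map_smul' c X := by
    rw [Finset.smul_sum]
    exact Finset.sum_congr rfl fun i _ => smul_assoc c ((X : C3) i) _

/-- The differential of the Hopf fibration at the point `adaptedBasis x 0` of `S⁷`. -/
def hopfPush (x : CP3) : C4 →ₗ[ℝ] TCP3 x where
  toFun w := fun i => inner ℂ (adaptedBasis x i.succ) w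
  map_add' _ _ := funext fun _ => inner_add_right _ _ _
  map_smul' c _ := funext fun _ => inner_smul_right_eq_smul _ _ c

theorem hasFDerivAt_affineCoord (b : UBasis) {v : C4} (hv : inner ℂ (b 0) v ≠ 0)
    (h : ∀ i : Fin 3, inner ℂ (b i.succ) v = 0) :
    HasFDerivAt (affineCoord b) (ContinuousLinearMap.pi fun i =>
      (((inner ℂ (b 0) v)⁻¹ • innerSL ℂ (b i.succ) : C4 →L[ℂ] ℂ).restrictScalars ℝ)) v := by
  rw [hasFDerivAt_pi]
  intro i
  have hd : ∀ w : C4, HasFDerivAt (fun v : C4 => (inner ℂ w v : ℂ)) (innerSL ℂ w) v := fun w =>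
    (innerSL ℂ w).hasFDerivAt
  have hinv : DifferentiableAt ℂ (fun v : C4 => (inner ℂ (b 0) v : ℂ)⁻¹) v :=
    (hd (b 0)).differentiableAt.inv hv
  have key := ((hd (b i.succ)).mul hinv.hasFDerivAt).restrictScalars ℝ
  simp only [affineCoord, div_eq_mul_inv]
  refine key.congr_fderiv ?_
  ext w
  simp [h i]

/-- The vector `v` is a multiple of the first vector of the unitary basis adapted to its line. -/
theorem eq_smul_adaptedBasis {v : C4} (hv : v ≠ 0) :
    inner ℂ (adaptedBasis (hopf v) 0) v ≠ 0 ∧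
      v = inner ℂ (adaptedBasis (hopf v) 0) v • adaptedBasis (hopf v) 0 := by
  obtain ⟨a, ha⟩ := (hopf_eq_iff hv (UBasis.ne_zero (adaptedBasis (hopf v)) 0)).1
    (hopf_adaptedBasis _).symm
  have h1 : inner ℂ (adaptedBasis (hopf v) 0) v = a := by
    have h2 : inner ℂ (adaptedBasis (hopf v) 0) (a • adaptedBasis (hopf v) 0) = a := by
      rw [inner_smul_right, inner_self_eq_norm_sq_to_K, (adaptedBasis (hopf v)).orthonormal.1]
      simp
    rwa [ha] at h2
  rw [h1]
  refine ⟨?_, ha.symm⟩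
  rintro rfl
  exact hv (by rw [← ha, zero_smul])

theorem inner_succ_adaptedBasis {v : C4} (hv : v ≠ 0) (i : Fin 3) :
    inner ℂ (adaptedBasis (hopf v) i.succ) v = 0 := by
  have h2 : inner ℂ (adaptedBasis (hopf v) i.succ)
      (inner ℂ (adaptedBasis (hopf v) 0) v • adaptedBasis (hopf v) 0) = 0 := by
    rw [inner_smul_right, (adaptedBasis (hopf v)).orthonormal.2 (Fin.succ_ne_zero i), mul_zero]
  rwa [← (eq_smul_adaptedBasis hv).2] at h2

/-- The quotient map `ℂ⁴ ∖ {0} → ℂP³` is differentiable, and its differential. -/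
theorem hasMFDerivAt_hopf {v : C4} (hv : v ≠ 0) :
    HasMFDerivAt 𝓘(ℝ, C4) 𝓘(ℝ, C3) hopf v
      (ContinuousLinearMap.pi fun i =>
        (((inner ℂ (adaptedBasis (hopf v) 0) v)⁻¹ • innerSL ℂ (adaptedBasis (hopf v) i.succ) :
          C4 →L[ℂ] ℂ).restrictScalars ℝ) : C4 →L[ℝ] C3) := by
  have hev : ∀ᶠ w in nhds v, w ≠ (0 : C4) := isOpen_ne.mem_nhds hv
  refine ⟨?_, ?_⟩
  · have : ContinuousOn hopf {w : C4 | w ≠ 0} :=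
      continuousOn_iff_continuous_domRestrict.2 isQuotientMap_hopf.continuous
    exact this.continuousAt hev
  · have h := hasFDerivAt_affineCoord (adaptedBasis (hopf v)) (eq_smul_adaptedBasis hv).1
      (inner_succ_adaptedBasis hv)
    have h' : writtenInExtChartAt 𝓘(ℝ, C4) 𝓘(ℝ, C3) v hopf
        =ᶠ[nhds v] affineCoord (adaptedBasis (hopf v)) := by
      filter_upwards [hev] with w hw
      obtain ⟨a, ha, hr⟩ := exists_smul_rep hw
      change affineCoord (adaptedBasis (hopf v)) (hopf w).rep = _
      rw [hr, affineCoord_smul _ ha]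
    have h2 := (h.congr_of_eventuallyEq h').hasFDerivWithinAt (s := Set.range 𝓘(ℝ, C4))
    exact h2

/-- `hopfPush x` is the differential of the Hopf fibration at `adaptedBasis x 0`. -/
theorem mfderiv_hopf (x : CP3) (w : C4) :
    (mfderiv 𝓘(ℝ, C4) 𝓘(ℝ, C3) hopf (adaptedBasis x 0) w : C3) = hopfPush x w := by
  have h0 := UBasis.ne_zero (adaptedBasis x) 0
  rw [(hasMFDerivAt_hopf h0).mfderiv]
  funext i
  have h1 : inner ℂ (adaptedBasis x 0) (adaptedBasis x 0) = 1 := by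
    rw [inner_self_eq_norm_sq_to_K, (adaptedBasis x).orthonormal.1]
    simp
  rw [hopf_adaptedBasis, h1]
  change (1 : ℂ)⁻¹ • inner ℂ (adaptedBasis x i.succ) w = inner ℂ (adaptedBasis x i.succ) w
  rw [inv_one, one_smul]

theorem hopfPush_horLift (x : CP3) (X : TCP3 x) : hopfPush x (horLift x X) = X := by
  funext i
  have h : ∀ k : Fin 3, inner ℂ (adaptedBasis x i.succ) (adaptedBasis x k.succ)
      = if i = k then 1 else 0 := fun k => by
    rw [orthonormal_iff_ite.1 (adaptedBasis x).orthonormal]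
    simp
  change inner ℂ (adaptedBasis x i.succ) (∑ k : Fin 3, (X : C3) k • adaptedBasis x k.succ) = _
  simp only [inner_sum, inner_smul_right, h, mul_ite, mul_one, mul_zero]
  exact (Finset.sum_ite_eq Finset.univ i _).trans (if_pos (Finset.mem_univ i))

theorem inner_horLift (x : CP3) (X : TCP3 x) :
    inner ℂ (adaptedBasis x 0) (horLift x X) = 0 := by
  have h : ∀ i : Fin 3, inner ℂ (adaptedBasis x 0) (adaptedBasis x i.succ) = 0 := fun i =>
    (adaptedBasis x).orthonormal.2 (Fin.succ_ne_zero i).symm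
  simp [horLift, h]

theorem horLift_hopfPush (x : CP3) (w : C4) :
    horLift x (hopfPush x w) = w - inner ℂ (adaptedBasis x 0) w • adaptedBasis x 0 := by
  rw [eq_sub_iff_add_eq']
  conv_rhs => rw [← (adaptedBasis x).sum_repr' w]
  rw [Fin.sum_univ_succ]
  rfl

/-- Left multiplication by `j` on `ℂ⁴ = ℍ²`, where `(z₀, z₁, z₂, z₃)` is identified with
`(z₀ + z₁ j, z₂ + z₃ j)`. Left multiplication by `i` is the scalar multiplication by `i`, and left
multiplication by `k = ij` is `v ↦ i • quatJ v`. -/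
def quatJ : C4 →ₗ[ℝ] C4 where
  toFun v := !₂[-conj (v 1), conj (v 0), -conj (v 3), conj (v 2)]
  map_add' v w := by
    ext i
    fin_cases i <;> simp [add_comm]
  map_smul' c v := by
    ext i
    fin_cases i <;> simp

/-- The distribution `D₁`, the image of `span {jq, kq}` under the Hopf fibration. -/
def distD1 (x : CP3) : Submodule ℝ (TCP3 x) :=
  (Submodule.span ℝ {quatJ (adaptedBasis x 0), Complex.I • quatJ (adaptedBasis x 0)}).map
    (hopfPush x)

/-- The distribution `D₂`, the image under the Hopf fibration of the orthogonal complement of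
`span {iq, jq, kq}` in the tangent space of `S⁷` at `q`. -/
def distD2 (x : CP3) : Submodule ℝ (TCP3 x) :=
  Submodule.map (hopfPush x)
    { carrier := {w | inner ℂ (adaptedBasis x 0) w = 0 ∧
        inner ℂ (quatJ (adaptedBasis x 0)) w = 0}
      add_mem' := fun h h' => ⟨by simp [h.1, h'.1],
        by simp [h.2, h'.2]⟩
      zero_mem' := by simp
      smul_mem' := fun c w h => ⟨by rw [inner_smul_right_eq_smul, h.1, smul_zero],
        by rw [inner_smul_right_eq_smul, h.2, smul_zero]⟩ }

theorem inner_quatJ_quatJ (v w : C4) : inner ℂ (quatJ v) (quatJ w) = inner ℂ w v := by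
  simp [quatJ, PiLp.inner_apply, Fin.sum_univ_four]
  ring

theorem inner_quatJ_self (v : C4) : inner ℂ v (quatJ v) = 0 := by
  simp [quatJ, PiLp.inner_apply, Fin.sum_univ_four]
  ring

theorem inner_quatJ_self' (v : C4) : inner ℂ (quatJ v) v = 0 := by
  rw [← inner_conj_symm, inner_quatJ_self, map_zero]

theorem quatJ_smul (c : ℂ) (v : C4) : quatJ (c • v) = conj c • quatJ v := by
  ext i
  fin_cases i <;> simp [quatJ]

/-- The standard almost complex structure `J∘` of `ℂP³`, induced by multiplication by `i`. -/
def kahlerJ (x : CP3) (X : TCP3 x) : TCP3 x := hopfPush x (Complex.I • horLift x X)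

/-- The Fubini-Study metric `g∘` (of constant holomorphic sectional curvature `4`), for which the
Hopf fibration is a Riemannian submersion. -/
def fubiniStudy (x : CP3) (X Y : TCP3 x) : ℝ := (inner ℂ (horLift x X) (horLift x Y)).re

/-- The almost product structure `P`: on the horizontal space it is the reflection which changes
the sign of the complex line spanned by `jq`, so it is `-1` on `D₁` and `1` on `D₂`. -/
def almostProd (x : CP3) (X : TCP3 x) : TCP3 x :=
  hopfPush x (horLift x X -
    (2 * inner ℂ (quatJ (adaptedBasis x 0)) (horLift x X)) • quatJ (adaptedBasis x 0))

theorem norm_quatJ_adaptedBasis (x : CP3) :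
    inner ℂ (quatJ (adaptedBasis x 0)) (quatJ (adaptedBasis x 0)) = 1 := by
  rw [inner_quatJ_quatJ, inner_self_eq_norm_sq_to_K, (adaptedBasis x).orthonormal.1]
  simp

theorem horLift_hopfPush_quatJ (x : CP3) (c : ℂ) :
    horLift x (hopfPush x (c • quatJ (adaptedBasis x 0))) = c • quatJ (adaptedBasis x 0) := by
  rw [horLift_hopfPush, inner_smul_right, inner_quatJ_self, mul_zero, zero_smul, sub_zero]

theorem almostProd_of_mem_distD1 (x : CP3) {A : TCP3 x} (hA : A ∈ distD1 x) :
    almostProd x A = -A := by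
  obtain ⟨w, hw, rfl⟩ := hA
  obtain ⟨a, b, rfl⟩ := Submodule.mem_span_pair.1 hw
  have h : a • quatJ (adaptedBasis x 0) + b • Complex.I • quatJ (adaptedBasis x 0)
      = ((a : ℂ) + b * Complex.I) • quatJ (adaptedBasis x 0) := by
    rw [add_smul, mul_smul, Complex.coe_smul, Complex.coe_smul]
  rw [h, almostProd, horLift_hopfPush_quatJ, inner_smul_right, norm_quatJ_adaptedBasis, ← map_neg]
  congr 1
  module

theorem almostProd_of_mem_distD2 (x : CP3) {X : TCP3 x} (hX : X ∈ distD2 x) :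
    almostProd x X = X := by
  obtain ⟨w, ⟨h0, h1⟩, rfl⟩ := hX
  rw [almostProd, horLift_hopfPush, h0, zero_smul, sub_zero, h1, mul_zero, zero_smul, sub_zero]

/-- The nearly Kähler almost complex structure `J = P J∘`. -/
def nkJ (x : CP3) (X : TCP3 x) : TCP3 x := almostProd x (kahlerJ x X)

/-- The nearly Kähler metric `g(X, Y) = (3/2) g∘(X, Y) + (1/2) g∘(X, P Y)`. -/
def nkMetric (x : CP3) (X Y : TCP3 x) : ℝ :=
  3 / 2 * fubiniStudy x X Y + 1 / 2 * fubiniStudy x X (almostProd x Y)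

theorem nkMetric_eq (x : CP3) (X Y : TCP3 x) :
    nkMetric x X Y = 2 * (inner ℂ (horLift x X) (horLift x Y)).re
      - (inner ℂ (horLift x X) (quatJ (adaptedBasis x 0))
          * inner ℂ (quatJ (adaptedBasis x 0)) (horLift x Y)).re := by
  have h : horLift x (almostProd x Y) = horLift x Y -
      (2 * inner ℂ (quatJ (adaptedBasis x 0)) (horLift x Y)) • quatJ (adaptedBasis x 0) := by
    rw [almostProd, map_sub, map_sub, hopfPush_horLift, horLift_hopfPush_quatJ]
  rw [nkMetric, fubiniStudy, fubiniStudy, h, inner_sub_right, inner_smul_right, Complex.sub_re,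
    mul_assoc, mul_comm (inner ℂ (quatJ (adaptedBasis x 0)) (horLift x Y))]
  simp
  ring

theorem nkMetric_pos (x : CP3) {X : TCP3 x} (hX : X ≠ 0) : 0 < nkMetric x X X := by
  have hw : horLift x X ≠ 0 := fun h => hX (by rw [← hopfPush_horLift x X, h, map_zero])
  have h1 : ‖inner ℂ (quatJ (adaptedBasis x 0)) (horLift x X)‖ ≤ ‖horLift x X‖ := by
    have hq : ‖quatJ (adaptedBasis x 0)‖ = 1 := by
      have h2 : ‖quatJ (adaptedBasis x 0)‖ ^ 2 = 1 := by
        rw [← inner_self_eq_norm_sq (𝕜 := ℂ), norm_quatJ_adaptedBasis]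
        simp
      nlinarith [norm_nonneg (quatJ (adaptedBasis x 0))]
    simpa [hq] using norm_inner_le_norm (𝕜 := ℂ) (quatJ (adaptedBasis x 0)) (horLift x X)
  have h2 : (inner ℂ (horLift x X) (horLift x X)).re = ‖horLift x X‖ ^ 2 := by
    rw [inner_self_eq_norm_sq_to_K]
    norm_cast
  have h3 : (inner ℂ (horLift x X) (quatJ (adaptedBasis x 0))
      * inner ℂ (quatJ (adaptedBasis x 0)) (horLift x X)).re
      = ‖inner ℂ (quatJ (adaptedBasis x 0)) (horLift x X)‖ ^ 2 := by
    rw [← inner_conj_symm (horLift x X), Complex.conj_mul']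
    norm_cast
  rw [nkMetric_eq, h2, h3]
  have := norm_pos_iff.2 hw
  nlinarith [norm_nonneg (inner ℂ (quatJ (adaptedBasis x 0)) (horLift x X))]

/-- The nearly Kähler metric as a bilinear form. -/
def nkForm (x : CP3) : TCP3 x →ₗ[ℝ] TCP3 x →ₗ[ℝ] ℝ :=
  LinearMap.mk₂ ℝ (nkMetric x)
    (fun X X' Y => by simp only [nkMetric_eq, map_add, inner_add_left, add_mul, Complex.add_re]; ring)
    (fun c X Y => by
      simp only [nkMetric_eq, map_smul, inner_smul_left_eq_smul, smul_mul_assoc, Complex.smul_re,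
        smul_eq_mul]; ring)
    (fun X Y Y' => by simp only [nkMetric_eq, map_add, inner_add_right, mul_add, Complex.add_re]; ring)
    (fun c X Y => by
      simp only [nkMetric_eq, map_smul, inner_smul_right_eq_smul, mul_smul_comm, Complex.smul_re,
        smul_eq_mul]; ring)

instance (x : CP3) : FiniteDimensional ℝ (TCP3 x) := inferInstanceAs (FiniteDimensional ℝ C3)

theorem exists_nkMetric_eq (x : CP3) (l : TCP3 x →ₗ[ℝ] ℝ) : ∃ W, ∀ Z, nkMetric x W Z = l Z := by
  have hinj : Function.Injective (nkForm x) := by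
    rw [injective_iff_map_eq_zero]
    intro X hX
    by_contra h
    exact (nkMetric_pos x h).ne' (LinearMap.congr_fun hX X)
  have hsurj : Function.Surjective (nkForm x) :=
    (LinearMap.injective_iff_surjective_of_finrank_eq_finrank
      (Subspace.dual_finrank_eq (K := ℝ) (V := TCP3 x)).symm).1 hinj
  obtain ⟨W, hW⟩ := hsurj l
  exact ⟨W, fun Z => LinearMap.congr_fun hW Z⟩

/-! ### The Levi-Civita connection and the tensor `G = ∇J` -/

/-- The nearly Kähler metric in the affine chart centred at `x`, at the point with coordinates `z`:
it is the pullback of `g` under the inverse of the chart. -/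
def chartMetric (x : CP3) (z Y Z : C3) : ℝ :=
  nkMetric ((chartAt C3 x).symm z)
    (mfderiv 𝓘(ℝ, C3) 𝓘(ℝ, C3) (chartAt C3 x).symm z Y)
    (mfderiv 𝓘(ℝ, C3) 𝓘(ℝ, C3) (chartAt C3 x).symm z Z)

/-- The almost complex structure `J` in the affine chart centred at `x`, at the point with
coordinates `z`. -/
def chartJ (x : CP3) (z Y : C3) : C3 :=
  mfderiv 𝓘(ℝ, C3) 𝓘(ℝ, C3) (chartAt C3 x) ((chartAt C3 x).symm z)
    (nkJ ((chartAt C3 x).symm z) (mfderiv 𝓘(ℝ, C3) 𝓘(ℝ, C3) (chartAt C3 x).symm z Y))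

/-- The linear part `z ↦ ∑ zᵢ bᵢ` of `affineVec b`. -/
def affineLin (b : UBasis) : C3 →L[ℝ] C4 :=
  ∑ i, ((ContinuousLinearMap.proj i : C3 →L[ℂ] ℂ).smulRight (b i.succ)).restrictScalars ℝ

theorem hasFDerivAt_affineVec (b : UBasis) (z : C3) :
    HasFDerivAt (affineVec b) (affineLin b) z := by
  have h : affineVec b = fun z => b 0 + affineLin b z := by
    funext z
    simp [affineVec, affineLin]
  rw [h]
  exact (affineLin b).hasFDerivAt.const_add _

theorem mfderiv_chart_symm (x : CP3) (z Y : C3) :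
    mfderiv 𝓘(ℝ, C3) 𝓘(ℝ, C3) (chartAt C3 x).symm z Y
      = mfderiv 𝓘(ℝ, C4) 𝓘(ℝ, C3) hopf (affineVec (adaptedBasis x) z)
          (affineLin (adaptedBasis x) Y) := by
  have h1 := hasMFDerivAt_hopf (affineVec_ne_zero (adaptedBasis x) z)
  have h2 := (hasFDerivAt_affineVec (adaptedBasis x) z).hasMFDerivAt
  have h3 := (h1.comp z h2).mfderiv
  rw [h1.mfderiv]
  exact congrArg (fun L : C3 →L[ℝ] C3 => L Y) h3

theorem horLift_mfderiv_hopf {v : C4} (hv : v ≠ 0) (w : C4) :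
    horLift (hopf v) (mfderiv 𝓘(ℝ, C4) 𝓘(ℝ, C3) hopf v w)
      = (inner ℂ (adaptedBasis (hopf v) 0) v)⁻¹ •
        (w - inner ℂ (adaptedBasis (hopf v) 0) w • adaptedBasis (hopf v) 0) := by
  have h : mfderiv 𝓘(ℝ, C4) 𝓘(ℝ, C3) hopf v w
      = hopfPush (hopf v) ((inner ℂ (adaptedBasis (hopf v) 0) v)⁻¹ • w) := by
    rw [(hasMFDerivAt_hopf hv).mfderiv]
    funext i
    change _ = inner ℂ (adaptedBasis (hopf v) i.succ) ((inner ℂ (adaptedBasis (hopf v) 0) v)⁻¹ • w)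
    rw [inner_smul_right]
    rfl
  rw [h, horLift_hopfPush, inner_smul_right, smul_sub, smul_smul]

/-- The nearly Kähler metric in terms of vectors of `ℂ⁴ ∖ {0}`. -/
theorem nkMetric_mfderiv_hopf {v : C4} (hv : v ≠ 0) (w w' : C4) :
    nkMetric (hopf v) (mfderiv 𝓘(ℝ, C4) 𝓘(ℝ, C3) hopf v w)
        (mfderiv 𝓘(ℝ, C4) 𝓘(ℝ, C3) hopf v w')
      = 2 * ((inner ℂ w w' : ℂ).re / ‖v‖ ^ 2
          - (inner ℂ w v * inner ℂ v w' : ℂ).re / ‖v‖ ^ 4)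
        - (inner ℂ w (quatJ v) * inner ℂ (quatJ v) w' : ℂ).re / ‖v‖ ^ 4 := by
  obtain ⟨hc, hvc⟩ := eq_smul_adaptedBasis hv
  rw [nkMetric_eq, horLift_mfderiv_hopf hv, horLift_mfderiv_hopf hv]
  have hb := (adaptedBasis (hopf v)).orthonormal.1 0
  generalize adaptedBasis (hopf v) 0 = b at *
  generalize inner ℂ b v = c at *
  subst hvc
  have hbb : inner ℂ b b = (1 : ℂ) := by
    rw [inner_self_eq_norm_sq_to_K, hb]
    simp
  have hn : ‖c • b‖ = ‖c‖ := by rw [norm_smul, hb, mul_one]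
  have hc2 : conj c * c = ((‖c‖ ^ 2 : ℝ) : ℂ) := by
    rw [Complex.conj_mul']
    norm_cast
  have hcn : ‖c‖ ≠ 0 := norm_ne_zero_iff.2 hc
  have hcc : conj c ≠ 0 := (map_ne_zero _).2 hc
  have hr : ∀ (s : ℂ) (k : ℕ), s.re / ‖c‖ ^ k = (s / ((‖c‖ ^ k : ℝ) : ℂ)).re := fun s k => by
    rw [Complex.div_ofReal_re]
  have h4 : ((‖c‖ ^ 4 : ℝ) : ℂ) = (conj c * c) ^ 2 := by
    rw [hc2]
    push_cast
    ring
  rw [hn, hr, hr, hr, h4, ← hc2]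
  simp only [inner_smul_left, inner_smul_right, inner_sub_left, inner_sub_right, quatJ_smul,
    inner_quatJ_self, inner_quatJ_self', hbb, map_inv₀, inner_conj_symm, Complex.conj_conj,
    mul_zero, mul_one, sub_zero, ← Complex.sub_re]
  rw [show (2 : ℝ) = ((2 : ℝ) : ℂ).re from rfl, ← Complex.re_ofReal_mul]
  rw [← Complex.re_ofReal_mul, ← Complex.sub_re, ← Complex.sub_re]
  congr 1
  push_cast
  field_simp
  ring

theorem chartMetric_eq (x : CP3) (z Y Z : C3) :
    chartMetric x z Y Z = nkMetric (hopf (affineVec (adaptedBasis x) z))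
      (mfderiv 𝓘(ℝ, C4) 𝓘(ℝ, C3) hopf (affineVec (adaptedBasis x) z)
        (affineLin (adaptedBasis x) Y))
      (mfderiv 𝓘(ℝ, C4) 𝓘(ℝ, C3) hopf (affineVec (adaptedBasis x) z)
        (affineLin (adaptedBasis x) Z)) := by
  rw [chartMetric, mfderiv_chart_symm, mfderiv_chart_symm]
  rfl

theorem differentiableAt_chartMetric (x : CP3) (z Y Z : C3) :
    DifferentiableAt ℝ (fun z => chartMetric x z Y Z) z := by
  have hv : DifferentiableAt ℝ (affineVec (adaptedBasis x)) z :=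
    (hasFDerivAt_affineVec _ z).differentiableAt
  have hj : DifferentiableAt ℝ (fun z => quatJ (affineVec (adaptedBasis x) z)) z :=
    (LinearMap.toContinuousLinearMap quatJ).differentiableAt.comp z hv
  have hn : DifferentiableAt ℝ (fun z => ‖affineVec (adaptedBasis x) z‖ ^ 2) z := by
    have h : (fun z => ‖affineVec (adaptedBasis x) z‖ ^ 2)
        = fun z => (inner ℂ (affineVec (adaptedBasis x) z) (affineVec (adaptedBasis x) z)).re := by
      funext z
      exact (inner_self_eq_norm_sq (𝕜 := ℂ) _).symm
    rw [h]
    exact Complex.reCLM.differentiableAt.comp z (hv.inner ℂ hv)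
  have hn0 : (fun z => ‖affineVec (adaptedBasis x) z‖ ^ 2) z ≠ 0 :=
    pow_ne_zero 2 (norm_ne_zero_iff.2 (affineVec_ne_zero _ z))
  have hn1 : (fun z => (‖affineVec (adaptedBasis x) z‖ ^ 2) ^ 2) z ≠ 0 := pow_ne_zero 2 hn0
  have e : ∀ r : ℝ, r ^ 4 = (r ^ 2) ^ 2 := fun r => by ring
  simp only [chartMetric_eq, nkMetric_mfderiv_hopf (affineVec_ne_zero _ _), e]
  have c : ∀ w : C4, DifferentiableAt ℝ (fun _ : C3 => w) z := fun w => differentiableAt_const w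
  have h1 := Complex.reCLM.differentiableAt.comp z
    (((c (affineLin (adaptedBasis x) Y)).inner ℂ hv).mul
      (hv.inner ℂ (c (affineLin (adaptedBasis x) Z))))
  have h2 := Complex.reCLM.differentiableAt.comp z
    (((c (affineLin (adaptedBasis x) Y)).inner ℂ hj).mul
      (hj.inner ℂ (c (affineLin (adaptedBasis x) Z))))
  have k0 := (differentiableAt_const (𝕜 := ℝ) (E := C3) (x := z)
    (inner ℂ (affineLin (adaptedBasis x) Y) (affineLin (adaptedBasis x) Z)).re).mul
    (hn.fun_inv hn0)
  have k1 := h1.mul ((hn.fun_pow 2).fun_inv hn1)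
  have k2 := h2.mul ((hn.fun_pow 2).fun_inv hn1)
  simp only [div_eq_mul_inv]
  exact ((k0.fun_sub k1).const_mul 2).fun_sub k2

theorem chartMetric_add (x : CP3) (z Y Z Z' : C3) :
    chartMetric x z Y (Z + Z') = chartMetric x z Y Z + chartMetric x z Y Z' := by
  have h := (nkForm ((chartAt C3 x).symm z)
    (mfderiv 𝓘(ℝ, C3) 𝓘(ℝ, C3) (chartAt C3 x).symm z Y)).map_add
    (mfderiv 𝓘(ℝ, C3) 𝓘(ℝ, C3) (chartAt C3 x).symm z Z)
    (mfderiv 𝓘(ℝ, C3) 𝓘(ℝ, C3) (chartAt C3 x).symm z Z')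
  have h' := (mfderiv 𝓘(ℝ, C3) 𝓘(ℝ, C3) (chartAt C3 x).symm z).map_add Z Z'
  rw [← h'] at h
  exact h

theorem chartMetric_smul (x : CP3) (c : ℝ) (z Y Z : C3) :
    chartMetric x z Y (c • Z) = c * chartMetric x z Y Z := by
  have h := (nkForm ((chartAt C3 x).symm z)
    (mfderiv 𝓘(ℝ, C3) 𝓘(ℝ, C3) (chartAt C3 x).symm z Y)).map_smul c
    (mfderiv 𝓘(ℝ, C3) 𝓘(ℝ, C3) (chartAt C3 x).symm z Z)
  have h' := (mfderiv 𝓘(ℝ, C3) 𝓘(ℝ, C3) (chartAt C3 x).symm z).map_smul c Z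
  rw [← h'] at h
  exact h

/-- The right-hand side `X g(Y, Z) + Y g(X, Z) - Z g(X, Y)` of Koszul's formula at `x` for
vector fields which are constant in the affine chart centred at `x`. -/
def koszul (x : CP3) (X Y Z : C3) : ℝ :=
  fderiv ℝ (fun z => chartMetric x z Y Z) (chartAt C3 x x) X
    + fderiv ℝ (fun z => chartMetric x z X Z) (chartAt C3 x x) Y
    - fderiv ℝ (fun z => chartMetric x z X Y) (chartAt C3 x x) Z

theorem exists_christoffel (x : CP3) (X Y : TCP3 x) :
    ∃ W : TCP3 x, ∀ Z : TCP3 x, 2 * nkMetric x W Z = koszul x X Y Z := by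
  have hadd : ∀ (A B Z Z' : C3),
      fderiv ℝ (fun z => chartMetric x z A (Z + Z')) (chartAt C3 x x) B
        = fderiv ℝ (fun z => chartMetric x z A Z) (chartAt C3 x x) B
          + fderiv ℝ (fun z => chartMetric x z A Z') (chartAt C3 x x) B := fun A B Z Z' => by
    simp only [chartMetric_add]
    rw [fderiv_fun_add (differentiableAt_chartMetric _ _ _ _)
      (differentiableAt_chartMetric _ _ _ _)]
    rfl
  have hsmul : ∀ (c : ℝ) (A B Z : C3),
      fderiv ℝ (fun z => chartMetric x z A (c • Z)) (chartAt C3 x x) B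
        = c * fderiv ℝ (fun z => chartMetric x z A Z) (chartAt C3 x x) B := fun c A B Z => by
    simp only [chartMetric_smul]
    rw [fderiv_const_mul (differentiableAt_chartMetric _ _ _ _)]
    rfl
  let l : C3 →ₗ[ℝ] ℝ :=
    { toFun := fun Z => 1 / 2 * koszul x X Y Z
      map_add' := fun Z Z' => by
        have h1 := hadd Y X Z Z'
        have h2 := hadd X Y Z Z'
        have h3 := (fderiv ℝ (fun z => chartMetric x z X Y) (chartAt C3 x x)).map_add Z Z'
        simp only [koszul]
        linear_combination (1 / 2) * h1 + (1 / 2) * h2 - (1 / 2) * h3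
      map_smul' := fun c Z => by
        have h1 := hsmul c Y X Z
        have h2 := hsmul c X Y Z
        have h3 := (fderiv ℝ (fun z => chartMetric x z X Y) (chartAt C3 x x)).map_smul c Z
        simp only [koszul, smul_eq_mul, RingHom.id_apply] at h3 ⊢
        linear_combination (1 / 2) * h1 + (1 / 2) * h2 - (1 / 2) * h3 }
  obtain ⟨W, hW⟩ := exists_nkMetric_eq x l
  refine ⟨W, fun Z => ?_⟩
  rw [hW]
  change 2 * (1 / 2 * koszul x X Y Z) = _
  ring

/-- The Christoffel symbol `Γ(X, Y)` at `x` of the Levi-Civita connection of `g` in the affine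
chart centred at `x`: the value at `x` of `∇_X Y` for vector fields which are constant in the
chart. By Koszul's formula and non-degeneracy it is determined by
`2 g(Γ(X, Y), Z) = X g(Y, Z) + Y g(X, Z) - Z g(X, Y)`. -/
def christoffel (x : CP3) (X Y : TCP3 x) : TCP3 x := (exists_christoffel x X Y).choose

/-- The tensor `G = ∇J`, that is `G(X, Y) = (∇_X J) Y = ∇_X (J Y) - J (∇_X Y)`, where `∇` is the
Levi-Civita connection of the nearly Kähler metric; it is computed at `x` in the affine chart
centred at `x`. -/
def nablaJ (x : CP3) (X Y : TCP3 x) : TCP3 x :=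
  let DJ : TCP3 x := fderiv ℝ (fun z => chartJ x z Y) (chartAt C3 x x) X
  DJ + christoffel x X (nkJ x Y) - nkJ x (christoffel x X Y)

/-! ### Surfaces in `ℂP³` -/

section Surfaces

variable {M : Type*} [TopologicalSpace M] [ChartedSpace (EuclideanSpace ℝ (Fin 2)) M]

/-- The differential of a map from a surface to `ℂP³`. -/
abbrev surfD (f : M → CP3) (p : M) : TangentSpace (𝓡 2) p →L[ℝ] TCP3 (f p) :=
  mfderiv (𝓡 2) 𝓘(ℝ, C3) f p

/-- `f : M → ℂP³` is a smooth immersion. -/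
structure IsImmersedSurface (f : M → CP3) : Prop where
  smooth : ContMDiff (𝓡 2) 𝓘(ℝ, C3) ∞ f
  injective : ∀ p, Function.Injective (surfD f p)

/-- The surface is totally real in the nearly Kähler `ℂP³`: `J` maps tangent vectors to normal
vectors for `g`. -/
def IsNKTotallyReal (f : M → CP3) : Prop :=
  ∀ (p : M) (X Y : TangentSpace (𝓡 2) p),
    nkMetric (f p) (surfD f p X) (nkJ (f p) (surfD f p Y)) = 0

/-- The surface is totally real in the Kähler `ℂP³`: `J∘` maps tangent vectors to normal vectors
for `g∘`. -/
def IsKahlerTotallyReal (f : M → CP3) : Prop :=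
  ∀ (p : M) (X Y : TangentSpace (𝓡 2) p),
    fubiniStudy (f p) (surfD f p X) (kahlerJ (f p) (surfD f p Y)) = 0

/-- The surface is almost complex in the Kähler `ℂP³`: its tangent spaces are `J∘`-invariant. -/
def IsKahlerAlmostComplex (f : M → CP3) : Prop :=
  ∀ (p : M) (X : TangentSpace (𝓡 2) p), ∃ Y : TangentSpace (𝓡 2) p,
    kahlerJ (f p) (surfD f p X) = surfD f p Y

variable [IsManifold (𝓡 2) ∞ M]

/-- `(U, V)` is a smooth frame of the surface on the open set `O`, orthonormal for the metric
induced by `g`. -/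
structure IsOrthonormalFrameOn (f : M → CP3) (O : Set M)
    (U V : ∀ p : M, TangentSpace (𝓡 2) p) : Prop where
  smooth_fst : ContMDiffOn (𝓡 2) (𝓡 2).tangent ∞
    (fun p => (⟨p, U p⟩ : TangentBundle (𝓡 2) M)) O
  smooth_snd : ContMDiffOn (𝓡 2) (𝓡 2).tangent ∞
    (fun p => (⟨p, V p⟩ : TangentBundle (𝓡 2) M)) O
  fst_fst : ∀ p ∈ O, nkMetric (f p) (surfD f p (U p)) (surfD f p (U p)) = 1
  snd_snd : ∀ p ∈ O, nkMetric (f p) (surfD f p (V p)) (surfD f p (V p)) = 1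
  fst_snd : ∀ p ∈ O, nkMetric (f p) (surfD f p (U p)) (surfD f p (V p)) = 0

/-- At the point `p`, the structure `J∘` is given in terms of `U`, `V`, `JU`, `JV`, `G(U, V)` and
`JG(U, V)` by `J∘ U = b₁ V + b₂ JU + b₄ G(U, V) + b₅ JG(U, V)` and
`J∘ V = -b₁ U + c₃ JV + c₄ G(U, V) + c₅ JG(U, V)`. -/
def KahlerJInFrame (f : M → CP3) (U V : ∀ p : M, TangentSpace (𝓡 2) p) (p : M)
    (b₁ b₂ b₄ b₅ c₃ c₄ c₅ : ℝ) : Prop :=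
  let u := surfD f p (U p)
  let v := surfD f p (V p)
  let J := nkJ (f p)
  let G := nablaJ (f p)
  kahlerJ (f p) u = b₁ • v + b₂ • J u + b₄ • G u v + b₅ • J (G u v) ∧
    kahlerJ (f p) v = -b₁ • u + c₃ • J v + c₄ • G u v + c₅ • J (G u v)

/-- On the open set `O` the surface is of Type 0 with function `lam`: there are a smooth
orthonormal frame and smooth functions `α` (with values in `]-π/2, π/2[`) and `θ` on `O` giving
the coefficients of `J∘`. -/
def IsType0On (f : M → CP3) (O : Set M) (lam : M → ℝ) : Prop :=
  ∃ (U V : ∀ p : M, TangentSpace (𝓡 2) p) (α θ : M → ℝ),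
    IsOrthonormalFrameOn f O U V ∧
    ContMDiffOn (𝓡 2) 𝓘(ℝ, ℝ) ∞ lam O ∧ ContMDiffOn (𝓡 2) 𝓘(ℝ, ℝ) ∞ α O ∧
    ContMDiffOn (𝓡 2) 𝓘(ℝ, ℝ) ∞ θ O ∧
    ∀ p ∈ O, α p ∈ Set.Ioo (-(Real.pi / 2)) (Real.pi / 2) ∧
      KahlerJInFrame f U V p
        (lam p / (1 + lam p ^ 2) * (1 - Real.sin (α p)))
        ((lam p ^ 2 + Real.sin (α p)) / (1 + lam p ^ 2))
        (Real.cos (α p) * Real.sin (θ p) / √(1 + lam p ^ 2))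
        (Real.cos (α p) * Real.cos (θ p) / √(1 + lam p ^ 2))
        ((1 + lam p ^ 2 * Real.sin (α p)) / (1 + lam p ^ 2))
        (lam p * Real.cos (α p) * Real.cos (θ p) / √(1 + lam p ^ 2))
        (-(lam p * Real.cos (α p) * Real.sin (θ p) / √(1 + lam p ^ 2)))

/-- On the open set `O` the surface is of Type 2 with angle function `α`. -/
def IsType2On (f : M → CP3) (O : Set M) (α : M → ℝ) : Prop :=
  ∃ U V : ∀ p : M, TangentSpace (𝓡 2) p,
    IsOrthonormalFrameOn f O U V ∧ ContMDiffOn (𝓡 2) 𝓘(ℝ, ℝ) ∞ α O ∧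
    ∀ p ∈ O, KahlerJInFrame f U V p
      (Real.cos (α p)) (Real.sin (α p)) 0 0 (-Real.sin (α p)) 0 0

/-- `Q` holds on a neighbourhood of every point of some open dense subset of `M`. -/
def LocallyOnOpenDense (Q : Set M → Prop) : Prop :=
  ∃ D : Set M, IsOpen D ∧ Dense D ∧ ∀ p ∈ D, ∃ O : Set M, IsOpen O ∧ p ∈ O ∧ Q O

end Surfaces

end NKCP3

end

namespace NKCP3

/-! ### Tangent vectors of `ℂP³` in terms of vectors of `ℂ⁴` -/

/-! Let σ(u, w) = ⟨ju, w⟩, the complex symplectic form of ℂ⁴. A unit vector v over x identifies the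
tangent space at x with ℂ³ so that g is the standard metric, J is multiplication by i, J∘ is
diag(-i, i, i), and G(X, Y) is i times the conjugate of the cross product X × Y; the first
coordinate of a tangent vector lifted to w is the conjugate of σ(v, w)
(`exists_unitary_coordinates`). An orthonormal pair U, V spanning a totally real plane is then
Hermitian orthonormal, and U, V, G(U, V) is a unitary basis.

Both global properties are conditions on one function β = g(J∘U, V): the surface is totally real for
J∘ iff β = 0, because 4g∘(X, J∘Y) = 3g(X, J∘Y) - g(X, JY), and almost complex iff β² = 1, by the
equality case of Cauchy-Schwarz. If w, w' lift U, V and a = σ(v, w), a' = σ(v, w'), then β = -2 Im(a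
· conj a'). The types give β = 0, resp. β² = 1, on a dense set, and continuity of β along local
lifts extends this to all points (`forall_of_dense`).

Conversely, β² = 1 makes β locally constant, which is Type 2 with α = 0 or π around every point. If
β = 0, then a and a' are real-proportional, so wherever they do not both vanish the frame can be
rotated to a' = 0. Then J∘V = JV, and expanding J∘U in U, V, G(U, V) gives (1 - 2|a|²)JU plus a
complex multiple z of G(U, V) with |z|² = 1 - (1 - 2|a|²)²: Type 0 with λ = 0 and sin α = 1 - 2|a|²
where |a| < 1, Type 2 with sin α = -1 where |a| = 1 on an open set.

An open and dense set remains because a and a' cannot both vanish on a nonempty open set: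
differentiating σ(v, dv) = 0 gives σ(w, w') = 0 (`inner_quatJ_fderiv_eq_zero`), so the first
coordinates of U, V and G(U, V) would all be zero, impossible for a basis. -/

theorem inner_quatJ_antisymm (v w : C4) : inner ℂ (quatJ v) w = -inner ℂ (quatJ w) v := by
  simp [quatJ, PiLp.inner_apply, Fin.sum_univ_four]
  ring

theorem quatJ_quatJ (v : C4) : quatJ (quatJ v) = -v := by
  ext i
  fin_cases i <;> simp [quatJ]

theorem inner_adaptedBasis_self (x : CP3) :
    inner ℂ (adaptedBasis x 0) (adaptedBasis x 0) = (1 : ℂ) := by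
  rw [inner_self_eq_norm_sq_to_K, (adaptedBasis x).orthonormal.1]
  simp

theorem hopfPush_smul_self (x : CP3) (c : ℂ) : hopfPush x (c • adaptedBasis x 0) = 0 := by
  have h : horLift x (hopfPush x (c • adaptedBasis x 0)) = 0 := by
    rw [horLift_hopfPush, inner_smul_right, inner_adaptedBasis_self, mul_one, sub_self]
  rw [← hopfPush_horLift x (hopfPush x _), h, map_zero]

/-- The differential at `v` of the quotient map `ℂ⁴ ∖ {0} → ℂP³`, with values in the tangent space
at `x = hopf v`. -/
noncomputable def pushAt (x : CP3) (v : C4) : C4 →ₗ[ℝ] TCP3 x where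
  toFun w := hopfPush x ((inner ℂ (adaptedBasis x 0) v)⁻¹ • w)
  map_add' w w' := by rw [smul_add, map_add]
  map_smul' c w := by
    rw [smul_comm, map_smul]
    rfl

/-- In `pushAt` the base point is a separate variable, tied to the representative only by a
hypothesis `hopf v = x`; lifts of a surface can thus be used in the tangent space at `f p` without
casts. -/
theorem mfderiv_hopf_eq_pushAt {v : C4} (hv : v ≠ 0) (w : C4) :
    mfderiv 𝓘(ℝ, C4) 𝓘(ℝ, C3) hopf v w = pushAt (hopf v) v w := by
  rw [(hasMFDerivAt_hopf hv).mfderiv]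
  funext i
  change _ = inner ℂ (adaptedBasis (hopf v) i.succ) ((inner ℂ (adaptedBasis (hopf v) 0) v)⁻¹ • w)
  rw [inner_smul_right]
  rfl

variable {x : CP3} {v : C4}

/-- Any representative of x is a nonzero complex multiple of the chosen unit vector, so every
formula at v reduces to the definition of the tensor there. -/
theorem exists_eq_smul_adaptedBasis (hv : v ≠ 0) (hx : hopf v = x) :
    ∃ c : ℂ, c ≠ 0 ∧ v = c • adaptedBasis x 0 ∧ ∀ w, pushAt x v w = hopfPush x (c⁻¹ • w) := by
  subst hx
  obtain ⟨h1, h2⟩ := eq_smul_adaptedBasis hv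
  exact ⟨_, h1, h2, fun w => rfl⟩

theorem pushAt_smul_self (hv : v ≠ 0) (hx : hopf v = x) (c : ℂ) : pushAt x v (c • v) = 0 := by
  obtain ⟨d, hd, rfl, h⟩ := exists_eq_smul_adaptedBasis hv hx
  rw [h, smul_smul, smul_smul, hopfPush_smul_self]

theorem pushAt_adaptedBasis (w : C4) : pushAt x (adaptedBasis x 0) w = hopfPush x w := by
  change hopfPush x ((inner ℂ (adaptedBasis x 0) (adaptedBasis x 0))⁻¹ • w) = _
  rw [inner_adaptedBasis_self, inv_one, one_smul]

theorem exists_pushAt_eq (hv : v ≠ 0) (hx : hopf v = x) (X : TCP3 x) :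
    ∃ w, inner ℂ v w = 0 ∧ pushAt x v w = X := by
  obtain ⟨d, hd, rfl, h⟩ := exists_eq_smul_adaptedBasis hv hx
  refine ⟨d • horLift x X, ?_, ?_⟩
  · rw [inner_smul_left, inner_smul_right, inner_horLift, mul_zero, mul_zero]
  · rw [h, smul_smul, inv_mul_cancel₀ hd, one_smul, hopfPush_horLift]

theorem kahlerJ_pushAt (hv : v ≠ 0) (hx : hopf v = x) (w : C4) :
    kahlerJ x (pushAt x v w) = pushAt x v (Complex.I • w) := by
  obtain ⟨d, hd, rfl, h⟩ := exists_eq_smul_adaptedBasis hv hx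
  rw [h, h, kahlerJ, horLift_hopfPush, smul_sub, map_sub, smul_smul Complex.I _ (adaptedBasis x 0),
    hopfPush_smul_self, sub_zero, smul_comm]

/-- P is the reflection in the complex line of jv. The norm of v is kept because the affine vectors
of the charts are not unit vectors. -/
theorem nkJ_pushAt (hv : v ≠ 0) (hx : hopf v = x) (w : C4) :
    nkJ x (pushAt x v w) = pushAt x v (Complex.I • w -
      (2 * Complex.I * inner ℂ (quatJ v) w / (‖v‖ ^ 2 : ℝ)) • quatJ v) := by
  rw [nkJ, kahlerJ_pushAt hv hx]
  obtain ⟨d, hd, rfl, h⟩ := exists_eq_smul_adaptedBasis hv hx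
  rw [h, h, almostProd, horLift_hopfPush, sub_right_comm, map_sub, hopfPush_smul_self, sub_zero]
  congr 1
  have hn : ((‖d • adaptedBasis x 0‖ ^ 2 : ℝ) : ℂ) = conj d * d := by
    rw [norm_smul, (adaptedBasis x).orthonormal.1, mul_one, Complex.conj_mul']
    norm_cast
  have hc : conj d ≠ 0 := (map_ne_zero _).2 hd
  rw [hn, quatJ_smul, smul_sub, smul_comm d⁻¹ Complex.I w]
  congr 1
  simp only [smul_smul]
  congr 1
  simp only [inner_sub_right, inner_smul_right, inner_smul_left, inner_quatJ_self',
    Complex.conj_conj]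
  field_simp
  ring

theorem nkMetric_pushAt (hv : ‖v‖ = 1) (hx : hopf v = x) (w w' : C4) :
    nkMetric x (pushAt x v w) (pushAt x v w')
      = 2 * (inner ℂ w w' - inner ℂ w v * inner ℂ v w' : ℂ).re
        - (inner ℂ w (quatJ v) * inner ℂ (quatJ v) w' : ℂ).re := by
  have hv0 : v ≠ 0 := fun h => by simp [h] at hv
  subst hx
  rw [← mfderiv_hopf_eq_pushAt hv0, ← mfderiv_hopf_eq_pushAt hv0, nkMetric_mfderiv_hopf hv0, hv]
  simp

theorem nkMetric_add_left (X X' Y : TCP3 x) :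
    nkMetric x (X + X') Y = nkMetric x X Y + nkMetric x X' Y :=
  congrArg (fun l => l Y) ((nkForm x).map_add X X')

theorem nkMetric_smul_left (c : ℝ) (X Y : TCP3 x) :
    nkMetric x (c • X) Y = c * nkMetric x X Y :=
  congrArg (fun l => l Y) ((nkForm x).map_smul c X)

theorem nkMetric_add_right (X Y Y' : TCP3 x) :
    nkMetric x X (Y + Y') = nkMetric x X Y + nkMetric x X Y' :=
  (nkForm x X).map_add Y Y'

theorem nkMetric_smul_right (c : ℝ) (X Y : TCP3 x) :
    nkMetric x X (c • Y) = c * nkMetric x X Y :=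
  (nkForm x X).map_smul c Y

theorem nkMetric_ext {X X' : TCP3 x} (h : ∀ Z, nkMetric x X Z = nkMetric x X' Z) : X = X' := by
  by_contra hne
  have h1 := nkMetric_pos x (sub_ne_zero.2 hne)
  have h2 : nkMetric x (X - X') (X - X') = nkMetric x X (X - X') - nkMetric x X' (X - X') := by
    rw [sub_eq_add_neg X X', ← neg_one_smul ℝ X', nkMetric_add_left, nkMetric_smul_left]
    ring
  rw [h2, h, sub_self] at h1
  exact lt_irrefl _ h1

/-! ### The tensor `G` -/

theorem chartAt_self (x : CP3) : chartAt C3 x x = (0 : C3) := by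
  funext i
  change inner ℂ (adaptedBasis x i.succ) x.rep / inner ℂ (adaptedBasis x 0) x.rep = (0 : ℂ)
  have h := inner_succ_adaptedBasis x.rep_nonzero i
  rw [hopf_rep] at h
  rw [h, zero_div]

theorem inner_affineLin (x : CP3) (Y : C3) :
    inner ℂ (adaptedBasis x 0) (affineLin (adaptedBasis x) Y) = 0 := by
  have h : ∀ i : Fin 3, inner ℂ (adaptedBasis x 0) (adaptedBasis x i.succ) = 0 := fun i =>
    (adaptedBasis x).orthonormal.2 (Fin.succ_ne_zero i).symm
  simp [affineLin, h]

theorem affineLin_eq_horLift (x : CP3) (Y : TCP3 x) :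
    affineLin (adaptedBasis x) Y = horLift x Y := by
  simp [affineLin, horLift]
  rfl

theorem affineVec_smul (x : CP3) (t : ℝ) (X : C3) :
    affineVec (adaptedBasis x) (t • X) = adaptedBasis x 0 + t • affineLin (adaptedBasis x) X := by
  rw [← map_smul]
  simp [affineVec, affineLin, Finset.smul_sum, mul_smul]

/-- The increment is Hermitian orthogonal to the centre, so there is no linear term: normalising
factors do not contribute to first derivatives at the centre of the chart. -/
theorem norm_sq_adaptedBasis_add (x : CP3) (t : ℝ) (X : C3) :
    ‖adaptedBasis x 0 + t • affineLin (adaptedBasis x) X‖ ^ 2 = 1 + t ^ 2 * ‖affineLin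
        (adaptedBasis x) X‖ ^ 2 := by
  rw [← inner_self_eq_norm_sq (𝕜 := ℂ), ← inner_self_eq_norm_sq (𝕜 := ℂ) (affineLin (adaptedBasis
      x) X)]
  have h : inner ℂ (affineLin (adaptedBasis x) X) (adaptedBasis x 0) = (0 : ℂ) := by
    rw [← inner_conj_symm, inner_affineLin, map_zero]
  simp only [inner_add_left, inner_add_right, inner_smul_left_eq_smul, inner_smul_right_eq_smul,
    inner_affineLin, h, inner_adaptedBasis_self, smul_zero, add_zero, zero_add, smul_smul]
  rw [map_add]
  simp [pow_two]

/-- The derivatives of the metric at the centre of the chart. -/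
theorem fderiv_chartMetric (x : CP3) (X Y Z : C3) :
    fderiv ℝ (fun z => chartMetric x z Y Z) (chartAt C3 x x) X
      = -(inner ℂ (affineLin (adaptedBasis x) Y) (quatJ (affineLin (adaptedBasis x) X))
            * inner ℂ (quatJ (adaptedBasis x 0)) (affineLin (adaptedBasis x) Z)
          + inner ℂ (affineLin (adaptedBasis x) Y) (quatJ (adaptedBasis x 0))
            * inner ℂ (quatJ (affineLin (adaptedBasis x) X)) (affineLin (adaptedBasis x) Z) : ℂ).re
                := by
  have hd := (differentiableAt_chartMetric x (0 : C3) Y Z).hasFDerivAt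
  have hl : HasDerivAt (fun t : ℝ => t • (X : C3)) X 0 := by
    simpa using (hasDerivAt_id (0 : ℝ)).smul_const (X : C3)
  have hd' : HasFDerivAt (fun z => chartMetric x z Y Z)
      (fderiv ℝ (fun z => chartMetric x z Y Z) (0 : C3)) ((0 : ℝ) • (X : C3)) := by
    rw [zero_smul]; exact hd
  have h1 := hd'.comp_hasDerivAt (0 : ℝ) hl
  rw [chartAt_self]
  refine h1.unique ?_
  have hX : inner ℂ (affineLin (adaptedBasis x) Y) (adaptedBasis x 0) = (0 : ℂ) := by
    rw [← inner_conj_symm, inner_affineLin, map_zero]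
  -- Along the ray tX everything is explicit in t. Only the term with jv has a part linear in t; the
  -- norm and the vertical correction are of second order.
  have hf : ((fun z => chartMetric x z Y Z) ∘ fun t : ℝ => t • (X : C3)) = fun t : ℝ =>
      2 * ((inner ℂ (affineLin (adaptedBasis x) Y) (affineLin (adaptedBasis x) Z) : ℂ).re / (1 + t
          ^ 2 * ‖affineLin (adaptedBasis x) X‖ ^ 2)
        - t ^ 2 * (inner ℂ (affineLin (adaptedBasis x) Y) (affineLin (adaptedBasis x) X) * inner ℂ
            (affineLin (adaptedBasis x) X) (affineLin (adaptedBasis x) Z) : ℂ).re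
          / (1 + t ^ 2 * ‖affineLin (adaptedBasis x) X‖ ^ 2) ^ 2)
      - ((inner ℂ (affineLin (adaptedBasis x) Y) (quatJ (adaptedBasis x 0))
            * inner ℂ (quatJ (adaptedBasis x 0)) (affineLin (adaptedBasis x) Z) : ℂ).re
          + t * (inner ℂ (affineLin (adaptedBasis x) Y) (quatJ (affineLin (adaptedBasis x) X))
            * inner ℂ (quatJ (adaptedBasis x 0)) (affineLin (adaptedBasis x) Z)
          + inner ℂ (affineLin (adaptedBasis x) Y) (quatJ (adaptedBasis x 0))
            * inner ℂ (quatJ (affineLin (adaptedBasis x) X)) (affineLin (adaptedBasis x) Z) : ℂ).re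
          + t ^ 2 * (inner ℂ (affineLin (adaptedBasis x) Y) (quatJ (affineLin (adaptedBasis x) X))
            * inner ℂ (quatJ (affineLin (adaptedBasis x) X)) (affineLin (adaptedBasis x) Z) : ℂ).re)
        / (1 + t ^ 2 * ‖affineLin (adaptedBasis x) X‖ ^ 2) ^ 2 := by
    funext t
    have e : ∀ r : ℝ, r ^ 4 = (r ^ 2) ^ 2 := fun r => by ring
    simp only [Function.comp]
    rw [chartMetric_eq, nkMetric_mfderiv_hopf (affineVec_ne_zero _ _), affineVec_smul, e,
        norm_sq_adaptedBasis_add]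
    congr 1
    · congr 3
      simp only [inner_add_left, inner_add_right, inner_smul_left_eq_smul,
        inner_smul_right_eq_smul, inner_affineLin, hX, zero_add, smul_mul_smul_comm,
            Complex.smul_re,
        smul_eq_mul, pow_two]
    · congr 1
      simp only [map_add, map_smul, inner_add_left, inner_add_right, inner_smul_left_eq_smul,
        inner_smul_right_eq_smul, add_mul, mul_add, smul_mul_assoc, mul_smul_comm, Complex.add_re,
        Complex.smul_re, smul_eq_mul]
      ring
  rw [hf]
  have hn : HasDerivAt (fun t : ℝ => 1 + t ^ 2 * ‖affineLin (adaptedBasis x) X‖ ^ 2) 0 0 := by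
    simpa using (((hasDerivAt_id (0 : ℝ)).fun_pow 2).mul_const (‖affineLin (adaptedBasis x) X‖ ^
        2)).const_add 1
  have hs : HasDerivAt (fun t : ℝ => t ^ 2) 0 0 := by
    simpa using (hasDerivAt_id (0 : ℝ)).fun_pow 2
  have hn2 : HasDerivAt (fun t : ℝ => (1 + t ^ 2 * ‖affineLin (adaptedBasis x) X‖ ^ 2) ^ 2) 0 0 :=
      by
    simpa using hn.fun_pow 2
  generalize (inner ℂ (affineLin (adaptedBasis x) Y) (affineLin (adaptedBasis x) Z) : ℂ).re = A
  generalize (inner ℂ (affineLin (adaptedBasis x) Y) (affineLin (adaptedBasis x) X) * inner ℂ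
      (affineLin (adaptedBasis x) X) (affineLin (adaptedBasis x) Z) : ℂ).re = B
  generalize (inner ℂ (affineLin (adaptedBasis x) Y) (quatJ (adaptedBasis x 0))
            * inner ℂ (quatJ (adaptedBasis x 0)) (affineLin (adaptedBasis x) Z) : ℂ).re = C
  generalize (inner ℂ (affineLin (adaptedBasis x) Y) (quatJ (affineLin (adaptedBasis x) X))
            * inner ℂ (quatJ (adaptedBasis x 0)) (affineLin (adaptedBasis x) Z)
          + inner ℂ (affineLin (adaptedBasis x) Y) (quatJ (adaptedBasis x 0))
            * inner ℂ (quatJ (affineLin (adaptedBasis x) X)) (affineLin (adaptedBasis x) Z) : ℂ).re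
                = D
  generalize (inner ℂ (affineLin (adaptedBasis x) Y) (quatJ (affineLin (adaptedBasis x) X))
            * inner ℂ (quatJ (affineLin (adaptedBasis x) X)) (affineLin (adaptedBasis x) Z) : ℂ).re
                = E
  have k1 := ((hasDerivAt_const (0 : ℝ) A).fun_div hn (by simp))
  have k2 := ((hs.mul_const B).fun_div hn2 (by simp))
  have k3 := (((hasDerivAt_const (0 : ℝ) C).fun_add ((hasDerivAt_id (0 : ℝ)).mul_const D)).fun_add
    (hs.mul_const E)).fun_div hn2 (by simp)
  have k := ((k1.fun_sub k2).const_mul 2).fun_sub k3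
  simpa using k

/-- Antisymmetry of ⟨j·, ·⟩ cancels the two terms that contain ⟨jX, Y⟩ and makes the remaining four
equal in pairs, whence the factor 2. -/
theorem koszul_eq (x : CP3) (X Y Z : C3) :
    koszul x X Y Z = 2 * (-(inner ℂ
      (inner ℂ (quatJ (adaptedBasis x 0)) (affineLin (adaptedBasis x) Y) •
          quatJ (affineLin (adaptedBasis x) X)
        + inner ℂ (quatJ (adaptedBasis x 0)) (affineLin (adaptedBasis x) X) •
          quatJ (affineLin (adaptedBasis x) Y))
      (affineLin (adaptedBasis x) Z) : ℂ).re) := by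
  have e : ∀ A B : C4, inner ℂ A (quatJ B) = conj (inner ℂ (quatJ B) A) := fun A B => by
    rw [inner_conj_symm]
  rw [koszul, fderiv_chartMetric, fderiv_chartMetric, fderiv_chartMetric]
  generalize affineLin (adaptedBasis x) X = X'
  generalize affineLin (adaptedBasis x) Y = Y'
  generalize affineLin (adaptedBasis x) Z = Z'
  simp only [inner_add_left, inner_smul_left, e]
  rw [inner_quatJ_antisymm Y' X', inner_quatJ_antisymm Z' X', inner_quatJ_antisymm Z' Y']
  simp only [map_neg, Complex.add_re, Complex.mul_re, Complex.neg_re, Complex.neg_im,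
    Complex.conj_re, Complex.conj_im]
  ring

/-- The Christoffel symbols at the centre of the chart. -/
theorem christoffel_eq (x : CP3) (X Y : TCP3 x) :
    christoffel x X Y = hopfPush x (-(1 / 2 : ℝ) •
      (inner ℂ (quatJ (adaptedBasis x 0)) (horLift x Y) • quatJ (horLift x X)
        + inner ℂ (quatJ (adaptedBasis x 0)) (horLift x X) • quatJ (horLift x Y))) := by
  refine nkMetric_ext fun Z => ?_
  have h := (exists_christoffel x X Y).choose_spec Z
  change 2 * nkMetric x (christoffel x X Y) Z = _ at h
  have hk := koszul_eq x X Y Z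
  rw [affineLin_eq_horLift, affineLin_eq_horLift, affineLin_eq_horLift] at hk
  rw [hk] at h
  have h' := mul_left_cancel₀ two_ne_zero h
  rw [h', nkMetric_eq, horLift_hopfPush]
  -- The candidate vector is orthogonal to jq, so the correction term of g drops out and g is twice
  -- the Hermitian real part.
  have h0 : ∀ A : TCP3 x, inner ℂ (quatJ (horLift x A)) (quatJ (adaptedBasis x 0)) = (0 : ℂ) :=
    fun A => by rw [inner_quatJ_quatJ, inner_horLift]
  simp only [inner_sub_left, inner_smul_left_eq_smul, inner_add_left, inner_smul_left,
    inner_horLift, h0, inner_quatJ_self, mul_zero, smul_zero, sub_zero, add_zero, zero_mul,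
    Complex.smul_re, smul_eq_mul, Complex.zero_re]
  ring

/-- The quotient rule at the vectors normalised by ⟨b₀, v⟩ = 1, as affine vectors are.
Differentiating J requires it at points away from the centre of the chart, where the components ⟨bᵢ,
v⟩ need not vanish. -/
theorem hasFDerivAt_affineCoord_apply (b : UBasis) {v : C4} (hv : inner ℂ (b 0) v = 1) : ∃ L : C4
    →L[ℝ] C3, HasFDerivAt (affineCoord b) L v ∧
      ∀ u i, L u i = inner ℂ (b i.succ) u - inner ℂ (b i.succ) v * inner ℂ (b 0) u := by
  have hd : ∀ w : C4, HasFDerivAt (fun v : C4 => (inner ℂ w v : ℂ)) (innerSL ℂ w) v := fun w =>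
    (innerSL ℂ w).hasFDerivAt
  refine ⟨ContinuousLinearMap.pi fun i => ((innerSL ℂ (b i.succ) -
    inner ℂ (b i.succ) v • innerSL ℂ (b 0) : C4 →L[ℂ] ℂ).restrictScalars ℝ), ?_, fun u i => rfl⟩
  rw [hasFDerivAt_pi]
  intro i
  have hinv := (hasDerivAt_inv (x := (inner ℂ (b 0) v : ℂ))
    (by rw [hv]; exact one_ne_zero)).comp_hasFDerivAt v (hd (b 0))
  have key := (((hd (b i.succ)).mul hinv).restrictScalars ℝ)
  simp only [affineCoord, div_eq_mul_inv]
  refine key.congr_fderiv ?_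
  ext w
  simp [hv]
  ring

/-- The almost complex structure in the chart centred at `x`. -/
theorem chartJ_apply (x : CP3) (z Y : C3) (i : Fin 3) :
    chartJ x z Y i = Complex.I * Y i -
      2 * Complex.I * inner ℂ (quatJ (affineVec (adaptedBasis x) z)) (affineLin (adaptedBasis x) Y)
        / (‖affineVec (adaptedBasis x) z‖ ^ 2 : ℝ)
      * (inner ℂ (adaptedBasis x i.succ) (quatJ (affineVec (adaptedBasis x) z))
        - z i * inner ℂ (adaptedBasis x 0) (quatJ (affineVec (adaptedBasis x) z))) := by
  set b := adaptedBasis x with hb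
  have hv := affineVec_ne_zero b z
  obtain ⟨L, hL, hL'⟩ := hasFDerivAt_affineCoord_apply b (inner_zero_affineVec b z)
  -- The chart composed with the quotient map is the affine coordinate map, so by the chain rule the
  -- differential of the chart need not be computed on its own.
  have h1 : ∀ u, mfderiv 𝓘(ℝ, C3) 𝓘(ℝ, C3) (chartAt C3 x) (hopf (affineVec b z))
      (mfderiv 𝓘(ℝ, C4) 𝓘(ℝ, C3) hopf (affineVec b z) u) = L u := by
    intro u
    have hsrc : hopf (affineVec b z) ∈ (chartAt C3 x).source :=
      (chartAt C3 x).map_target (Set.mem_univ z)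
    have k1 := (mdifferentiableAt_atlas (I := 𝓘(ℝ, C3)) (chart_mem_atlas C3 x) hsrc).hasMFDerivAt
    have k2 := (hasMFDerivAt_hopf hv)
    have k3 := k1.comp _ k2
    have k4 : HasMFDerivAt 𝓘(ℝ, C4) 𝓘(ℝ, C3) (chartAt C3 x ∘ hopf) (affineVec b z) L := by
      refine hL.hasMFDerivAt.congr_of_eventuallyEq ?_
      filter_upwards [isOpen_ne.mem_nhds hv] with w hw
      obtain ⟨a, ha, hr⟩ := exists_smul_rep hw
      change affineCoord b (hopf w).rep = _
      rw [hr, affineCoord_smul _ ha]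
    rw [k2.mfderiv]
    exact congrArg (fun l : C4 →L[ℝ] C3 => l u) (k3.mfderiv.symm.trans k4.mfderiv)
  have h2 : chartJ x z Y = L (Complex.I • affineLin b Y - (2 * Complex.I * inner ℂ
      (quatJ (affineVec b z)) (affineLin b Y) / (‖affineVec b z‖ ^ 2 : ℝ)) •
        quatJ (affineVec b z)) := by
    refine Eq.trans ?_ (h1 _)
    rw [mfderiv_hopf_eq_pushAt hv, ← nkJ_pushAt hv rfl, ← mfderiv_hopf_eq_pushAt hv,
      ← mfderiv_chart_symm]
    rfl
  rw [h2, hL', inner_succ_affineVec]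
  have h3 : inner ℂ (b i.succ) (affineLin b Y) = Y i := by
    have := inner_succ_affineVec b Y i
    rwa [show affineVec b Y = b 0 + affineLin b Y by simp [affineVec, affineLin], inner_add_right,
      b.orthonormal.2 (Fin.succ_ne_zero i), zero_add] at this
  have h4 : inner ℂ (b 0) (affineLin b Y) = 0 := inner_affineLin x Y
  simp only [inner_sub_right, inner_smul_right, h3, h4]
  ring

theorem differentiableAt_chartJ (x : CP3) (z Y : C3) :
    DifferentiableAt ℝ (fun z => chartJ x z Y) z := by
  have hv : DifferentiableAt ℝ (affineVec (adaptedBasis x)) z :=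
    (hasFDerivAt_affineVec _ z).differentiableAt
  have hj : DifferentiableAt ℝ (fun z => quatJ (affineVec (adaptedBasis x) z)) z :=
    (LinearMap.toContinuousLinearMap quatJ).differentiableAt.comp z hv
  have hn : DifferentiableAt ℝ
      (fun z => ((‖affineVec (adaptedBasis x) z‖ ^ 2 : ℝ) : ℂ)) z := by
    have h : (fun z => ((‖affineVec (adaptedBasis x) z‖ ^ 2 : ℝ) : ℂ))
        = fun z => inner ℂ (affineVec (adaptedBasis x) z) (affineVec (adaptedBasis x) z) := by
      funext z
      rw [inner_self_eq_norm_sq_to_K]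
      norm_cast
    rw [h]
    exact hv.inner ℂ hv
  have hn0 : (fun z => ((‖affineVec (adaptedBasis x) z‖ ^ 2 : ℝ) : ℂ)) z ≠ 0 :=
    Complex.ofReal_ne_zero.2 (pow_ne_zero 2 (norm_ne_zero_iff.2 (affineVec_ne_zero _ z)))
  have c : ∀ w : C4, DifferentiableAt ℝ (fun _ : C3 => w) z := fun w => differentiableAt_const w
  rw [differentiableAt_pi]
  intro i
  simp only [chartJ_apply, div_eq_mul_inv]
  have hz : DifferentiableAt ℝ (fun z : C3 => z i) z := differentiableAt_apply i z
  exact (((hj.inner ℂ (c _)).const_mul _).mul (hn.fun_inv hn0)).mul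
    (((c _).inner ℂ hj).sub (hz.mul ((c _).inner ℂ hj))) |>.const_sub _

/-- The derivative of the almost complex structure at the centre of the chart. -/
theorem fderiv_chartJ (x : CP3) (X Y : C3) :
    fderiv ℝ (fun z => chartJ x z Y) (chartAt C3 x x) X = hopfPush x (-(2 * Complex.I) •
      (inner ℂ (quatJ (affineLin (adaptedBasis x) X)) (affineLin (adaptedBasis x) Y) •
          quatJ (adaptedBasis x 0)
        + inner ℂ (quatJ (adaptedBasis x 0)) (affineLin (adaptedBasis x) Y) •
          quatJ (affineLin (adaptedBasis x) X))) := by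
  have hd := (differentiableAt_chartJ x (0 : C3) Y).hasFDerivAt
  have hl : HasDerivAt (fun t : ℝ => t • X) X 0 := by
    simpa using (hasDerivAt_id (0 : ℝ)).smul_const X
  have hd' : HasFDerivAt (fun z => chartJ x z Y)
      (fderiv ℝ (fun z => chartJ x z Y) (0 : C3)) ((0 : ℝ) • X) := by
    rw [zero_smul]; exact hd
  have h1 := hd'.comp_hasDerivAt (0 : ℝ) hl
  rw [chartAt_self]
  funext i
  refine ((hasDerivAt_pi.1 h1) i).unique ?_
  change HasDerivAt _ (inner ℂ (adaptedBasis x i.succ) (-(2 * Complex.I) •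
      (inner ℂ (quatJ (affineLin (adaptedBasis x) X)) (affineLin (adaptedBasis x) Y) •
          quatJ (adaptedBasis x 0)
        + inner ℂ (quatJ (adaptedBasis x 0)) (affineLin (adaptedBasis x) Y) •
          quatJ (affineLin (adaptedBasis x) X)))) 0
  simp only [Function.comp, chartJ_apply, affineVec_smul, norm_sq_adaptedBasis_add, map_add,
    map_smul, inner_add_left, inner_add_right, inner_smul_left_eq_smul, inner_smul_right_eq_smul,
    inner_quatJ_self, zero_add]
  generalize inner ℂ (quatJ (adaptedBasis x 0)) (affineLin (adaptedBasis x) Y) = p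
  generalize inner ℂ (quatJ (affineLin (adaptedBasis x) X)) (affineLin (adaptedBasis x) Y) = P
  generalize inner ℂ (adaptedBasis x i.succ) (quatJ (adaptedBasis x 0)) = r
  generalize inner ℂ (adaptedBasis x i.succ) (quatJ (affineLin (adaptedBasis x) X)) = R
  generalize inner ℂ (adaptedBasis x 0) (quatJ (affineLin (adaptedBasis x) X)) = m
  generalize ‖affineLin (adaptedBasis x) X‖ ^ 2 = s
  have hn : HasDerivAt (fun t : ℝ => ((1 + t ^ 2 * s : ℝ) : ℂ)) 0 0 := by
    have := ((((hasDerivAt_id (0 : ℝ)).fun_pow 2).mul_const s).const_add 1).ofReal_comp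
    simpa using this
  have hid : ∀ c : ℂ, HasDerivAt (fun t : ℝ => t • c) c 0 := fun c => by
    simpa using (hasDerivAt_id (0 : ℝ)).smul_const c
  have k1 := (((hid P).const_add p).const_mul (2 * Complex.I)).fun_div hn (by simp)
  -- The product subtracted here is quadratic in t, since both the coordinate and ⟨q, jv⟩ vanish at
  -- t = 0.
  have k2 := ((hid R).const_add r).fun_sub ((hid (X i)).fun_mul (hid m))
  have k := (k1.fun_mul k2).const_sub (Complex.I * Y i)
  refine HasDerivAt.congr_deriv k ?_
  simp
  ring

/-- The derivative of J and the two Christoffel terms add up to an expression alternating in X and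
Y, as expected of a nearly Kähler structure. -/
theorem nablaJ_eq (x : CP3) (X Y : TCP3 x) :
    nablaJ x X Y = hopfPush x (
      -(2 * Complex.I * inner ℂ (quatJ (horLift x X)) (horLift x Y)) • quatJ (adaptedBasis x 0)
      + (Complex.I * inner ℂ (quatJ (adaptedBasis x 0)) (horLift x X)) • quatJ (horLift x Y)
      - (Complex.I * inner ℂ (quatJ (adaptedBasis x 0)) (horLift x Y)) • quatJ (horLift x X)) := by
  have hq : adaptedBasis x 0 ≠ 0 := UBasis.ne_zero _ 0
  have hJ : ∀ w, nkJ x (hopfPush x w) = hopfPush x (Complex.I • w -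
      (2 * Complex.I * inner ℂ (quatJ (adaptedBasis x 0)) w) • quatJ (adaptedBasis x 0)) := by
    intro w
    have h := nkJ_pushAt hq (hopf_adaptedBasis x) w
    rw [pushAt_adaptedBasis, pushAt_adaptedBasis, (adaptedBasis x).orthonormal.1] at h
    simpa using h
  have hDJ := fderiv_chartJ x X Y
  rw [affineLin_eq_horLift, affineLin_eq_horLift] at hDJ
  have hJY : horLift x (nkJ x Y) = Complex.I • horLift x Y -
      (2 * Complex.I * inner ℂ (quatJ (adaptedBasis x 0)) (horLift x Y)) •
        quatJ (adaptedBasis x 0) := by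
    conv_lhs => rw [← hopfPush_horLift x Y]
    rw [hJ, horLift_hopfPush, inner_sub_right, inner_smul_right, inner_smul_right, inner_horLift,
      inner_quatJ_self]
    simp
  have h0 : ∀ A : TCP3 x, inner ℂ (quatJ (adaptedBasis x 0)) (quatJ (horLift x A)) = (0 : ℂ) :=
    fun A => by rw [inner_quatJ_quatJ, ← inner_conj_symm, inner_horLift, map_zero]
  have hG : nablaJ x X Y = (hopfPush x (-(2 * Complex.I) •
      (inner ℂ (quatJ (horLift x X)) (horLift x Y) • quatJ (adaptedBasis x 0)
        + inner ℂ (quatJ (adaptedBasis x 0)) (horLift x Y) • quatJ (horLift x X))) : TCP3 x)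
      + christoffel x X (nkJ x Y) - nkJ x (christoffel x X Y) := by
    rw [← hDJ]
    rfl
  rw [hG, christoffel_eq, christoffel_eq, hJ, hJY, ← map_add, ← map_sub, ← sub_eq_zero, ← map_sub]
  simp only [inner_smul_right_eq_smul, inner_add_right, inner_sub_right, h0,
    norm_quatJ_adaptedBasis, map_sub quatJ, quatJ_smul, quatJ_quatJ]
  -- The two sides agree in ℂ⁴ only up to a multiple of q, which arises from j(jq) = -q; it is
  -- vertical and is killed by the projection.
  refine (congrArg (hopfPush x) ?_).trans (hopfPush_smul_self x (Complex.I *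
    inner ℂ (quatJ (adaptedBasis x 0)) (horLift x X) *
      conj (inner ℂ (quatJ (adaptedBasis x 0)) (horLift x Y))))
  generalize inner ℂ (quatJ (adaptedBasis x 0)) (horLift x Y) = a
  generalize inner ℂ (quatJ (adaptedBasis x 0)) (horLift x X) = b
  generalize inner ℂ (quatJ (horLift x X)) (horLift x Y) = c
  simp only [← Complex.coe_smul, smul_eq_mul, map_mul, Complex.conj_I, Complex.conj_ofNat,
    mul_zero, add_zero, mul_one]
  push_cast
  module

/-! ### Unitary coordinates on the tangent spaces -/

/-- A unit v differs from the chosen vector by a phase d with conj d = d⁻¹. Since ⟨j·, ·⟩ is complex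
bilinear, all three terms scale by the same power of d. -/
theorem nablaJ_pushAt {x : CP3} {v : C4} (hv : ‖v‖ = 1) (hx : hopf v = x) {w w' : C4}
    (hw : inner ℂ v w = 0) (hw' : inner ℂ v w' = 0) :
    nablaJ x (pushAt x v w) (pushAt x v w') = pushAt x v (
      -(2 * Complex.I * inner ℂ (quatJ w) w') • quatJ v
      + (Complex.I * inner ℂ (quatJ v) w) • quatJ w'
      - (Complex.I * inner ℂ (quatJ v) w') • quatJ w) := by
  have hv0 : v ≠ 0 := fun h => by simp [h] at hv
  obtain ⟨d, hd, rfl, h⟩ := exists_eq_smul_adaptedBasis hv0 hx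
  have hd1 : ‖d‖ = 1 := by rwa [norm_smul, (adaptedBasis x).orthonormal.1, mul_one] at hv
  have hdd : conj d = d⁻¹ := (Complex.inv_eq_conj hd1).symm
  have hl : ∀ w, inner ℂ (d • adaptedBasis x 0) w = 0 →
      horLift x (hopfPush x (d⁻¹ • w)) = d⁻¹ • w := by
    intro w hw
    rw [inner_smul_left] at hw
    rw [horLift_hopfPush, inner_smul_right,
      (mul_eq_zero.1 hw).resolve_left ((map_ne_zero _).2 hd), mul_zero, zero_smul, sub_zero]
  rw [h, h, h, nablaJ_eq, hl w hw, hl w' hw']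
  congr 1
  simp only [quatJ_smul, inner_smul_left, inner_smul_right, map_inv₀, hdd, inv_inv, smul_sub,
      smul_add, smul_smul]
  match_scalars <;> field_simp

/-- The orthogonal complement of v and jv is stable under j, and every u is orthogonal to ju; any
unit u in the complement therefore completes the basis together with ju. -/
theorem exists_quaternionic_basis {v : C4} (hv : ‖v‖ = 1) :
    ∃ e : UBasis, e 0 = v ∧ e 1 = quatJ v ∧ e 3 = quatJ (e 2) := by
  have hjn : ∀ v : C4, ‖quatJ v‖ = ‖v‖ := fun v => by
    have h2 : ‖quatJ v‖ ^ 2 = ‖v‖ ^ 2 := by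
      rw [← inner_self_eq_norm_sq (𝕜 := ℂ), ← inner_self_eq_norm_sq (𝕜 := ℂ), inner_quatJ_quatJ]
    exact (pow_left_inj₀ (norm_nonneg _) (norm_nonneg _) two_ne_zero).1 h2
  -- Only the indices 0 and 1 are prescribed; the two zeros are placeholders.
  obtain ⟨b, hb⟩ := Orthonormal.exists_orthonormalBasis_extension_of_card_eq (𝕜 := ℂ)
    (E := C4) (ι := Fin 4) (by simp) (v := ![v, quatJ v, 0, 0]) (s := {0, 1}) (by
      refine ⟨?_, ?_⟩
      · rintro ⟨i, hi | hi⟩ <;> subst hi <;> simp [hv, hjn]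
      · rintro ⟨i, hi | hi⟩ ⟨j, hj | hj⟩ hij <;> subst hi <;> subst hj <;>
          simp_all [inner_quatJ_self, inner_quatJ_self'])
  have h0 : b 0 = v := hb 0 (by simp)
  have h1 : b 1 = quatJ v := hb 1 (by simp)
  have h02 : inner ℂ v (b 2) = 0 := by rw [← h0]; exact b.orthonormal.2 (by decide)
  have h12 : inner ℂ (quatJ v) (b 2) = 0 := by rw [← h1]; exact b.orthonormal.2 (by decide)
  have h20 : inner ℂ (b 2) v = 0 := by rw [← inner_conj_symm, h02, map_zero]
  have h21 : inner ℂ (b 2) (quatJ v) = 0 := by rw [← inner_conj_symm, h12, map_zero]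
  have h30 : inner ℂ (quatJ (b 2)) v = 0 := by rw [inner_quatJ_antisymm, h12, neg_zero]
  have h03 : inner ℂ v (quatJ (b 2)) = 0 := by rw [← inner_conj_symm, h30, map_zero]
  have hn2 : ‖b 2‖ = 1 := b.orthonormal.1 2
  have ho : Orthonormal ℂ ![v, quatJ v, b 2, quatJ (b 2)] := by
    refine ⟨?_, ?_⟩
    · intro i
      fin_cases i <;> simp [hv, hjn, hn2]
    · intro i j hij
      fin_cases i <;> fin_cases j <;>
        simp_all [inner_quatJ_self, inner_quatJ_self', inner_quatJ_quatJ]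
  refine ⟨OrthonormalBasis.mk ho ?_, ?_, ?_, ?_⟩
  · rw [ho.linearIndependent.span_eq_top_of_card_eq_finrank (by simp)]
  all_goals simp

/-- In the basis v, jv, u, ju take the coordinates of a horizontal vector. J acts as -i on the line
of jv and as i on the rest, so conjugating the first coordinate makes J equal to i and moves the
sign change to J∘. The factors √2 absorb the ratio 2 : 1 of g on the two distributions. The last
clause ties the first coordinate to the lift. -/
theorem exists_unitary_coordinates {x : CP3} {v : C4} (hv : ‖v‖ = 1) (hx : hopf v = x) :
    ∃ φ : TCP3 x →ₗ[ℝ] EuclideanSpace ℂ (Fin 3), Function.Injective φ ∧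
      (∀ X Y, nkMetric x X Y = (inner ℂ (φ X) (φ Y)).re) ∧
      (∀ X, φ (nkJ x X) = Complex.I • φ X) ∧
      (∀ X, φ (kahlerJ x X) =
        !₂[-Complex.I * φ X 0, Complex.I * φ X 1, Complex.I * φ X 2]) ∧
      (∀ X Y, φ (nablaJ x X Y) =
        !₂[Complex.I * conj (φ X 1 * φ Y 2 - φ X 2 * φ Y 1),
          Complex.I * conj (φ X 2 * φ Y 0 - φ X 0 * φ Y 2),
          Complex.I * conj (φ X 0 * φ Y 1 - φ X 1 * φ Y 0)]) ∧
      ∀ w, φ (pushAt x v w) 0 = conj (inner ℂ (quatJ v) w) := by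
  have hv0 : v ≠ 0 := fun h => by simp [h] at hv
  obtain ⟨e, he0, he1, he3⟩ := exists_quaternionic_basis hv
  obtain ⟨d, hd, hvd, hp⟩ := exists_eq_smul_adaptedBasis hv0 hx
  let ψ : C4 →ₗ[ℝ] EuclideanSpace ℂ (Fin 3) :=
    { toFun := fun w => !₂[conj (inner ℂ (e 1) w), √2 * inner ℂ (e 2) w, √2 * inner ℂ (e 3) w]
      map_add' := fun w w' => by
        ext i; fin_cases i <;> simp [mul_add]
      map_smul' := fun c w => by
        ext i; fin_cases i <;> simp [mul_left_comm] }
  have hψ : ∀ w, ψ w =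
      !₂[conj (inner ℂ (e 1) w), √2 * inner ℂ (e 2) w, √2 * inner ℂ (e 3) w] := fun w => rfl
  -- `horLift` lives at the chosen unit vector; multiplication by d transports it to v.
  let D : C4 →ₗ[ℝ] C4 := (d • (LinearMap.id : C4 →ₗ[ℂ] C4)).restrictScalars ℝ
  have h10 : inner ℂ (e 1) v = 0 := by rw [← he0]; exact e.orthonormal.2 (by decide)
  have h20 : inner ℂ (e 2) v = 0 := by rw [← he0]; exact e.orthonormal.2 (by decide)
  have h30 : inner ℂ (e 3) v = 0 := by rw [← he0]; exact e.orthonormal.2 (by decide)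
  have h21 : inner ℂ (e 2) (e 1) = 0 := e.orthonormal.2 (by decide)
  have h31 : inner ℂ (e 3) (e 1) = 0 := e.orthonormal.2 (by decide)
  have h11 : inner ℂ (e 1) (e 1) = 1 := by
    rw [inner_self_eq_norm_sq_to_K, e.orthonormal.1]; simp
  have hφP : ∀ w, (ψ ∘ₗ D ∘ₗ horLift x) (pushAt x v w) = ψ w := by
    intro w
    change ψ (d • horLift x (pushAt x v w)) = ψ w
    rw [hp, horLift_hopfPush, smul_sub, smul_inv_smul₀ hd, smul_comm, ← hvd, hψ, hψ]
    simp only [inner_sub_right, inner_smul_right, h10, h20, h30, mul_zero, sub_zero]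
  have h2e : ∀ w, inner ℂ (e 2) (quatJ w) = -conj (inner ℂ (e 3) w) := fun w => by
    rw [inner_conj_symm, he3, ← inner_quatJ_quatJ, quatJ_quatJ, inner_neg_left]
  have h3e : ∀ w, inner ℂ (e 3) (quatJ w) = conj (inner ℂ (e 2) w) := fun w => by
    rw [inner_conj_symm, he3, inner_quatJ_quatJ]
  have h1e : ∀ w, inner ℂ v w = 0 → inner ℂ (e 1) (quatJ w) = 0 := fun w hw => by
    rw [he1, inner_quatJ_quatJ, ← inner_conj_symm, hw, map_zero]
  -- Parseval in the basis e: for horizontal w and w' the components along v and jv drop out,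
  -- leaving the 2 × 2 determinant in the other two.
  have hσ : ∀ w w', inner ℂ v w = 0 → inner ℂ v w' = 0 → inner ℂ (quatJ w) w' =
      inner ℂ (e 2) w * inner ℂ (e 3) w' - inner ℂ (e 3) w * inner ℂ (e 2) w' := by
    intro w w' hw hw'
    rw [← e.sum_inner_mul_inner, Fin.sum_univ_four, he0, hw', ← inner_conj_symm _ (e 1), h1e w hw,
      ← inner_conj_symm _ (e 2), h2e, ← inner_conj_symm _ (e 3), h3e]
    simp
    ring
  have hsq : (√2 : ℂ) * √2 = 2 := by
    rw [← Complex.ofReal_mul, Real.mul_self_sqrt zero_le_two]; norm_num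
  refine ⟨ψ ∘ₗ D ∘ₗ horLift x, ?_, ?_, ?_, ?_, ?_, ?_⟩
  · rw [injective_iff_map_eq_zero]
    intro X hX
    obtain ⟨w, hw, rfl⟩ := exists_pushAt_eq hv0 hx X
    rw [hφP, hψ] at hX
    have k1 := congrArg (fun z : EuclideanSpace ℂ (Fin 3) => z 0) hX
    have k2 := congrArg (fun z : EuclideanSpace ℂ (Fin 3) => z 1) hX
    have k3 := congrArg (fun z : EuclideanSpace ℂ (Fin 3) => z 2) hX
    simp [-inner_conj_symm] at k1 k2 k3
    rw [← e.sum_repr' w, Fin.sum_univ_four, he0, hw, k1, k2, k3]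
    simp
  · intro X Y
    obtain ⟨w, hw, rfl⟩ := exists_pushAt_eq hv0 hx X
    obtain ⟨w', hw', rfl⟩ := exists_pushAt_eq hv0 hx Y
    rw [hφP, hφP, nkMetric_pushAt hv hx, hw', ← he1, ← e.sum_inner_mul_inner, Fin.sum_univ_four,
      he0, hw', hψ, hψ]
    have c : ∀ i, inner ℂ w (e i) = conj (inner ℂ (e i) w) := fun i => by rw [inner_conj_symm]
    rw [c, c, c]
    generalize inner ℂ (e 1) w = a₁, inner ℂ (e 2) w = a₂, inner ℂ (e 3) w = a₃,
      inner ℂ (e 1) w' = b₁, inner ℂ (e 2) w' = b₂, inner ℂ (e 3) w' = b₃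
    simp [PiLp.inner_apply, Fin.sum_univ_three, Complex.add_re, Complex.mul_re]
    have : √2 * √2 = 2 := Real.mul_self_sqrt zero_le_two
    linear_combination (-(a₂.re * b₂.re + a₂.im * b₂.im + a₃.re * b₃.re + a₃.im * b₃.im)) * this
  · intro X
    obtain ⟨w, hw, rfl⟩ := exists_pushAt_eq hv0 hx X
    rw [nkJ_pushAt hv0 hx, hφP, hφP, hψ, hψ, hv, ← he1]
    simp only [inner_sub_right, inner_smul_right, h11, h21, h31]
    ext i
    fin_cases i
    · simp [-inner_conj_symm, Complex.conj_ofNat]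
      ring
    · simp
      ring
    · simp
      ring
  · intro X
    obtain ⟨w, hw, rfl⟩ := exists_pushAt_eq hv0 hx X
    rw [kahlerJ_pushAt hv0 hx, hφP, hφP, hψ, hψ]
    ext i
    fin_cases i <;> simp [-inner_conj_symm] <;> ring
  · intro X Y
    obtain ⟨w, hw, rfl⟩ := exists_pushAt_eq hv0 hx X
    obtain ⟨w', hw', rfl⟩ := exists_pushAt_eq hv0 hx Y
    rw [nablaJ_pushAt hv hx hw hw', hφP, hφP, hφP, hψ, hψ, hψ, hσ w w' hw hw', ← he1]
    simp only [inner_sub_right, inner_add_right, inner_smul_right, h11, h21, h31, h1e w hw,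
      h1e w' hw', h2e, h3e]
    ext i
    fin_cases i
    · simp [-inner_conj_symm, Complex.conj_ofNat]
      linear_combination (Complex.I * (conj (inner ℂ (e 2) w) * conj (inner ℂ (e 3) w')
        - conj (inner ℂ (e 3) w) * conj (inner ℂ (e 2) w'))) * (-hsq)
    · simp [-inner_conj_symm]
      ring
    · simp [-inner_conj_symm]
      ring
  · intro w
    rw [hφP, ← he1]
    rfl
/-! ### Orthonormal pairs spanning a totally real plane -/

section Linear

variable {x : CP3}

theorem kahlerJ_add (X Y : TCP3 x) : kahlerJ x (X + Y) = kahlerJ x X + kahlerJ x Y := by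
  rw [kahlerJ, map_add, smul_add, map_add]
  rfl

theorem kahlerJ_smul (c : ℝ) (X : TCP3 x) : kahlerJ x (c • X) = c • kahlerJ x X := by
  rw [kahlerJ, map_smul (horLift x), smul_comm, map_smul]
  rfl

theorem kahlerJ_kahlerJ (X : TCP3 x) : kahlerJ x (kahlerJ x X) = -X := by
  rw [kahlerJ, kahlerJ, horLift_hopfPush, smul_sub, map_sub, smul_smul, smul_smul,
    hopfPush_smul_self, sub_zero, Complex.I_mul_I, neg_one_smul, map_neg, hopfPush_horLift]

theorem almostProd_almostProd (X : TCP3 x) : almostProd x (almostProd x X) = X := by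
  have h : horLift x (almostProd x X) = horLift x X -
      (2 * inner ℂ (quatJ (adaptedBasis x 0)) (horLift x X)) • quatJ (adaptedBasis x 0) := by
    rw [almostProd, map_sub, map_sub, hopfPush_horLift, horLift_hopfPush_quatJ]
  rw [almostProd, h, inner_sub_right, inner_smul_right, norm_quatJ_adaptedBasis, sub_sub,
    ← add_smul, show 2 * inner ℂ (quatJ (adaptedBasis x 0)) (horLift x X)
    + 2 * (inner ℂ (quatJ (adaptedBasis x 0)) (horLift x X)
      - 2 * inner ℂ (quatJ (adaptedBasis x 0)) (horLift x X) * 1) = 0 by ring, zero_smul, sub_zero,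
    hopfPush_horLift]

/-- Since P² = 1, the definition of g expresses g(X, J∘Y) and g(X, JY) linearly through g∘(X, J∘Y)
and g∘(X, JY); the combination eliminates the latter. -/
theorem four_mul_fubiniStudy_kahlerJ (X Y : TCP3 x) :
    4 * fubiniStudy x X (kahlerJ x Y) =
      3 * nkMetric x X (kahlerJ x Y) - nkMetric x X (nkJ x Y) := by
  rw [nkMetric, nkMetric, nkJ, almostProd_almostProd]
  ring

theorem exists_unitary_coordinates' (x : CP3) :
    ∃ φ : TCP3 x →ₗ[ℝ] EuclideanSpace ℂ (Fin 3), Function.Injective φ ∧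
      (∀ X Y, nkMetric x X Y = (inner ℂ (φ X) (φ Y)).re) ∧
      (∀ X, φ (nkJ x X) = Complex.I • φ X) ∧
      (∀ X, φ (kahlerJ x X) =
        !₂[-Complex.I * φ X 0, Complex.I * φ X 1, Complex.I * φ X 2]) := by
  obtain ⟨φ, h1, h2, h3, h4, -⟩ :=
    exists_unitary_coordinates ((adaptedBasis x).orthonormal.1 0) (hopf_adaptedBasis x)
  exact ⟨φ, h1, h2, h3, h4⟩

theorem nkMetric_comm (X Y : TCP3 x) : nkMetric x X Y = nkMetric x Y X := by
  obtain ⟨φ, -, h, -⟩ := exists_unitary_coordinates' x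
  rw [h, h, ← inner_conj_symm, Complex.conj_re]

/-- J∘ is diag(-i, i, i) in unitary coordinates, so it is skew for g as well as for g∘. -/
theorem nkMetric_kahlerJ_left (X Y : TCP3 x) :
    nkMetric x (kahlerJ x X) Y = -nkMetric x X (kahlerJ x Y) := by
  obtain ⟨φ, -, h, -, h'⟩ := exists_unitary_coordinates' x
  rw [h, h, h', h']
  simp [PiLp.inner_apply, Fin.sum_univ_three]
  ring

theorem nkMetric_kahlerJ_self (X : TCP3 x) : nkMetric x X (kahlerJ x X) = 0 := by
  have h1 := nkMetric_kahlerJ_left X X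
  rw [nkMetric_comm] at h1
  linarith

theorem nkMetric_kahlerJ_kahlerJ (X Y : TCP3 x) :
    nkMetric x (kahlerJ x X) (kahlerJ x Y) = nkMetric x X Y := by
  rw [nkMetric_kahlerJ_left, kahlerJ_kahlerJ, ← neg_one_smul ℝ Y, nkMetric_smul_right]
  ring

theorem nkMetric_nkJ_left (X Y : TCP3 x) :
    nkMetric x (nkJ x X) Y = -nkMetric x X (nkJ x Y) := by
  obtain ⟨φ, -, h, h', -⟩ := exists_unitary_coordinates' x
  rw [h, h, h', h', inner_smul_left, inner_smul_right]
  simp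

theorem nkMetric_nkJ_self (X : TCP3 x) : nkMetric x X (nkJ x X) = 0 := by
  have h1 := nkMetric_nkJ_left X X
  rw [nkMetric_comm] at h1
  linarith

/-- The vectors `X`, `Y` are an orthonormal basis of a totally real plane for `(g, J)`. -/
structure IsTotallyRealPair (X Y : TCP3 x) : Prop where
  fst_fst : nkMetric x X X = 1
  snd_snd : nkMetric x Y Y = 1
  fst_snd : nkMetric x X Y = 0
  fst_nkJ_snd : nkMetric x X (nkJ x Y) = 0

variable {X Y : TCP3 x}

/-- A plane totally real for `(g, J)` is totally real for `J∘` if and only if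
`g(J∘ X, Y) = 0`. -/
theorem IsTotallyRealPair.fubiniStudy_eq (h : IsTotallyRealPair X Y) (a b c d : ℝ) :
    fubiniStudy x (a • X + b • Y) (kahlerJ x (c • X + d • Y)) =
      3 / 4 * ((b * c - a * d) * nkMetric x (kahlerJ x X) Y) := by
  have h1 := four_mul_fubiniStudy_kahlerJ (a • X + b • Y) (c • X + d • Y)
  have h2 : nkMetric x Y (nkJ x X) = 0 := by
    rw [nkMetric_comm, nkMetric_nkJ_left, h.fst_nkJ_snd, neg_zero]
  have h3 : nkMetric x Y (kahlerJ x X) = nkMetric x (kahlerJ x X) Y := nkMetric_comm _ _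
  have h4 : nkMetric x X (kahlerJ x Y) = -nkMetric x (kahlerJ x X) Y := by
    rw [nkMetric_kahlerJ_left, neg_neg]
  have h5 : nkMetric x (a • X + b • Y) (nkJ x (c • X + d • Y)) = 0 := by
    have e1 := nkMetric_nkJ_left X (c • X + d • Y)
    have e2 := nkMetric_nkJ_left Y (c • X + d • Y)
    simp only [nkMetric_add_right, nkMetric_smul_right, nkMetric_add_left, nkMetric_smul_left,
      nkMetric_nkJ_left, nkMetric_nkJ_self, h2, h.fst_nkJ_snd] at e1 e2 ⊢
    linear_combination a * e1 + b * e2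
  rw [h5] at h1
  simp only [kahlerJ_add, kahlerJ_smul, nkMetric_add_right, nkMetric_smul_right,
    nkMetric_add_left, nkMetric_smul_left, nkMetric_kahlerJ_self, h3, h4] at h1 ⊢
  linear_combination (1 / 4) * h1

/-- Equality in Cauchy-Schwarz: J∘X is a unit vector, so the squared length of J∘X - βY is 1 - β².
The formula for J∘Y follows by applying J∘ once more. -/
theorem IsTotallyRealPair.kahlerJ_eq (h : IsTotallyRealPair X Y)
    (hβ : nkMetric x (kahlerJ x X) Y ^ 2 = 1) :
    kahlerJ x X = nkMetric x (kahlerJ x X) Y • Y ∧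
      kahlerJ x Y = -nkMetric x (kahlerJ x X) Y • X := by
  have h1 : kahlerJ x X = nkMetric x (kahlerJ x X) Y • Y := by
    by_contra hne
    have h2 := nkMetric_pos x (sub_ne_zero.2 hne)
    rw [sub_eq_add_neg, ← neg_smul] at h2
    simp only [nkMetric_add_right, nkMetric_smul_right, nkMetric_add_left, nkMetric_smul_left,
      nkMetric_kahlerJ_kahlerJ, h.fst_fst, h.snd_snd, nkMetric_comm Y] at h2
    nlinarith
  refine ⟨h1, ?_⟩
  have h3 := congrArg (kahlerJ x) h1
  rw [kahlerJ_kahlerJ, kahlerJ_smul] at h3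
  have h4 := congrArg (fun Z => nkMetric x (kahlerJ x X) Y • Z) h3
  simp only [smul_smul] at h4
  rw [← pow_two, hβ, one_smul] at h4
  rw [← h4, smul_neg, neg_smul]

/-- J∘X is a unit vector orthogonal to X, so a = 0 and b² = 1. -/
theorem IsTotallyRealPair.sq_eq_one (h : IsTotallyRealPair X Y) {a b : ℝ}
    (hX : kahlerJ x X = a • X + b • Y) : nkMetric x (kahlerJ x X) Y ^ 2 = 1 := by
  have h1 := nkMetric_kahlerJ_kahlerJ X X
  have h2 := nkMetric_kahlerJ_self X
  rw [hX] at h1 h2 ⊢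
  simp only [nkMetric_add_right, nkMetric_smul_right, nkMetric_add_left, nkMetric_smul_left,
      h.fst_fst, h.snd_snd, h.fst_snd, nkMetric_comm Y] at h1 h2 ⊢
  nlinarith

end Linear

/-! ### Totally real planes in unitary coordinates -/

section Coordinates

/-- The conjugated cross product of two Hermitian orthonormal vectors completes them to a unitary
basis of ℂ³; the two conclusions are its expansion formula and Parseval's identity. -/
theorem sum_inner_cross_smul {U V G : EuclideanSpace ℂ (Fin 3)} (hU : inner ℂ U U = 1)
    (hV : inner ℂ V V = 1) (hUV : inner ℂ U V = 0)
    (hG : G = !₂[Complex.I * conj (U 1 * V 2 - U 2 * V 1),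
      Complex.I * conj (U 2 * V 0 - U 0 * V 2), Complex.I * conj (U 0 * V 1 - U 1 * V 0)])
    (W : EuclideanSpace ℂ (Fin 3)) :
    W = inner ℂ U W • U + inner ℂ V W • V + inner ℂ G W • G ∧
      ‖inner ℂ U W‖ ^ 2 + ‖inner ℂ V W‖ ^ 2 + ‖inner ℂ G W‖ ^ 2 = ‖W‖ ^ 2 := by
  have hUG : inner ℂ U G = 0 := by
    rw [hG]
    simp [PiLp.inner_apply, Fin.sum_univ_three]
    ring
  have hVG : inner ℂ V G = 0 := by
    rw [hG]
    simp [PiLp.inner_apply, Fin.sum_univ_three]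
    ring
  have hGG : inner ℂ G G = 1 := by
    -- Lagrange's identity for the cross product.
    have h1 : inner ℂ G G = inner ℂ U U * inner ℂ V V - inner ℂ U V * inner ℂ V U := by
      rw [hG]
      simp only [PiLp.inner_apply, Fin.sum_univ_three, RCLike.inner_apply']
      simp
      ring_nf
      simp only [Complex.I_sq]
      ring
    rw [h1, hU, hV, hUV]
    simp
  have hn : ∀ Z : EuclideanSpace ℂ (Fin 3), inner ℂ Z Z = 1 → ‖Z‖ = 1 := fun Z hZ => by
    have h1 : ‖Z‖ ^ 2 = 1 := by rw [← inner_self_eq_norm_sq (𝕜 := ℂ), hZ]; simp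
    exact (pow_eq_one_iff_of_nonneg (norm_nonneg _) two_ne_zero).1 h1
  have hs : ∀ A B : EuclideanSpace ℂ (Fin 3), inner ℂ A B = 0 → inner ℂ B A = 0 :=
    fun A B h => by rw [← inner_conj_symm, h, map_zero]
  have ho : Orthonormal ℂ ![U, V, G] := by
    refine ⟨?_, ?_⟩
    · intro i
      fin_cases i <;> simp [hn _ hU, hn _ hV, hn _ hGG]
    · intro i j hij
      fin_cases i <;> fin_cases j <;>
        simp_all
  let b := OrthonormalBasis.mk ho
    (by rw [ho.linearIndependent.span_eq_top_of_card_eq_finrank (by simp)])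
  have hb : ⇑b = ![U, V, G] := OrthonormalBasis.coe_mk ho _
  have h1 := b.sum_repr' W
  have h2 := b.sum_sq_norm_inner_right W
  rw [Fin.sum_univ_three, hb] at h1 h2
  exact ⟨h1.symm, h2⟩

variable {x : CP3} {v w w' : C4}

/-- If the plane spanned by `X`, `Y` is totally real for `(g, J)`, then `g(J∘ X, Y)` in terms of
lifts. -/
theorem IsTotallyRealPair.nkMetric_kahlerJ_eq (h : IsTotallyRealPair (pushAt x v w) (pushAt x v w'))
    (hv : ‖v‖ = 1) (hx : hopf v = x) :
    nkMetric x (kahlerJ x (pushAt x v w)) (pushAt x v w') =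
      -2 * (inner ℂ (quatJ v) w * conj (inner ℂ (quatJ v) w')).im := by
  obtain ⟨φ, -, h2, h3, h4, -, h6⟩ := exists_unitary_coordinates hv hx
  have k1 := h.fst_nkJ_snd
  have k2 := h6 w
  have k3 := h6 w'
  rw [h2, h3] at k1
  rw [h2, h4, k2]
  rw [← Complex.conj_conj (inner ℂ (quatJ v) w), ← k2, ← k3]
  -- J∘ and J differ only in the first coordinate, and total reality for J removes the contribution
  -- they share.
  simp [PiLp.inner_apply, Fin.sum_univ_three] at k1 ⊢
  linarith

theorem IsTotallyRealPair.norm_inner_quatJ_le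
    (h : IsTotallyRealPair (pushAt x v w) (pushAt x v w')) (hv : ‖v‖ = 1) (hx : hopf v = x) :
    ‖inner ℂ (quatJ v) w‖ ≤ 1 := by
  obtain ⟨φ, -, h2, h3, h4, -, h6⟩ := exists_unitary_coordinates hv hx
  have k1 := h.fst_fst
  rw [h2] at k1
  have k2 : ‖φ (pushAt x v w)‖ ^ 2 = 1 := by
    rw [← inner_self_eq_norm_sq (𝕜 := ℂ)]
    exact k1
  have k3 : ‖φ (pushAt x v w)‖ = 1 := (pow_eq_one_iff_of_nonneg (norm_nonneg _) two_ne_zero).1 k2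
  have k4 := PiLp.norm_apply_le (φ (pushAt x v w)) 0
  rw [h6, RCLike.norm_conj, k3] at k4
  exact k4

/-- J∘ is i minus 2i times the projection to the first coordinate. This coordinate is zero for Y, so
J∘Y = JY and J∘X has no Y component; z is the component of J∘X along G(X, Y), and Parseval for J∘X
gives its norm. If the first coordinates of X and G(X, Y) vanished too, the first standard vector
would be orthogonal to a basis. -/
theorem IsTotallyRealPair.kahlerJ_eq_of_inner_quatJ_eq_zero
    (h : IsTotallyRealPair (pushAt x v w) (pushAt x v w')) (hv : ‖v‖ = 1) (hx : hopf v = x)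
    (hw : inner ℂ v w = 0) (hw' : inner ℂ v w' = 0) (h0 : inner ℂ (quatJ v) w' = 0) :
    let z := -4 * conj (inner ℂ (quatJ v) w) * inner ℂ (quatJ w) w'
    let τ := ‖inner ℂ (quatJ v) w‖ ^ 2
    kahlerJ x (pushAt x v w') = nkJ x (pushAt x v w') ∧
    kahlerJ x (pushAt x v w) = (1 - 2 * τ) • nkJ x (pushAt x v w)
      + z.re • nablaJ x (pushAt x v w) (pushAt x v w')
      + z.im • nkJ x (nablaJ x (pushAt x v w) (pushAt x v w')) ∧
    ‖z‖ ^ 2 = 1 - (1 - 2 * τ) ^ 2 ∧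
    (inner ℂ (quatJ v) w = 0 → inner ℂ (quatJ w) w' ≠ 0) := by
  intro z τ
  obtain ⟨φ, hφ, h2, h3, h4, h5, h6⟩ := exists_unitary_coordinates hv hx
  have k0 := h6 w
  have k0' := h6 w'
  have kG := h6 (-(2 * Complex.I * inner ℂ (quatJ w) w') • quatJ v
      + (Complex.I * inner ℂ (quatJ v) w) • quatJ w'
      - (Complex.I * inner ℂ (quatJ v) w') • quatJ w)
  rw [← nablaJ_pushAt hv hx hw hw', h5] at kG
  have e1 := h.fst_fst
  have e2 := h.snd_snd
  have e3 := h.fst_snd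
  have e4 := h.fst_nkJ_snd
  generalize pushAt x v w = X at *
  generalize pushAt x v w' = Y at *
  rw [h2] at e1 e2 e3 e4
  rw [h3, inner_smul_right] at e4
  rw [h0, map_zero] at k0'
  have hvv : inner ℂ (quatJ v) (quatJ v) = (1 : ℂ) := by
    rw [inner_quatJ_quatJ, inner_self_eq_norm_sq_to_K, hv]
    simp
  have h00 : ∀ A, inner ℂ v A = 0 → inner ℂ (quatJ v) (quatJ A) = 0 := fun A hA => by
    rw [inner_quatJ_quatJ, ← inner_conj_symm, hA, map_zero]
  have hG0 : φ (nablaJ x X Y) 0 = 2 * Complex.I * conj (inner ℂ (quatJ w) w') := by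
    rw [h5, kG]
    simp only [inner_sub_right, inner_add_right, inner_smul_right, hvv, h00 w hw, h00 w' hw']
    simp [-inner_conj_symm, Complex.conj_ofNat]
  have hself : ∀ Z : EuclideanSpace ℂ (Fin 3), (inner ℂ Z Z).re = 1 → inner ℂ Z Z = (1 : ℂ) :=
    fun Z hZ => Complex.ext hZ (by simpa using inner_self_im (𝕜 := ℂ) Z)
  have hUV : inner ℂ (φ X) (φ Y) = (0 : ℂ) := Complex.ext e3 (by simpa using e4)
  obtain ⟨s1, s2⟩ := sum_inner_cross_smul (hself _ e1) (hself _ e2) hUV (h5 X Y)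
    (φ (kahlerJ x X))
  -- Parseval for the first standard vector: the first coordinates of the three basis vectors have
  -- squared norms adding up to 1.
  obtain ⟨-, s3⟩ := sum_inner_cross_smul (hself _ e1) (hself _ e2) hUV (h5 X Y)
    (EuclideanSpace.single 0 1)
  have hJ : ∀ Z : EuclideanSpace ℂ (Fin 3), inner ℂ Z (φ (kahlerJ x X)) =
      Complex.I * inner ℂ Z (φ X) - 2 * Complex.I * conj (Z 0) * φ X 0 := by
    intro Z
    rw [h4]
    simp [PiLp.inner_apply, Fin.sum_univ_three]
    ring
  have hUG : inner ℂ (φ (nablaJ x X Y)) (φ X) = (0 : ℂ) := by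
    rw [h5]
    simp [PiLp.inner_apply, Fin.sum_univ_three]
    ring
  have hVU : inner ℂ (φ Y) (φ X) = (0 : ℂ) := by rw [← inner_conj_symm, hUV, map_zero]
  have c1 : inner ℂ (φ X) (φ (kahlerJ x X)) = Complex.I * ((1 - 2 * τ : ℝ) : ℂ) := by
    have ht : conj (φ X 0) * φ X 0 = ((τ : ℝ) : ℂ) := by
      rw [k0, Complex.conj_conj, Complex.mul_conj']
      push_cast [τ]
      rfl
    rw [hJ, hself _ e1]
    push_cast
    linear_combination (-2 * Complex.I) * ht
  have c2 : inner ℂ (φ Y) (φ (kahlerJ x X)) = 0 := by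
    rw [hJ, hVU, k0']
    simp
  have c3 : inner ℂ (φ (nablaJ x X Y)) (φ (kahlerJ x X)) = z := by
    rw [hJ, hUG, hG0, k0]
    simp [-inner_conj_symm, z, Complex.conj_ofNat]
    linear_combination (4 * conj (inner ℂ (quatJ v) w) * inner ℂ (quatJ w) w') * Complex.I_mul_I
  rw [c1, c2, c3] at s1 s2
  refine ⟨?_, ?_, ?_, ?_⟩
  · apply hφ
    rw [h3, h4]
    ext i
    fin_cases i <;> simp [k0']
  · apply hφ
    rw [s1, map_add, map_add, map_smul, map_smul, map_smul, h3, h3, zero_smul, add_zero]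
    ext i
    simp only [PiLp.add_apply, PiLp.smul_apply, smul_eq_mul, Complex.real_smul]
    conv_lhs => rw [← Complex.re_add_im z]
    ring
  · have hn : ‖φ (kahlerJ x X)‖ ^ 2 = 1 := by
      rw [← inner_self_eq_norm_sq (𝕜 := ℂ)]
      exact (h2 _ _).symm.trans ((nkMetric_kahlerJ_kahlerJ X X).trans ((h2 _ _).trans e1))
    rw [hn, norm_mul, Complex.norm_I, Complex.norm_real, one_mul, norm_zero, Real.norm_eq_abs,
      sq_abs] at s2
    linarith
  · intro hw0 hσ
    rw [EuclideanSpace.inner_single_right, EuclideanSpace.inner_single_right,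
      EuclideanSpace.inner_single_right, k0, k0', hG0, hw0, hσ] at s3
    simp at s3

end Coordinates

/-! ### Local lifts of surfaces -/

/-- Surfaces tangent to the horizontal distribution of `S⁷ → S⁴` are isotropic for `⟨j·, ·⟩`. -/
theorem inner_quatJ_fderiv_eq_zero {E : Type*} [NormedAddCommGroup E] [NormedSpace ℝ E]
    {F : E → C4} {Ω : Set E} (hΩ : IsOpen Ω) (hF : ContDiffOn ℝ ∞ F Ω) {a b : E}
    (ha : ∀ y ∈ Ω, inner ℂ (quatJ (F y)) (fderiv ℝ F y a) = 0)
    (hb : ∀ y ∈ Ω, inner ℂ (quatJ (F y)) (fderiv ℝ F y b) = 0) {y : E} (hy : y ∈ Ω) :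
    inner ℂ (quatJ (fderiv ℝ F y a)) (fderiv ℝ F y b) = 0 := by
  have hFy : ContDiffAt ℝ ∞ F y := hF.contDiffAt (hΩ.mem_nhds hy)
  have hF1 : HasFDerivAt F (fderiv ℝ F y) y := (hFy.differentiableAt (by simp)).hasFDerivAt
  have hF2 : HasFDerivAt (fderiv ℝ F) (fderiv ℝ (fderiv ℝ F) y) y :=
    ((hFy.fderiv_right (m := 1) (by norm_cast)).differentiableAt (by simp)).hasFDerivAt
  have hsymm := hFy.isSymmSndFDerivAt (by simpa using ENat.LEInfty.out)
  -- The product rule for ⟨jF, ∂F⟩ = 0. Taken in both orders and subtracted, symmetry of the second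
  -- derivative removes the second-order terms, and antisymmetry of ⟨j·, ·⟩ leaves twice the desired
  -- quantity.
  have key : ∀ c d : E, (∀ y ∈ Ω, inner ℂ (quatJ (F y)) (fderiv ℝ F y c) = 0) →
      inner ℂ (quatJ (F y)) (fderiv ℝ (fderiv ℝ F) y d c)
        + inner ℂ (quatJ (fderiv ℝ F y d)) (fderiv ℝ F y c) = 0 := by
    intro c d hc
    have h1 : HasFDerivAt (fun y => quatJ (F y))
        ((LinearMap.toContinuousLinearMap quatJ).comp (fderiv ℝ F y)) y :=
      (LinearMap.toContinuousLinearMap quatJ).hasFDerivAt.comp y hF1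
    have h2 : HasFDerivAt (fun y => fderiv ℝ F y c)
        ((fderiv ℝ (fderiv ℝ F) y).flip c) y := by
      simpa using hF2.clm_apply (hasFDerivAt_const c y)
    have h3 := h1.inner ℂ h2
    have h4 : HasFDerivAt (fun y => inner ℂ (quatJ (F y)) (fderiv ℝ F y c)) (0 : E →L[ℝ] ℂ) y := by
      refine (hasFDerivAt_const (0 : ℂ) y).congr_of_eventuallyEq ?_
      filter_upwards [hΩ.mem_nhds hy] with z hz using hc z hz
    have h5 := congrArg (fun L : E →L[ℝ] ℂ => L d) (h3.unique h4)
    simpa [fderivInnerCLM_apply] using h5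
  have k1 := key a b ha
  have k2 := key b a hb
  rw [hsymm b a] at k1
  rw [inner_quatJ_antisymm (fderiv ℝ F y b)] at k1
  have h : inner ℂ (quatJ (fderiv ℝ F y a)) (fderiv ℝ F y b) * (2 : ℂ) = 0 := by
    linear_combination k2 - k1
  simpa using h

/-- Tangent spaces at propositionally equal points are different types, so the comparison is made in
the common model space. -/
theorem pushAt_congr {x x' : CP3} (h : x = x') (v w : C4) :
    (pushAt x v w : C3) = (pushAt x' v w : C3) := by
  subst h
  rfl

section LocalLifts

variable {M : Type*} [TopologicalSpace M] [ChartedSpace (EuclideanSpace ℝ (Fin 2)) M]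

theorem ContDiffAt.comp_contMDiffOn {E F : Type*} [NormedAddCommGroup E] [NormedSpace ℝ E]
    [NormedAddCommGroup F] [NormedSpace ℝ F] {g : E → F} {h : M → E} {O : Set M}
    (hg : ∀ p ∈ O, ContDiffAt ℝ ∞ g (h p)) (hh : ContMDiffOn (𝓡 2) 𝓘(ℝ, E) ∞ h O) :
    ContMDiffOn (𝓡 2) 𝓘(ℝ, F) ∞ (fun p => g (h p)) O :=
  fun p hp => (hg p hp).comp_contMDiffWithinAt (hh p hp)

theorem contMDiffOn_inner {w w' : M → C4} {O : Set M}
    (hw : ContMDiffOn (𝓡 2) 𝓘(ℝ, C4) ∞ w O) (hw' : ContMDiffOn (𝓡 2) 𝓘(ℝ, C4) ∞ w' O) :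
    ContMDiffOn (𝓡 2) 𝓘(ℝ, ℂ) ∞ (fun p => (inner ℂ (w p) (w' p) : ℂ)) O :=
  ContDiffAt.comp_contMDiffOn (g := fun z : C4 × C4 => (inner ℂ z.1 z.2 : ℂ))
    (fun _ _ => contDiff_inner.contDiffAt) (hw.prodMk_space hw')

theorem contMDiffOn_complex_mul {h h' : M → ℂ} {O : Set M}
    (hh : ContMDiffOn (𝓡 2) 𝓘(ℝ, ℂ) ∞ h O) (hh' : ContMDiffOn (𝓡 2) 𝓘(ℝ, ℂ) ∞ h' O) :
    ContMDiffOn (𝓡 2) 𝓘(ℝ, ℂ) ∞ (fun p => h p * h' p) O :=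
  ContDiffAt.comp_contMDiffOn (g := fun z : ℂ × ℂ => z.1 * z.2)
    (fun _ _ => (contDiff_fst.mul contDiff_snd).contDiffAt) (hh.prodMk_space hh')

theorem contMDiffOn_re {h : M → ℂ} {O : Set M} (hh : ContMDiffOn (𝓡 2) 𝓘(ℝ, ℂ) ∞ h O) :
    ContMDiffOn (𝓡 2) 𝓘(ℝ, ℝ) ∞ (fun p => (h p).re) O :=
  ContDiffAt.comp_contMDiffOn (g := Complex.re) (fun _ _ => Complex.reCLM.contDiff.contDiffAt) hh

theorem contMDiffOn_quatJ {w : M → C4} {O : Set M} (hw : ContMDiffOn (𝓡 2) 𝓘(ℝ, C4) ∞ w O) :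
    ContMDiffOn (𝓡 2) 𝓘(ℝ, C4) ∞ (fun p => quatJ (w p)) O :=
  ContDiffAt.comp_contMDiffOn (g := quatJ)
    (fun _ _ => (LinearMap.toContinuousLinearMap quatJ).contDiff.contDiffAt) hw

theorem contMDiffOn_inv_sqrt {h : M → ℝ} (hh : ContMDiffOn (𝓡 2) 𝓘(ℝ, ℝ) ∞ h O)
    (h0 : ∀ p ∈ O, 0 < h p) : ContMDiffOn (𝓡 2) 𝓘(ℝ, ℝ) ∞ (fun p => (√(h p))⁻¹) O :=
  ContDiffAt.comp_contMDiffOn (g := fun t : ℝ => (√t)⁻¹)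
    (fun p hp => (Real.contDiffAt_sqrt (h0 p hp).ne').inv (Real.sqrt_ne_zero'.2 (h0 p hp))) hh

/-- The map `v` into the unit sphere of `ℂ⁴` is a smooth lift of `f` on `O`. -/
structure IsLiftOn (f : M → CP3) (O : Set M) (v : M → C4) : Prop where
  smooth : ContMDiffOn (𝓡 2) 𝓘(ℝ, C4) ∞ v O
  norm_eq : ∀ p ∈ O, ‖v p‖ = 1
  hopf_eq : ∀ p ∈ O, hopf (v p) = f p

theorem IsLiftOn.mono {f : M → CP3} {O O' : Set M} {v : M → C4} (h : IsLiftOn f O v)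
    (hO : O' ⊆ O) : IsLiftOn f O' v :=
  ⟨h.smooth.mono hO, fun p hp => h.norm_eq p (hO hp), fun p hp => h.hopf_eq p (hO hp)⟩

variable [IsManifold (𝓡 2) ∞ M]

/-- The smooth vector field `X` on `O` has the horizontal lift `w` along the lift `v` of `f`. -/
structure IsLiftedFieldOn (f : M → CP3) (O : Set M) (v : M → C4)
    (X : ∀ p : M, TangentSpace (𝓡 2) p) (w : M → C4) : Prop where
  smooth_field : ContMDiffOn (𝓡 2) (𝓡 2).tangent ∞
    (fun p => (⟨p, X p⟩ : TangentBundle (𝓡 2) M)) O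
  smooth_lift : ContMDiffOn (𝓡 2) 𝓘(ℝ, C4) ∞ w O
  horizontal : ∀ p ∈ O, inner ℂ (v p) (w p) = 0
  surfD_eq : ∀ p ∈ O, surfD f p (X p) = pushAt (f p) (v p) (w p)

variable {f : M → CP3} {O : Set M} {v w w' : M → C4} {X Y : ∀ p : M, TangentSpace (𝓡 2) p}

theorem IsLiftedFieldOn.mono {O' : Set M} (h : IsLiftedFieldOn f O v X w) (hO : O' ⊆ O) :
    IsLiftedFieldOn f O' v X w :=
  ⟨h.smooth_field.mono hO, h.smooth_lift.mono hO, fun p hp => h.horizontal p (hO hp),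
    fun p hp => h.surfD_eq p (hO hp)⟩

theorem IsLiftedFieldOn.smul_add_smul (hX : IsLiftedFieldOn f O v X w)
    (hY : IsLiftedFieldOn f O v Y w') {a b : M → ℝ} (ha : ContMDiffOn (𝓡 2) 𝓘(ℝ, ℝ) ∞ a O)
    (hb : ContMDiffOn (𝓡 2) 𝓘(ℝ, ℝ) ∞ b O) :
    IsLiftedFieldOn f O v (fun p => a p • X p + b p • Y p) (fun p => a p • w p + b p • w' p) where
  smooth_field := (ha.smul_section hX.smooth_field).add_section (hb.smul_section hY.smooth_field)
  smooth_lift := (ha.smul hX.smooth_lift).add (hb.smul hY.smooth_lift)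
  horizontal p hp := by
    rw [inner_add_right, inner_smul_right_eq_smul, inner_smul_right_eq_smul, hX.horizontal p hp,
      hY.horizontal p hp, smul_zero, smul_zero, add_zero]
  surfD_eq p hp := by
    rw [map_add, map_smul, map_smul, hX.surfD_eq p hp, hY.surfD_eq p hp, map_add, map_smul,
      map_smul]

theorem IsLiftedFieldOn.contMDiffOn_nkMetric (hv : IsLiftOn f O v)
    (hX : IsLiftedFieldOn f O v X w) (hY : IsLiftedFieldOn f O v Y w') :
    ContMDiffOn (𝓡 2) 𝓘(ℝ, ℝ) ∞ (fun p => nkMetric (f p) (surfD f p (X p)) (surfD f p (Y p))) O :=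
        by
  have h1 := contMDiffOn_re (contMDiffOn_inner hX.smooth_lift hY.smooth_lift)
  have h2 := contMDiffOn_re (contMDiffOn_complex_mul
    (contMDiffOn_inner hX.smooth_lift (contMDiffOn_quatJ hv.smooth))
    (contMDiffOn_inner (contMDiffOn_quatJ hv.smooth) hY.smooth_lift))
  refine (((contMDiffOn_const (c := (2 : ℝ))).mul h1).sub h2).congr fun p hp => ?_
  rw [hX.surfD_eq p hp, hY.surfD_eq p hp, nkMetric_pushAt (hv.norm_eq p hp) (hv.hopf_eq p hp),
    hY.horizontal p hp, mul_zero, sub_zero]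
  rfl

/-- Locally, a smooth surface has a smooth lift and a frame of lifted vector fields. -/
theorem exists_lifted_fields (hf : ContMDiff (𝓡 2) 𝓘(ℝ, C3) ∞ f) (p₀ : M) :
    ∃ (O : Set M) (v w w' : M → C4) (X Y : ∀ p : M, TangentSpace (𝓡 2) p),
      IsOpen O ∧ p₀ ∈ O ∧ IsLiftOn f O v ∧ IsLiftedFieldOn f O v X w ∧ IsLiftedFieldOn f O v Y w' ∧
      (∀ p ∈ O, ∀ a b : ℝ, a • X p + b • Y p = 0 → a = 0 ∧ b = 0) ∧
      ∀ O' ⊆ O, IsOpen O' → (∀ p ∈ O', inner ℂ (quatJ (v p)) (w p) = 0) →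
        (∀ p ∈ O', inner ℂ (quatJ (v p)) (w' p) = 0) →
          ∀ p ∈ O', inner ℂ (quatJ (w p)) (w' p) = 0 := by
  let E2 := EuclideanSpace ℝ (Fin 2)
  let b := adaptedBasis (f p₀)
  let φ := extChartAt (𝓡 2) p₀
  let c := chartAt C3 (f p₀)
  let Ω : Set E2 := φ.target ∩ φ.symm ⁻¹' (f ⁻¹' c.source)
  -- The affine section of the quotient map over the chart at `f p₀`, composed with f; F below is
  -- its normalisation to the sphere.
  let A : E2 → C4 := fun y => affineVec b (c (f (φ.symm y)))
  let F : E2 → C4 := fun y => (‖A y‖⁻¹ : ℝ) • A y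
  have hφs : ContMDiffOn 𝓘(ℝ, E2) (𝓡 2) ∞ φ.symm φ.target := contMDiffOn_extChartAt_symm p₀
  have hΩ : IsOpen Ω :=
    hφs.continuousOn.isOpen_inter_preimage (isOpen_extChartAt_target p₀)
      (c.open_source.preimage hf.continuous)
  have hA0 : ∀ y, A y ≠ 0 := fun y => affineVec_ne_zero b _
  have hA : ContDiffOn ℝ ∞ A Ω := by
    have h1 : ContMDiffOn 𝓘(ℝ, E2) 𝓘(ℝ, C3) ∞ (fun y => c (f (φ.symm y))) Ω :=
      (contMDiffOn_chart (I := 𝓘(ℝ, C3)) (n := ∞) (x := f p₀)).comp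
        (hf.comp_contMDiffOn (hφs.mono Set.inter_subset_left)) fun y hy => hy.2
    exact (contDiff_affineVec b).comp_contDiffOn (contMDiffOn_iff_contDiffOn.1 h1)
  have hF : ContDiffOn ℝ ∞ F Ω :=
    ((hA.norm ℂ fun y _ => hA0 y).inv fun y _ => norm_ne_zero_iff.2 (hA0 y)).smul hA
  have hFn : ∀ y, ‖F y‖ = 1 := fun y => by
    rw [norm_smul, norm_inv, norm_norm, inv_mul_cancel₀ (norm_ne_zero_iff.2 (hA0 y))]
  have hF0 : ∀ y, F y ≠ 0 := fun y h => by simpa [h] using hFn y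
  have hFhopf : ∀ y ∈ Ω, hopf (F y) = f (φ.symm y) := by
    intro y hy
    have h1 : hopf (F y) = hopf (A y) := by
      change hopf ((‖A y‖⁻¹ : ℝ) • A y) = _
      rw [← Complex.coe_smul, hopf_smul _ (hA0 y)]
      exact_mod_cast inv_ne_zero (norm_ne_zero_iff.2 (hA0 y))
    rw [h1]
    exact c.left_inv hy.2
  let O : Set M := φ.source ∩ f ⁻¹' c.source
  have hOΩ : ∀ p ∈ O, φ p ∈ Ω := fun p hp => ⟨φ.map_source hp.1, by
    change f (φ.symm (φ p)) ∈ c.source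
    rw [φ.left_inv hp.1]
    exact hp.2⟩
  have hO : IsOpen O := (isOpen_extChartAt_source p₀).inter (c.open_source.preimage hf.continuous)
  have hφ : ContMDiffOn (𝓡 2) 𝓘(ℝ, E2) ∞ φ O :=
    contMDiffOn_extChartAt.mono fun p hp => by simpa [φ] using hp.1
  let t := trivializationAt E2 (TangentSpace (𝓡 2) : M → Type _) p₀
  have ht : ∀ p ∈ O, p ∈ t.baseSet := fun p hp => by simpa [φ, t] using hp.1
  let bas := (EuclideanSpace.basisFun (Fin 2) ℝ).toBasis
  let X : Fin 2 → ∀ p : M, TangentSpace (𝓡 2) p := fun i p => t.symmL ℝ p (bas i)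
  -- These are the coordinate vector fields of the chart at `p₀`, so their images under the
  -- differential of f come from the partial derivatives of F.
  have hX : ∀ i, ∀ p ∈ O, mfderiv (𝓡 2) 𝓘(ℝ, E2) φ p (X i p) = bas i := by
    intro i p hp
    have hs : p ∈ (chartAt E2 p₀).source := by simpa [φ] using hp.1
    have := t.continuousLinearMapAt_symmL (R := ℝ) (ht p hp) (bas i)
    rw [TangentBundle.continuousLinearMapAt_trivializationAt hs] at this
    exact this
  have hXs : ∀ i, ContMDiffOn (𝓡 2) (𝓡 2).tangent ∞
      (fun p => (⟨p, X i p⟩ : TangentBundle (𝓡 2) M)) O := by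
    intro i
    refine ((t.contMDiffOn_localFrame_baseSet (I := 𝓡 2) ∞ bas i).mono ht).congr fun p hp => ?_
    rw [t.localFrame_apply_of_mem_baseSet bas (ht p hp)]
    simp only [X, t.symmL_apply (ht p hp)]
    simp [Bundle.Trivialization.basisAt]
  have hd : ∀ p ∈ O, ∀ Z : TangentSpace (𝓡 2) p, surfD f p Z =
      pushAt (f p) (F (φ p)) (fderiv ℝ F (φ p) (mfderiv (𝓡 2) 𝓘(ℝ, E2) φ p Z)) := by
    intro p hp Z
    have h1 := (hasMFDerivAt_hopf (hF0 (φ p)))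
    have h2 : HasMFDerivAt 𝓘(ℝ, E2) 𝓘(ℝ, C4) F (φ p) (fderiv ℝ F (φ p)) :=
      (((hF _ (hOΩ p hp)).contDiffAt (hΩ.mem_nhds (hOΩ p hp))).differentiableAt
        (by simp)).hasFDerivAt.hasMFDerivAt
    have h3 : HasMFDerivAt (𝓡 2) 𝓘(ℝ, E2) φ p (mfderiv (𝓡 2) 𝓘(ℝ, E2) φ p) :=
      (((hφ p hp).contMDiffAt (hO.mem_nhds hp)).mdifferentiableAt (by simp)).hasMFDerivAt
    have h4 := h1.comp p (h2.comp p h3)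
    have h5 : f =ᶠ[nhds p] hopf ∘ F ∘ φ := by
      filter_upwards [hO.mem_nhds hp] with p' hp'
      simp only [Function.comp]
      rw [hFhopf _ (hOΩ p' hp'), φ.left_inv hp'.1]
    have h6 := (h4.congr_of_eventuallyEq h5).mfderiv
    have h7 : f p = hopf (F (φ p)) := h5.self_of_nhds
    refine Eq.trans ?_ (pushAt_congr h7 _ _).symm
    rw [← mfderiv_hopf_eq_pushAt (hF0 (φ p)), h1.mfderiv]
    exact congrArg (fun L : TangentSpace (𝓡 2) p →L[ℝ] C3 => L Z) h6
  have hFs : ContMDiffOn (𝓡 2) 𝓘(ℝ, C4) ∞ (fun p => F (φ p)) O :=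
    (contMDiffOn_iff_contDiffOn.2 hF).comp hφ hOΩ
  -- The partial derivatives of F made horizontal by subtracting their components along F.
  let w : Fin 2 → M → C4 := fun i p => fderiv ℝ F (φ p) (bas i) -
    (inner ℂ (F (φ p)) (fderiv ℝ F (φ p) (bas i)) : ℂ) • F (φ p)
  have hw : ∀ i, IsLiftedFieldOn f O (fun p => F (φ p)) (X i) (w i) := by
    intro i
    refine ⟨hXs i, ?_, ?_, ?_⟩
    · have h1 : ContDiffOn ℝ ∞ (fun y => fderiv ℝ F y (bas i)) Ω :=
        (hF.fderiv_of_isOpen hΩ (m := ∞) (by simp)).clm_apply contDiffOn_const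
      have h2 : ContMDiffOn (𝓡 2) 𝓘(ℝ, C4) ∞ (fun p => fderiv ℝ F (φ p) (bas i)) O :=
        (contMDiffOn_iff_contDiffOn.2 h1).comp hφ hOΩ
      exact h2.sub (ContDiffAt.comp_contMDiffOn (g := fun z : ℂ × C4 => z.1 • z.2)
        (fun _ _ => (contDiff_fst.smul contDiff_snd).contDiffAt)
        ((contMDiffOn_inner hFs h2).prodMk_space hFs))
    · intro p hp
      change inner ℂ _ (_ - _) = _
      rw [inner_sub_right, inner_smul_right, inner_self_eq_norm_sq_to_K, hFn]
      simp
    · intro p hp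
      change _ = pushAt _ _ (_ - _)
      rw [hd p hp, hX i p hp, map_sub, pushAt_smul_self (hF0 _), sub_zero]
      rw [hFhopf _ (hOΩ p hp), φ.left_inv hp.1]
  refine ⟨O, fun p => F (φ p), w 0, w 1, X 0, X 1, hO, ?_, ?_, hw 0, hw 1, ?_, ?_⟩
  · exact ⟨mem_extChartAt_source p₀, mem_chart_source C3 (f p₀)⟩
  · refine ⟨?_, fun p _ => hFn _, fun p hp => ?_⟩
    · exact hFs
    · rw [hFhopf _ (hOΩ p hp), φ.left_inv hp.1]
  · intro p hp α β h
    have h1 := congrArg (mfderiv (𝓡 2) 𝓘(ℝ, E2) φ p) h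
    rw [map_add, map_smul, map_smul, hX 0 p hp, hX 1 p hp, ContinuousLinearMap.map_zero] at h1
    have h1' : α • bas 0 + β • bas 1 = 0 := h1
    have h2 := congrArg (fun z : EuclideanSpace ℝ (Fin 2) => z 0) h1'
    have h3 := congrArg (fun z : EuclideanSpace ℝ (Fin 2) => z 1) h1'
    simp [bas] at h2 h3
    exact ⟨h2, h3⟩
  · intro O' hO' hO'o h0 h1 p hp
    -- Passing to the horizontal part does not change the pairing with jF, because jF is orthogonal
    -- to F; the hypotheses thus concern the derivatives of F themselves.
    have k : ∀ i, ∀ p, inner ℂ (quatJ (F (φ p))) (w i p) =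
        inner ℂ (quatJ (F (φ p))) (fderiv ℝ F (φ p) (bas i)) := fun i p => by
      change inner ℂ _ (_ - _) = _
      rw [inner_sub_right, inner_smul_right, inner_quatJ_self', mul_zero, sub_zero]
    have hΩ' : IsOpen (φ.target ∩ φ.symm ⁻¹' O') :=
      hφs.continuousOn.isOpen_inter_preimage (isOpen_extChartAt_target p₀) hO'o
    have hin : ∀ p ∈ O', φ p ∈ φ.target ∩ φ.symm ⁻¹' O' := fun p hp =>
      ⟨φ.map_source (hO' hp).1, by
        change φ.symm (φ p) ∈ O'
        rwa [φ.left_inv (hO' hp).1]⟩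
    have hz : ∀ i, (∀ p ∈ O', inner ℂ (quatJ (F (φ p))) (w i p) = 0) →
        ∀ y ∈ φ.target ∩ φ.symm ⁻¹' O', inner ℂ (quatJ (F y)) (fderiv ℝ F y (bas i)) = 0 := by
      intro i hi y hy
      have := hi _ hy.2
      rwa [k, φ.right_inv hy.1] at this
    have h2 := inner_quatJ_fderiv_eq_zero hΩ' (hF.mono fun y hy => ⟨hy.1, (hO' hy.2).2⟩)
      (hz 0 h0) (hz 1 h1) (hin p hp)
    have h3 := h0 p hp
    have h4 := h1 p hp
    rw [k] at h3 h4
    change inner ℂ (quatJ (_ - _)) (_ - _) = _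
    rw [map_sub, quatJ_smul]
    simp only [inner_sub_left, inner_sub_right, inner_smul_left, inner_smul_right, h2, h4,
      inner_quatJ_self']
    rw [inner_quatJ_antisymm, h3]
    simp

/-- The vector fields `U`, `V` form an orthonormal frame of the surface, with horizontal lifts
`w`, `w'` along the lift `v`. -/
structure IsLiftedFrameOn (f : M → CP3) (O : Set M) (v : M → C4)
    (U V : ∀ p : M, TangentSpace (𝓡 2) p) (w w' : M → C4) : Prop where
  lift : IsLiftOn f O v
  fst : IsLiftedFieldOn f O v U w
  snd : IsLiftedFieldOn f O v V w'
  fst_fst : ∀ p ∈ O, nkMetric (f p) (surfD f p (U p)) (surfD f p (U p)) = 1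
  snd_snd : ∀ p ∈ O, nkMetric (f p) (surfD f p (V p)) (surfD f p (V p)) = 1
  fst_snd : ∀ p ∈ O, nkMetric (f p) (surfD f p (U p)) (surfD f p (V p)) = 0

theorem IsLiftedFrameOn.isOrthonormalFrameOn {U V : ∀ p : M, TangentSpace (𝓡 2) p}
    (h : IsLiftedFrameOn f O v U V w w') : IsOrthonormalFrameOn f O U V :=
  ⟨h.fst.smooth_field, h.snd.smooth_field, h.fst_fst, h.snd_snd, h.fst_snd⟩

theorem IsLiftedFrameOn.mono {U V : ∀ p : M, TangentSpace (𝓡 2) p} {O' : Set M}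
    (h : IsLiftedFrameOn f O v U V w w') (hO : O' ⊆ O) : IsLiftedFrameOn f O' v U V w w' :=
  ⟨h.lift.mono hO, h.fst.mono hO, h.snd.mono hO, fun p hp => h.fst_fst p (hO hp),
    fun p hp => h.snd_snd p (hO hp), fun p hp => h.fst_snd p (hO hp)⟩

/-- Locally, an immersed surface has an orthonormal frame with horizontal lifts. -/
theorem exists_lifted_frame (hf : IsImmersedSurface f) (p₀ : M) :
    ∃ (O : Set M) (v w w' : M → C4) (U V : ∀ p : M, TangentSpace (𝓡 2) p),
      IsOpen O ∧ p₀ ∈ O ∧ IsLiftedFrameOn f O v U V w w' ∧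
      ∀ O' ⊆ O, IsOpen O' → (∀ p ∈ O', inner ℂ (quatJ (v p)) (w p) = 0) →
        (∀ p ∈ O', inner ℂ (quatJ (v p)) (w' p) = 0) →
          ∀ p ∈ O', inner ℂ (quatJ (w p)) (w' p) = 0 := by
  obtain ⟨O, v, w, w', X, Y, hO, hp₀, hv, hX, hY, hXY, hint⟩ := exists_lifted_fields hf.smooth p₀
  have hpos : ∀ p, ∀ Z : TangentSpace (𝓡 2) p, Z ≠ 0 →
      0 < nkMetric (f p) (surfD f p Z) (surfD f p Z) := fun p Z hZ =>
    nkMetric_pos _ fun h => hZ (hf.injective p (by rw [h, map_zero]))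
  have hX0 : ∀ p ∈ O, X p ≠ 0 := fun p hp h => by
    simpa using (hXY p hp 1 0 (by rw [h]; simp)).1
  -- normalize the first field
  let n₁ : M → ℝ := fun p => nkMetric (f p) (surfD f p (X p)) (surfD f p (X p))
  have hn₁ : ∀ p ∈ O, 0 < n₁ p := fun p hp => hpos p _ (hX0 p hp)
  have hn₁s : ContMDiffOn (𝓡 2) 𝓘(ℝ, ℝ) ∞ (fun p => (√(n₁ p))⁻¹) O :=
    contMDiffOn_inv_sqrt (hX.contMDiffOn_nkMetric hv hX) hn₁
  -- The zero coefficient lets `smul_add_smul` serve for plain rescaling.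
  have h0 : ContMDiffOn (𝓡 2) 𝓘(ℝ, ℝ) ∞ (fun _ : M => (0 : ℝ)) O := contMDiffOn_const
  have hU := hX.smul_add_smul hX hn₁s h0
  set U := fun p => (√(n₁ p))⁻¹ • X p + (0 : ℝ) • X p with hUdef
  have hUU : ∀ p ∈ O, nkMetric (f p) (surfD f p (U p)) (surfD f p (U p)) = 1 := fun p hp => by
    have h1 : n₁ p ≠ 0 := (hn₁ p hp).ne'
    have h2 := Real.mul_self_sqrt (hn₁ p hp).le
    have h3 : √(n₁ p) ≠ 0 := Real.sqrt_ne_zero'.2 (hn₁ p hp)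
    simp only [hUdef, zero_smul, add_zero, map_smul, nkMetric_smul_left, nkMetric_smul_right]
    change (√(n₁ p))⁻¹ * ((√(n₁ p))⁻¹ * n₁ p) = 1
    field_simp
    linarith
  -- make the second field orthogonal to the first one, and normalize it
  have hc : ContMDiffOn (𝓡 2) 𝓘(ℝ, ℝ) ∞
      (fun p => nkMetric (f p) (surfD f p (Y p)) (surfD f p (U p))) O :=
    hY.contMDiffOn_nkMetric hv hU
  have h1 : ContMDiffOn (𝓡 2) 𝓘(ℝ, ℝ) ∞ (fun _ : M => (1 : ℝ)) O := contMDiffOn_const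
  have hZ := hY.smul_add_smul hU h1 hc.neg
  set Z := fun p => (1 : ℝ) • Y p +
    (-fun p => nkMetric (f p) (surfD f p (Y p)) (surfD f p (U p))) p • U p with hZdef
  have hZU : ∀ p ∈ O, nkMetric (f p) (surfD f p (Z p)) (surfD f p (U p)) = 0 := fun p hp => by
    simp only [hZdef, map_add, map_smul, nkMetric_add_left, nkMetric_smul_left, hUU p hp,
      Pi.neg_apply]
    ring
  have hZ0 : ∀ p ∈ O, Z p ≠ 0 := fun p hp h => by
    have h2 := hXY p hp ((-fun p => nkMetric (f p) (surfD f p (Y p)) (surfD f p (U p))) p *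
      (√(n₁ p))⁻¹) 1 (by
        rw [← h]
        simp only [hZdef, hUdef]
        module)
    exact one_ne_zero h2.2
  let n₂ : M → ℝ := fun p => nkMetric (f p) (surfD f p (Z p)) (surfD f p (Z p))
  have hn₂ : ∀ p ∈ O, 0 < n₂ p := fun p hp => hpos p _ (hZ0 p hp)
  have hn₂s : ContMDiffOn (𝓡 2) 𝓘(ℝ, ℝ) ∞ (fun p => (√(n₂ p))⁻¹) O :=
    contMDiffOn_inv_sqrt (hZ.contMDiffOn_nkMetric hv hZ) hn₂
  have hV := hZ.smul_add_smul hZ hn₂s h0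
  refine ⟨O, v, _, _, U, _, hO, hp₀, ⟨hv, hU, hV, hUU, fun p hp => ?_, fun p hp => ?_⟩, ?_⟩
  · have h1 : n₂ p ≠ 0 := (hn₂ p hp).ne'
    have h2 := Real.mul_self_sqrt (hn₂ p hp).le
    have h3 : √(n₂ p) ≠ 0 := Real.sqrt_ne_zero'.2 (hn₂ p hp)
    simp only [zero_smul, add_zero, map_smul, nkMetric_smul_left, nkMetric_smul_right]
    change (√(n₂ p))⁻¹ * ((√(n₂ p))⁻¹ * n₂ p) = 1
    field_simp
    linarith
  · simp only [zero_smul, add_zero, map_smul, nkMetric_smul_right]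
    rw [nkMetric_comm]
    exact mul_eq_zero_of_right _ (hZU p hp)
  -- Gram-Schmidt is a real triangular change of frame with nonzero diagonal: vanishing of ⟨jv, ·⟩
  -- passes back to the original fields, and the alternating ⟨j·, ·⟩ passes forward to the new ones.
  · intro O' hO' hO'o hw hw' p hp
    have k1 : ∀ p ∈ O', inner ℂ (quatJ (v p)) (w p) = 0 := fun p hp => by
      have := hw p hp
      have h3 : √(n₁ p) ≠ 0 := Real.sqrt_ne_zero'.2 (hn₁ p (hO' hp))
      simpa [h3] using this
    have k2 : ∀ p ∈ O', inner ℂ (quatJ (v p)) (w' p) = 0 := fun p hp => by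
      have := hw' p hp
      have h3 : √(n₂ p) ≠ 0 := Real.sqrt_ne_zero'.2 (hn₂ p (hO' hp))
      simp only [zero_smul, add_zero, inner_add_right, inner_smul_right_eq_smul, k1 p hp, smul_zero,
        one_smul] at this
      exact (smul_eq_zero.1 this).resolve_left (inv_ne_zero h3)
    have k3 := hint O' hO' hO'o k1 k2 p hp
    have k4 : inner ℂ (quatJ (w p)) (w p) = 0 := by
      have := inner_quatJ_antisymm (w p) (w p)
      exact self_eq_neg.1 this
    simp only [map_smul, zero_smul, add_zero, inner_add_right, inner_smul_left_eq_smul,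
      inner_smul_right_eq_smul, k3, k4, smul_zero, one_smul]

end LocalLifts

/-- A nowhere vanishing smooth complex function locally has a smooth argument. -/
theorem exists_smooth_arg {M : Type*} [TopologicalSpace M]
    [ChartedSpace (EuclideanSpace ℝ (Fin 2)) M] {O : Set M} {ζ : M → ℂ} (hO : IsOpen O)
    (hζ : ContMDiffOn (𝓡 2) 𝓘(ℝ, ℂ) ∞ ζ O)
    {p₀ : M} (hp₀ : p₀ ∈ O) (h0 : ζ p₀ ≠ 0) :
    ∃ O' ⊆ O, IsOpen O' ∧ p₀ ∈ O' ∧ ∃ ψ : M → ℝ, ContMDiffOn (𝓡 2) 𝓘(ℝ, ℝ) ∞ ψ O' ∧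
      ∀ p ∈ O', (ζ p).re = ‖ζ p‖ * Real.cos (ψ p) ∧ (ζ p).im = ‖ζ p‖ * Real.sin (ψ p) := by
  have hopen := (hζ.continuousOn.div_const (ζ p₀)).isOpen_inter_preimage hO
    Complex.isOpen_slitPlane
  -- Division by the value at the base point moves it to 1, inside the domain of the principal
  -- logarithm.
  let g : ℂ → ℝ := fun z => Complex.arg (ζ p₀) + (Complex.log (z / ζ p₀)).im
  refine ⟨_, Set.inter_subset_left, hopen, ⟨hp₀, ?_⟩, fun p => g (ζ p),
    ContDiffAt.comp_contMDiffOn (fun p hp => ?_) (hζ.mono Set.inter_subset_left), fun p hp => ?_⟩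
  · change ζ p₀ / ζ p₀ ∈ Complex.slitPlane
    rw [div_self h0]
    exact Complex.one_mem_slitPlane
  · have h1 : ContDiffAt ℂ ∞ (fun z => Complex.log (z / ζ p₀)) (ζ p) :=
      (Complex.contDiffAt_log hp.2).comp (ζ p) (contDiffAt_id.div_const _)
    exact contDiffAt_const.add
      (Complex.imCLM.contDiff.contDiffAt.comp (ζ p) (h1.restrict_scalars ℝ))
  · have h1 : ζ p = ‖ζ p‖ * Complex.exp ((g (ζ p) : ℝ) * Complex.I) := by
      have e1 := Complex.norm_mul_exp_arg_mul_I (ζ p₀)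
      have e2 := Complex.norm_mul_exp_arg_mul_I (ζ p / ζ p₀)
      have e3 : ζ p = ζ p₀ * (ζ p / ζ p₀) := by field_simp
      have e4 : ‖ζ p‖ = ‖ζ p₀‖ * ‖ζ p / ζ p₀‖ := by rw [← norm_mul, ← e3]
      calc ζ p = ζ p₀ * (ζ p / ζ p₀) := e3
        _ = _ := by
          rw [e4]
          nth_rewrite 1 [← e1]
          nth_rewrite 1 [← e2]
          simp only [g, Complex.log_im]
          push_cast
          rw [add_mul, Complex.exp_add]
          ring
    constructor
    · have := congrArg Complex.re h1
      rwa [Complex.re_ofReal_mul, Complex.exp_ofReal_mul_I_re] at this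
    · have := congrArg Complex.im h1
      rwa [Complex.im_ofReal_mul, Complex.exp_ofReal_mul_I_im] at this

/-! ### Frames along the surface and the criteria in terms of g(J∘U, V) -/

section Frames

variable {M : Type*} [TopologicalSpace M] [ChartedSpace (EuclideanSpace ℝ (Fin 2)) M]
  [IsManifold (𝓡 2) ∞ M] {f : M → CP3} {O : Set M} {v w w' : M → C4}
  {U V : ∀ p : M, TangentSpace (𝓡 2) p}

theorem IsOrthonormalFrameOn.isTotallyRealPair (h : IsOrthonormalFrameOn f O U V)
    (hTR : IsNKTotallyReal f) {p : M} (hp : p ∈ O) :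
    IsTotallyRealPair (surfD f p (U p)) (surfD f p (V p)) :=
  ⟨h.fst_fst p hp, h.snd_snd p hp, h.fst_snd p hp, hTR p _ _⟩

theorem IsOrthonormalFrameOn.exists_surfD_eq (h : IsOrthonormalFrameOn f O U V) {p : M}
    (hp : p ∈ O) (X : TangentSpace (𝓡 2) p) :
    ∃ a b : ℝ, surfD f p X = a • surfD f p (U p) + b • surfD f p (V p) := by
  have hi : LinearIndependent ℝ ![U p, V p] := by
    rw [LinearIndependent.pair_iff]
    intro a b hab
    have h1 := congrArg (surfD f p) hab
    rw [map_add, map_smul, map_smul, map_zero] at h1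
    have hz : ∀ Z : TCP3 (f p), nkMetric (f p) 0 Z = 0 := fun Z => by
      simpa using nkMetric_smul_left (0 : ℝ) (0 : TCP3 (f p)) Z
    have h2 := hz (surfD f p (U p))
    have h3 := hz (surfD f p (V p))
    rw [← h1] at h2 h3
    simp only [nkMetric_add_left, nkMetric_smul_left, nkMetric_comm (surfD f p (V p)),
      h.fst_fst p hp, h.snd_snd p hp, h.fst_snd p hp] at h2 h3
    constructor <;> linarith
  have hfin : Fintype.card (Fin 2) = Module.finrank ℝ (TangentSpace (𝓡 2) p) := by
    change _ = Module.finrank ℝ (EuclideanSpace ℝ (Fin 2))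
    simp
  have hs := hi.span_eq_top_of_card_eq_finrank hfin
  have hX : X ∈ Submodule.span ℝ (Set.range ![U p, V p]) := hs ▸ Submodule.mem_top
  rw [Matrix.range_cons, Matrix.range_cons, Matrix.range_empty, Set.union_empty,
    Set.singleton_union, Submodule.mem_span_pair] at hX
  obtain ⟨a, b, rfl⟩ := hX
  exact ⟨a, b, by rw [map_add, map_smul, map_smul]⟩

theorem IsOrthonormalFrameOn.fubiniStudy_kahlerJ_eq_zero_iff (h : IsOrthonormalFrameOn f O U V)
    (hTR : IsNKTotallyReal f) {p : M} (hp : p ∈ O) :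
    (∀ X Y : TangentSpace (𝓡 2) p,
      fubiniStudy (f p) (surfD f p X) (kahlerJ (f p) (surfD f p Y)) = 0) ↔
    nkMetric (f p) (kahlerJ (f p) (surfD f p (U p))) (surfD f p (V p)) = 0 := by
  have hE := h.isTotallyRealPair hTR hp
  constructor
  · intro h0
    have h1 := hE.fubiniStudy_eq 1 0 0 1
    rw [one_smul, zero_smul, add_zero, zero_smul, one_smul, zero_add, h0] at h1
    linarith
  · intro h0 X Y
    obtain ⟨a, b, hX⟩ := h.exists_surfD_eq hp X
    obtain ⟨c, d, hY⟩ := h.exists_surfD_eq hp Y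
    rw [hX, hY, hE.fubiniStudy_eq, h0, mul_zero, mul_zero]

theorem IsOrthonormalFrameOn.kahlerJ_mem_range_iff (h : IsOrthonormalFrameOn f O U V)
    (hTR : IsNKTotallyReal f) {p : M} (hp : p ∈ O) :
    (∀ X : TangentSpace (𝓡 2) p, ∃ Y : TangentSpace (𝓡 2) p,
      kahlerJ (f p) (surfD f p X) = surfD f p Y) ↔
    nkMetric (f p) (kahlerJ (f p) (surfD f p (U p))) (surfD f p (V p)) ^ 2 = 1 := by
  have hE := h.isTotallyRealPair hTR hp
  constructor
  · intro h0
    obtain ⟨Y, hY⟩ := h0 (U p)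
    obtain ⟨a, b, hab⟩ := h.exists_surfD_eq hp Y
    exact hE.sq_eq_one (hY.trans hab)
  · intro h0 X
    obtain ⟨a, b, hX⟩ := h.exists_surfD_eq hp X
    obtain ⟨h1, h2⟩ := hE.kahlerJ_eq h0
    set β := nkMetric (f p) (kahlerJ (f p) (surfD f p (U p))) (surfD f p (V p))
    refine ⟨a • β • V p + b • (-β) • U p, ?_⟩
    rw [hX, kahlerJ_add, kahlerJ_smul, kahlerJ_smul, h1, h2]
    simp only [map_add, map_smul]

theorem IsLiftedFrameOn.nkMetric_kahlerJ_eq (h : IsLiftedFrameOn f O v U V w w')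
    (hTR : IsNKTotallyReal f) {p : M} (hp : p ∈ O) :
    nkMetric (f p) (kahlerJ (f p) (surfD f p (U p))) (surfD f p (V p)) =
      -2 * (inner ℂ (quatJ (v p)) (w p) * conj (inner ℂ (quatJ (v p)) (w' p))).im := by
  have hE := h.isOrthonormalFrameOn.isTotallyRealPair hTR hp
  rw [h.fst.surfD_eq p hp, h.snd.surfD_eq p hp] at hE ⊢
  exact hE.nkMetric_kahlerJ_eq (h.lift.norm_eq p hp) (h.lift.hopf_eq p hp)

theorem IsLiftedFrameOn.continuousOn_inner_quatJ (h : IsLiftedFrameOn f O v U V w w') :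
    ContinuousOn (fun p => (inner ℂ (quatJ (v p)) (w p) : ℂ)) O :=
  (contMDiffOn_inner (contMDiffOn_quatJ h.lift.smooth) h.fst.smooth_lift).continuousOn

theorem IsLiftedFrameOn.swap (h : IsLiftedFrameOn f O v U V w w') :
    IsLiftedFrameOn f O v V U w' w :=
  ⟨h.lift, h.snd, h.fst, h.snd_snd, h.fst_fst, fun p hp => by
    rw [nkMetric_comm, h.fst_snd p hp]⟩

/-- The tensors are defined through arbitrarily chosen unitary bases, so continuity is read off from
the expression in the smooth lifts. -/
theorem IsLiftedFrameOn.continuousOn_nkMetric_kahlerJ (h : IsLiftedFrameOn f O v U V w w')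
    (hTR : IsNKTotallyReal f) :
    ContinuousOn (fun p => nkMetric (f p) (kahlerJ (f p) (surfD f p (U p)))
      (surfD f p (V p))) O := by
  refine ContinuousOn.congr (f := fun p =>
    -2 * (inner ℂ (quatJ (v p)) (w p) * conj (inner ℂ (quatJ (v p)) (w' p))).im) ?_
    fun p hp => h.nkMetric_kahlerJ_eq hTR hp
  exact continuousOn_const.mul (Complex.continuous_im.comp_continuousOn
    (h.continuousOn_inner_quatJ.mul
      (Complex.continuous_conj.comp_continuousOn h.swap.continuousOn_inner_quatJ)))

/-- Rotation of a frame. -/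
theorem IsLiftedFrameOn.rotate (h : IsLiftedFrameOn f O v U V w w') {a b : M → ℝ}
    (ha : ContMDiffOn (𝓡 2) 𝓘(ℝ, ℝ) ∞ a O) (hb : ContMDiffOn (𝓡 2) 𝓘(ℝ, ℝ) ∞ b O)
    (hab : ∀ p ∈ O, a p ^ 2 + b p ^ 2 = 1) :
    IsLiftedFrameOn f O v (fun p => a p • U p + b p • V p) (fun p => (-b) p • U p + a p • V p)
      (fun p => a p • w p + b p • w' p) (fun p => (-b) p • w p + a p • w' p) := by
  refine ⟨h.lift, h.fst.smul_add_smul h.snd ha hb, h.fst.smul_add_smul h.snd hb.neg ha,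
    fun p hp => ?_, fun p hp => ?_, fun p hp => ?_⟩ <;>
  · have h1 := hab p hp
    simp only [map_add, map_smul, nkMetric_add_left, nkMetric_add_right, nkMetric_smul_left,
      nkMetric_smul_right, h.fst_fst p hp, h.snd_snd p hp, h.fst_snd p hp,
      nkMetric_comm (surfD f p (V p)) (surfD f p (U p)), Pi.neg_apply]
    linarith

/-- A property which along lifted frames is given by a closed condition on `g(J∘ U, V)` holds
everywhere as soon as it holds on a dense set. -/
theorem forall_of_dense (hf : IsImmersedSurface f) (hTR : IsNKTotallyReal f) {D : Set M}
    (hD : Dense D) {P : M → Prop} {q : ℝ → ℝ} (hq : Continuous q)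
    (hP : ∀ (O : Set M) (U V : ∀ p : M, TangentSpace (𝓡 2) p), IsOrthonormalFrameOn f O U V →
      ∀ p ∈ O, P p ↔
        q (nkMetric (f p) (kahlerJ (f p) (surfD f p (U p))) (surfD f p (V p))) = 0)
    (h : ∀ p ∈ D, P p) (p : M) : P p := by
  obtain ⟨O, v, w, w', U, V, hO, hp, hE, -⟩ := exists_lifted_frame hf p
  rw [hP O U V hE.isOrthonormalFrameOn p hp]
  by_contra hne
  have hopen := (hq.comp_continuousOn (hE.continuousOn_nkMetric_kahlerJ hTR)).isOpen_inter_preimage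
    hO (isOpen_ne (x := (0 : ℝ)))
  obtain ⟨p', hp', hpD⟩ := hD.inter_open_nonempty _ hopen ⟨p, hp, hne⟩
  exact hp'.2 ((hP O U V hE.isOrthonormalFrameOn p' hp'.1).1 (h p' hpD))

/-- `M` is of Type 0 with `λ = 0` on `O`, or of Type 2 with `cos α = 0`. -/
def IsTotallyRealTypeOn (f : M → CP3) (O : Set M) : Prop :=
  (∃ lam : M → ℝ, IsType0On f O lam ∧ ∀ p ∈ O, lam p = 0) ∨
    (∃ α : M → ℝ, IsType2On f O α ∧ ∀ p ∈ O, Real.cos (α p) = 0)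

/-- `M` is of Type 2 with `sin α = 0` on `O`. -/
def IsAlmostComplexTypeOn (f : M → CP3) (O : Set M) : Prop :=
  ∃ α : M → ℝ, IsType2On f O α ∧ ∀ p ∈ O, Real.sin (α p) = 0

theorem IsTotallyRealTypeOn.fubiniStudy_kahlerJ (h : IsTotallyRealTypeOn f O)
    (hTR : IsNKTotallyReal f) {p : M} (hp : p ∈ O) (X Y : TangentSpace (𝓡 2) p) :
    fubiniStudy (f p) (surfD f p X) (kahlerJ (f p) (surfD f p Y)) = 0 := by
  obtain ⟨lam, ⟨U, V, α, θ, hE, -, -, -, hJ⟩, hlam⟩ | ⟨α, ⟨U, V, hE, -, hJ⟩, hcos⟩ := h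
  · refine (hE.fubiniStudy_kahlerJ_eq_zero_iff hTR hp).2 ?_ X Y
    -- For λ = 0 the second frame equation reads J∘V = JV, with no G(U, V) term.
    have h1 := (hJ p hp).2.2
    rw [hlam p hp] at h1
    simp only [zero_div, zero_mul, neg_zero, zero_smul, ne_eq, OfNat.ofNat_ne_zero,
      not_false_eq_true, zero_pow, add_zero, zero_add, div_one, one_smul] at h1
    rw [nkMetric_kahlerJ_left, h1, hTR, neg_zero]
  · refine (hE.fubiniStudy_kahlerJ_eq_zero_iff hTR hp).2 ?_ X Y
    have h1 := (hJ p hp).1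
    rw [hcos p hp] at h1
    simp only [zero_smul, add_zero, zero_add] at h1
    rw [h1, nkMetric_smul_left, nkMetric_comm, hTR, mul_zero]

theorem IsAlmostComplexTypeOn.exists_kahlerJ_eq (h : IsAlmostComplexTypeOn f O)
    (hTR : IsNKTotallyReal f) {p : M} (hp : p ∈ O) (X : TangentSpace (𝓡 2) p) :
    ∃ Y : TangentSpace (𝓡 2) p, kahlerJ (f p) (surfD f p X) = surfD f p Y := by
  obtain ⟨α, ⟨U, V, hE, -, hJ⟩, hsin⟩ := h
  refine (hE.kahlerJ_mem_range_iff hTR hp).2 ?_ X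
  have h1 := (hJ p hp).1
  rw [hsin p hp] at h1
  simp only [zero_smul, add_zero] at h1
  exact (hE.isTotallyRealPair hTR hp).sq_eq_one (a := 0) (b := Real.cos (α p))
    (by rw [h1, zero_smul, zero_add])

/-- Here g(J∘U, V) is continuous with values ±1, hence of constant sign near each point; the angle
is the constant 0 or π and no exceptional set is needed. -/
theorem exists_isAlmostComplexTypeOn (hf : IsImmersedSurface f) (hTR : IsNKTotallyReal f)
    (hC : IsKahlerAlmostComplex f) (p₀ : M) :
    ∃ O : Set M, IsOpen O ∧ p₀ ∈ O ∧ IsAlmostComplexTypeOn f O := by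
  obtain ⟨O, v, w, w', U, V, hO, hp₀, hE, -⟩ := exists_lifted_frame hf p₀
  have hF := hE.isOrthonormalFrameOn
  have hc := hE.continuousOn_nkMetric_kahlerJ hTR
  have hβ : ∀ p ∈ O, _ := fun p hp => (hF.kahlerJ_mem_range_iff hTR hp).1 (hC p)
  -- S will be an open half-line isolating one of the values ±1, and t the angle whose cosine is
  -- that value.
  have key : ∀ (S : Set ℝ) (t : ℝ), IsOpen S → Real.sin t = 0 →
      nkMetric (f p₀) (kahlerJ (f p₀) (surfD f p₀ (U p₀))) (surfD f p₀ (V p₀)) ∈ S →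
      (∀ β ∈ S, β ^ 2 = 1 → β = Real.cos t) →
      ∃ O : Set M, IsOpen O ∧ p₀ ∈ O ∧ IsAlmostComplexTypeOn f O := by
    intro S t hS ht hp hcos
    refine ⟨_, hc.isOpen_inter_preimage hO hS, ⟨hp₀, hp⟩, fun _ => t,
      ⟨U, V, (hE.mono Set.inter_subset_left).isOrthonormalFrameOn, contMDiffOn_const,
        fun p hp => ?_⟩, fun _ _ => ht⟩
    obtain ⟨h1, h2⟩ := (hF.isTotallyRealPair hTR hp.1).kahlerJ_eq (hβ p hp.1)
    have h3 := hcos _ hp.2 (hβ p hp.1)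
    simp only at h3
    rw [h3] at h1 h2
    simp only [KahlerJInFrame, ht, neg_zero, zero_smul, add_zero]
    exact ⟨h1, h2⟩
  obtain h1 | h1 := sq_eq_one_iff.1 (hβ p₀ hp₀)
  · refine key (Set.Ioi 0) 0 isOpen_Ioi Real.sin_zero ?_ fun β hβ h2 => ?_
    · rw [h1]
      exact one_pos (α := ℝ)
    · rw [Real.cos_zero]
      exact (pow_eq_one_iff_of_nonneg (le_of_lt hβ) two_ne_zero).1 h2
  · refine key (Set.Iio 0) Real.pi isOpen_Iio Real.sin_pi ?_ fun β hβ h2 => ?_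
    · rw [h1]
      exact neg_one_lt_zero (R := ℝ)
    · have h3 : β < 0 := hβ
      rw [Real.cos_pi]
      nlinarith

/-- The Type 0 and Type 2 surfaces which are totally real for `J∘`, in a frame with
`⟨j v, w'⟩ = 0`. -/
theorem IsLiftedFrameOn.exists_isTotallyRealTypeOn (h : IsLiftedFrameOn f O v U V w w')
    (hTR : IsNKTotallyReal f) (hO : IsOpen O) (hne : O.Nonempty)
    (hw' : ∀ p ∈ O, inner ℂ (quatJ (v p)) (w' p) = 0)
    (hw : ∀ p ∈ O, inner ℂ (quatJ (v p)) (w p) ≠ 0) :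
    ∃ O' ⊆ O, IsOpen O' ∧ O'.Nonempty ∧ IsTotallyRealTypeOn f O' := by
  have hpair : ∀ p ∈ O, IsTotallyRealPair (pushAt (f p) (v p) (w p))
      (pushAt (f p) (v p) (w' p)) := fun p hp => by
    have hE := h.isOrthonormalFrameOn.isTotallyRealPair hTR hp
    rwa [h.fst.surfD_eq p hp, h.snd.surfD_eq p hp] at hE
  have hJ := fun p (hp : p ∈ O) => (hpair p hp).kahlerJ_eq_of_inner_quatJ_eq_zero
    (h.lift.norm_eq p hp) (h.lift.hopf_eq p hp) (h.fst.horizontal p hp) (h.snd.horizontal p hp)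
    (hw' p hp)
  simp only at hJ
  have hle := fun p (hp : p ∈ O) => (hpair p hp).norm_inner_quatJ_le
    (h.lift.norm_eq p hp) (h.lift.hopf_eq p hp)
  set a : M → ℂ := fun p => inner ℂ (quatJ (v p)) (w p) with ha
  have has : ContMDiffOn (𝓡 2) 𝓘(ℝ, ℂ) ∞ a O :=
    contMDiffOn_inner (contMDiffOn_quatJ h.lift.smooth) h.fst.smooth_lift
  let z : M → ℂ := fun p => -4 * conj (a p) * inner ℂ (quatJ (w p)) (w' p)
  have hzs : ContMDiffOn (𝓡 2) 𝓘(ℝ, ℂ) ∞ z O := by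
    have h1 := contMDiffOn_inner h.fst.smooth_lift (contMDiffOn_quatJ h.lift.smooth)
    refine (contMDiffOn_complex_mul (contMDiffOn_complex_mul
      (contMDiffOn_const (c := (-4 : ℂ))) h1)
      (contMDiffOn_inner (contMDiffOn_quatJ h.fst.smooth_lift) h.snd.smooth_lift)).congr
      fun p _ => ?_
    simp only [z, ha, inner_conj_symm]
  -- Strict inequality somewhere gives Type 0 near that point; otherwise |a| = 1 throughout O, which
  -- gives Type 2.
  by_cases hlt : ∃ p₁ ∈ O, ‖a p₁‖ < 1
  · obtain ⟨p₁, hp₁, hlt⟩ := hlt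
    have hO₁ := (has.continuousOn.norm).isOpen_inter_preimage hO (isOpen_Iio (a := (1 : ℝ)))
    set O₁ := O ∩ (fun p => ‖a p‖) ⁻¹' Set.Iio 1
    have hτ : ∀ p ∈ O₁, 0 < ‖a p‖ ^ 2 ∧ ‖a p‖ ^ 2 < 1 := fun p hp => by
      have h1 : 0 < ‖a p‖ := norm_pos_iff.2 (hw p hp.1)
      have h2 : ‖a p‖ < 1 := hp.2
      exact ⟨by positivity, by nlinarith⟩
    have hz0 : z p₁ ≠ 0 := fun h0 => by
      have h1 := (hJ p₁ hp₁).2.2.1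
      have h2 := hτ p₁ ⟨hp₁, hlt⟩
      change ‖z p₁‖ ^ 2 = _ at h1
      rw [h0, norm_zero] at h1
      nlinarith
    obtain ⟨O₂, hO₂, hO₂o, hp₂, ψ, hψ, hzψ⟩ := exists_smooth_arg hO₁
      (hzs.mono Set.inter_subset_left) ⟨hp₁, hlt⟩ hz0
    have hO₂O : O₂ ⊆ O := hO₂.trans Set.inter_subset_left
    -- The coefficient of JU forces sin α = 1 - 2|a|², and then cos α = |z|. The coefficients of G
    -- and JG are cos α sin θ and cos α cos θ, hence θ = π/2 - arg z. Because 0 < |a| < 1, the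
    -- arcsine stays in its smooth range.
    refine ⟨O₂, hO₂O, hO₂o, ⟨p₁, hp₂⟩, Or.inl ⟨fun _ => 0, ⟨U, V,
      fun p => Real.arcsin (1 - 2 * ‖a p‖ ^ 2), fun p => Real.pi / 2 - ψ p,
      (h.mono hO₂O).isOrthonormalFrameOn, contMDiffOn_const, ?_, contMDiffOn_const.sub hψ,
      fun p hp => ⟨?_, ?_⟩⟩, fun _ _ => rfl⟩⟩
    · refine ContDiffAt.comp_contMDiffOn
        (g := fun c : ℂ => Real.arcsin (1 - 2 * ‖c‖ ^ 2)) (fun p hp => ?_) (has.mono hO₂O)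
      have h1 := hτ p (hO₂ hp)
      have h2 : ContDiff ℝ ∞ (fun c : ℂ => 1 - 2 * ‖c‖ ^ 2) :=
        contDiff_const.sub (contDiff_const.mul (contDiff_norm_sq ℝ))
      exact (Real.contDiffAt_arcsin (by linarith) (by linarith)).comp (a p) h2.contDiffAt
    · have h1 := hτ p (hO₂ hp)
      exact ⟨Real.neg_pi_div_two_lt_arcsin.2 (by linarith),
        Real.arcsin_lt_pi_div_two.2 (by linarith)⟩
    · have h1 := hτ p (hO₂ hp)
      obtain ⟨j1, j2, j3, -⟩ := hJ p (hO₂O hp)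
      change kahlerJ (f p) _ = _ + (z p).re • _ + (z p).im • _ at j2
      change ‖z p‖ ^ 2 = _ at j3
      have hs : Real.sin (Real.arcsin (1 - 2 * ‖a p‖ ^ 2)) = 1 - 2 * ‖a p‖ ^ 2 :=
        Real.sin_arcsin (by linarith) (by linarith)
      have hcs : Real.cos (Real.arcsin (1 - 2 * ‖a p‖ ^ 2)) = ‖z p‖ := by
        rw [Real.cos_arcsin, ← j3, Real.sqrt_sq (norm_nonneg _)]
      rw [(hzψ p hp).1, (hzψ p hp).2] at j2
      rw [← h.fst.surfD_eq p (hO₂O hp), ← h.snd.surfD_eq p (hO₂O hp)] at j2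
      rw [← h.snd.surfD_eq p (hO₂O hp)] at j1
      simp only [KahlerJInFrame, hs, hcs, Real.sin_pi_div_two_sub, Real.cos_pi_div_two_sub,
        zero_mul, neg_zero, zero_smul, ne_eq, OfNat.ofNat_ne_zero,
        not_false_eq_true, zero_pow, add_zero, zero_add, div_one, one_smul, Real.sqrt_one]
      exact ⟨j2, j1⟩
  · push Not at hlt
    have hone : ∀ p ∈ O, ‖a p‖ = 1 := fun p hp => le_antisymm (hle p hp) (hlt p hp)
    -- With |a| = 1 one has z = 0, J∘U = -JU and J∘V = JV, so sin α = -1.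
    refine ⟨O, subset_rfl, hO, hne, Or.inr ⟨fun _ => -(Real.pi / 2), ⟨U, V,
      h.isOrthonormalFrameOn, contMDiffOn_const, fun p hp => ?_⟩, fun _ _ => by simp⟩⟩
    obtain ⟨j1, j2, j3, -⟩ := hJ p hp
    change kahlerJ (f p) _ = _ + (z p).re • _ + (z p).im • _ at j2
    change ‖z p‖ ^ 2 = _ at j3
    have hz : z p = 0 := by
      rw [hone p hp] at j3
      norm_num at j3
      exact j3
    rw [hz, hone p hp, ← h.fst.surfD_eq p hp, ← h.snd.surfD_eq p hp] at j2
    rw [← h.snd.surfD_eq p hp] at j1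
    simp only [KahlerJInFrame, Real.cos_neg, Real.sin_neg, Real.cos_pi_div_two,
      Real.sin_pi_div_two, neg_neg, neg_zero, zero_smul, add_zero, zero_add, one_smul]
    refine ⟨j2.trans ?_, j1⟩
    norm_num

/-- This gives the density. The condition β = 0 makes the values of ⟨jv, ·⟩ on the frame
real-proportional, so a rotation kills the second one wherever the first is nonzero; isotropy
excludes their common vanishing on an open set. -/
theorem exists_isTotallyRealTypeOn (hf : IsImmersedSurface f) (hTR : IsNKTotallyReal f)
    (hR : IsKahlerTotallyReal f) {W : Set M} (hW : IsOpen W) (hne : W.Nonempty) :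
    ∃ O ⊆ W, IsOpen O ∧ O.Nonempty ∧ IsTotallyRealTypeOn f O := by
  obtain ⟨p₀, hp₀⟩ := hne
  obtain ⟨O, v, w, w', U, V, hO, hpO, hE, hint⟩ := exists_lifted_frame hf p₀
  have hβ : ∀ p ∈ O, (inner ℂ (quatJ (v p)) (w p) *
      conj (inner ℂ (quatJ (v p)) (w' p))).im = 0 := fun p hp => by
    have h1 := (hE.isOrthonormalFrameOn.fubiniStudy_kahlerJ_eq_zero_iff hTR hp).1 (hR p)
    rw [hE.nkMetric_kahlerJ_eq hTR hp] at h1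
    linarith
  have key : ∀ (U V : ∀ p : M, TangentSpace (𝓡 2) p) (w w' : M → C4),
      IsLiftedFrameOn f O v U V w w' →
      (∀ p ∈ O, (inner ℂ (quatJ (v p)) (w p) * conj (inner ℂ (quatJ (v p)) (w' p))).im = 0) →
      (∃ p ∈ O ∩ W, inner ℂ (quatJ (v p)) (w p) ≠ 0) →
      ∃ O ⊆ W, IsOpen O ∧ O.Nonempty ∧ IsTotallyRealTypeOn f O := by
    rintro U V w w' hE hβ ⟨p₁, hp₁, hne⟩
    have hO₁ := hE.continuousOn_inner_quatJ.isOpen_inter_preimage hO (isOpen_ne (x := (0 : ℂ)))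
    have hO₂ := hO₁.inter hW
    set O₂ := O ∩ (fun p => inner ℂ (quatJ (v p)) (w p)) ⁻¹' {y | y ≠ 0} ∩ W
    have hO₂O : O₂ ⊆ O := Set.inter_subset_left.trans Set.inter_subset_left
    have hE₂ := hE.mono hO₂O
    let a : M → ℂ := fun p => inner ℂ (quatJ (v p)) (w p)
    let a' : M → ℂ := fun p => inner ℂ (quatJ (v p)) (w' p)
    have ha0 : ∀ p ∈ O₂, a p ≠ 0 := fun p hp => hp.1.2
    have has : ContMDiffOn (𝓡 2) 𝓘(ℝ, ℂ) ∞ a O₂ :=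
      contMDiffOn_inner (contMDiffOn_quatJ hE₂.lift.smooth) hE₂.fst.smooth_lift
    have has' : ContMDiffOn (𝓡 2) 𝓘(ℝ, ℂ) ∞ a' O₂ :=
      contMDiffOn_inner (contMDiffOn_quatJ hE₂.lift.smooth) hE₂.snd.smooth_lift
    -- The real ratio a'/a is the tangent of the rotation angle: the new frame uses cosine 1/√(1 +
    -- r²) and sine r/√(1 + r²).
    let r : M → ℝ := fun p => (a' p / a p).re
    have hr : ContMDiffOn (𝓡 2) 𝓘(ℝ, ℝ) ∞ r O₂ :=
      ContDiffAt.comp_contMDiffOn (g := fun y : ℂ × ℂ => (y.1 * y.2⁻¹).re)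
        (fun p hp => Complex.reCLM.contDiff.contDiffAt.comp (a' p, a p)
          (contDiffAt_fst.mul (contDiffAt_snd.inv (ha0 p hp)))) (has'.prodMk_space has)
    have hra : ∀ p ∈ O₂, a' p = r p * a p := fun p hp => by
      have h1 : (a' p / a p).im = 0 := by
        have h2 : a' p / a p = conj (a p * conj (a' p)) / (Complex.normSq (a p) : ℝ) := by
          rw [Complex.normSq_eq_conj_mul_self, map_mul, Complex.conj_conj]
          have := (map_ne_zero (starRingEnd ℂ)).2 (ha0 p hp)
          field_simp
        rw [h2, Complex.div_ofReal_im, Complex.conj_im, hβ p (hO₂O hp), neg_zero, zero_div]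
      have h2 : ((r p : ℝ) : ℂ) = a' p / a p := Complex.ext rfl (by rw [h1]; rfl)
      rw [h2, div_mul_cancel₀ _ (ha0 p hp)]
    have hpos : ∀ p, 0 < 1 + r p ^ 2 := fun p => by positivity
    have hc : ContMDiffOn (𝓡 2) 𝓘(ℝ, ℝ) ∞ (fun p => (√(1 + r p ^ 2))⁻¹) O₂ :=
      ContDiffAt.comp_contMDiffOn (g := fun t : ℝ => (√(1 + t ^ 2))⁻¹)
        (fun p _ => ((Real.contDiffAt_sqrt (hpos p).ne').comp (r p)
          (contDiffAt_const.add (contDiffAt_id.pow 2))).inv (Real.sqrt_ne_zero'.2 (hpos p))) hr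
    have hs : ContMDiffOn (𝓡 2) 𝓘(ℝ, ℝ) ∞ (fun p => r p * (√(1 + r p ^ 2))⁻¹) O₂ := hr.mul hc
    have hrot := hE₂.rotate hc hs fun p _ => by
      rw [mul_pow, inv_pow, Real.sq_sqrt (hpos p).le]
      have := (hpos p).ne'
      field_simp
    have hrot0 : ∀ p ∈ O₂, inner ℂ (quatJ (v p)) ((-fun p => r p * (√(1 + r p ^ 2))⁻¹) p • w p +
        (√(1 + r p ^ 2))⁻¹ • w' p) = 0 := fun p hp => by
      rw [inner_add_right, inner_smul_right_eq_smul, inner_smul_right_eq_smul]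
      change (-(r p * (√(1 + r p ^ 2))⁻¹)) • a p + (√(1 + r p ^ 2))⁻¹ • a' p = 0
      rw [hra p hp, Complex.real_smul, Complex.real_smul]
      push_cast
      ring
    have hrot1 : ∀ p ∈ O₂, inner ℂ (quatJ (v p)) ((√(1 + r p ^ 2))⁻¹ • w p +
        (r p * (√(1 + r p ^ 2))⁻¹) • w' p) ≠ 0 := fun p hp => by
      rw [inner_add_right, inner_smul_right_eq_smul, inner_smul_right_eq_smul]
      change (√(1 + r p ^ 2))⁻¹ • a p + (r p * (√(1 + r p ^ 2))⁻¹) • a' p ≠ 0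
      have h1 : (√(1 + r p ^ 2))⁻¹ • a p + (r p * (√(1 + r p ^ 2))⁻¹) • a' p =
          ((√(1 + r p ^ 2))⁻¹ * (1 + r p ^ 2)) • a p := by
        rw [hra p hp]
        simp only [Complex.real_smul]
        push_cast
        ring
      rw [h1]
      exact smul_ne_zero (mul_ne_zero (inv_ne_zero (Real.sqrt_ne_zero'.2 (hpos p))) (hpos p).ne')
        (ha0 p hp)
    obtain ⟨O₃, hO₃, hres⟩ := hrot.exists_isTotallyRealTypeOn hTR hO₂
      ⟨p₁, ⟨hp₁.1, hne⟩, hp₁.2⟩ hrot0 hrot1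
    exact ⟨O₃, hO₃.trans Set.inter_subset_right, hres⟩
  by_cases h1 : ∃ p ∈ O ∩ W, inner ℂ (quatJ (v p)) (w p) ≠ 0
  · exact key U V w w' hE hβ h1
  by_cases h2 : ∃ p ∈ O ∩ W, inner ℂ (quatJ (v p)) (w' p) ≠ 0
  · refine key V U w' w hE.swap (fun p hp => ?_) h2
    have h3 := hβ p hp
    rw [Complex.mul_im, Complex.conj_re, Complex.conj_im] at h3 ⊢
    linarith
  -- Both values vanish on a whole neighbourhood of `p₀`, so the integrability clause of the lifted
  -- frame applies and contradicts the last clause of the algebraic lemma.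
  push Not at h1 h2
  have hp : p₀ ∈ O ∩ W := ⟨hpO, hp₀⟩
  have h3 := hint _ Set.inter_subset_left (hO.inter hW) h1 h2 p₀ hp
  have hpair := hE.isOrthonormalFrameOn.isTotallyRealPair hTR hpO
  rw [hE.fst.surfD_eq p₀ hpO, hE.snd.surfD_eq p₀ hpO] at hpair
  exact absurd h3 ((hpair.kahlerJ_eq_of_inner_quatJ_eq_zero
    (hE.lift.norm_eq p₀ hpO) (hE.lift.hopf_eq p₀ hpO) (hE.fst.horizontal p₀ hpO)
    (hE.snd.horizontal p₀ hpO) (h2 p₀ hp)).2.2.2 (h1 p₀ hp))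

end Frames

end NKCP3

open NKCP3 in
theorem mainTheorem9 {M : Type*} [TopologicalSpace M]
    [ChartedSpace (EuclideanSpace ℝ (Fin 2)) M] [IsManifold (𝓡 2) ∞ M]
    (f : M → CP3) (hf : IsImmersedSurface f) (hTR : IsNKTotallyReal f) :
    (IsKahlerTotallyReal f ↔
      LocallyOnOpenDense fun O : Set M =>
        (∃ lam : M → ℝ, IsType0On f O lam ∧ ∀ p ∈ O, lam p = 0) ∨
        (∃ α : M → ℝ, IsType2On f O α ∧ ∀ p ∈ O, Real.cos (α p) = 0)) ∧
    (IsKahlerAlmostComplex f ↔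
      LocallyOnOpenDense fun O : Set M =>
        ∃ α : M → ℝ, IsType2On f O α ∧ ∀ p ∈ O, Real.sin (α p) = 0) := by
  refine ⟨⟨fun hR => ?_, ?_⟩, fun hC => ?_, ?_⟩
  -- The largest candidate for D, the union of all open sets of the required types.
  · refine ⟨{p | ∃ O : Set M, IsOpen O ∧ p ∈ O ∧ IsTotallyRealTypeOn f O}, ?_, ?_,
      fun p hp => hp⟩
    · refine isOpen_iff_forall_mem_open.2 ?_
      rintro p ⟨O, hO, hp, hQ⟩
      exact ⟨O, fun p' hp' => ⟨O, hO, hp', hQ⟩, hO, hp⟩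
    · refine dense_iff_inter_open.2 fun W hW hne => ?_
      obtain ⟨O, hOW, hO, ⟨p, hp⟩, hQ⟩ := exists_isTotallyRealTypeOn hf hTR hR hW hne
      exact ⟨p, hOW hp, O, hO, hp, hQ⟩
  · rintro ⟨D, -, hD, h⟩
    refine forall_of_dense hf hTR hD continuous_id (fun O U V hE p hp =>
      hE.fubiniStudy_kahlerJ_eq_zero_iff hTR hp) fun p hp => ?_
    obtain ⟨O, -, hpO, hQ⟩ := h p hp
    exact IsTotallyRealTypeOn.fubiniStudy_kahlerJ hQ hTR hpO
  · exact ⟨Set.univ, isOpen_univ, dense_univ, fun p _ =>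
      exists_isAlmostComplexTypeOn hf hTR hC p⟩
  · rintro ⟨D, -, hD, h⟩
    -- Being almost complex is the closed condition β² - 1 = 0 on β = g(J∘U, V).
    refine forall_of_dense hf hTR hD (q := fun t => t ^ 2 - 1) (by fun_prop)
      (fun O U V hE p hp => (hE.kahlerJ_mem_range_iff hTR hp).trans sub_eq_zero.symm)
      fun p hp => ?_
    obtain ⟨O, -, hpO, hQ⟩ := h p hp
    exact IsAlmostComplexTypeOn.exists_kahlerJ_eq hQ hTR hpO
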